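/- **Definitions.** Let $a=(a_1,\dots,a_M)$ with $a_j>0$, and $f_M(t|a)=t^M\prod_{j=1}^M(1-e^{-a_jt})^{-1}$ (singularity at $t=0$ removed), $B_{M,m}(x|a)=\frac{d^m}{dt^m}\big|_{t=0}[f_M(t|a)e^{-xt}]$. For $\Re w>0$ set $$\log\Gamma_M(w|a)=\int_0^\infty\frac{dt}{t^{M+1}}\Bigl(e^{-wt}f_M(t|a)-\sum_{k=0}^{M-1}\frac{t^k}{k!}B_{M,k}(w|a)-\frac{t^Me^{-t}}{M!}B_{M,M}(w|a)\Bigr),\qquad \Gamma_M(w|a)=\exp(\log\Gamma_M(w|a)),$$ so that $\Gamma_0(w)=1/w$; $\Gamma_M(\cdot|a)$ is continued meromorphically to $\mathbb C$ by $\Gamma_M(w|a_1,\dots,a_M)=\Gamma_{M-1}(w|a_2,\dots,a_M)\,\Gamma_M(w+a_1|a)$. Write $\Gamma_2(w|\tau)$ for $\Gamma_2(w|(1,\tau))$. For $b=(b_0,b_1,\dots,b_N)$ positive and $\Re q>-b_0$ let $$(\mathcal S_N\log\Gamma_M)(q|a,b)=\sum_{S\subseteq\{1,\dots,N\}}(-1)^{|S|}\log\Gamma_M\Bigl(q+b_0+\sum_{k\in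 S}b_k\Big|a\Bigr),\qquad \eta_{M,N}(q|a,b)=\exp\bigl((\mathcal S_N\log\Gamma_M)(q|a,b)-(\mathcal S_N\log\Gamma_M)(0|a,b)\bigr).$$ The Barnes beta distribution $\beta_{M,N}(a,b)$ is the probability distribution, on $(0,1]$ if $M\le N$ and on $(0,\infty)$ if $M>N$, with $\mathbf E[\beta_{M,N}(a,b)^q]=\eta_{M,N}(q|a,b)$ for all $\Re q>-b_0$. **Theorem.** Let $\tau>1$ and $\lambda_1,\lambda_2\ge0$, and let $$\mathfrak M(q|\tau,\lambda_1,\lambda_2)=\frac{(2\pi\tau^{1/\tau})^q}{\Gamma(1-\frac1\tau)^q}\,R(q|\tau,\lambda_1,\lambda_2),$$ $$R(q|\tau,\lambda_1,\lambda_2)=\frac{\Gamma_2(\tau(\lambda_1+\lambda_2+1)+1-q|\tau)}{\Gamma_2(\tau(\lambda_1+\lambda_2+1)+1|\tau)}\,\frac{\Gamma_2(\tau-q|\tau)}{\Gamma_2(\tau|\tau)}\,\frac{\Gamma_2(\tau(1+\lambda_1)+1|\tau)}{\Gamma_2(\tau(1+\lambda_1)+1-q|\tau)}\,\frac{\Gamma_2(\tau(1+\lambda_2)+1|\tau)}{\Gamma_2(\tau(1+\lambda_2)+1-q|\tau)},$$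 the same formulas defining $\mathfrak M$ and $R$ with $1/\tau$ in place of $\tau$. 1. For every integer $n\ge0$ with $n<\tau$, $\mathfrak M(n|\tau,\lambda_1,\lambda_2)$ equals the Morris product $$(2\pi)^n\prod_{j=0}^{n-1}\frac{\Gamma(1+\lambda_1+\lambda_2-\frac j\tau)\,\Gamma(1-\frac{j+1}\tau)}{\Gamma(1+\lambda_1-\frac j\tau)\,\Gamma(1+\lambda_2-\frac j\tau)\,\Gamma(1-\frac1\tau)}.$$ 2. The distributions $\beta_{2,2}\bigl((1,\tau);(\tau,1+\tau\lambda_1,1+\tau\lambda_2)\bigr)$ and $\beta_{1,0}\bigl(\tau;\tau(\lambda_1+\lambda_2+1)+1\bigr)$ exist and are unique. With independent $X$, $Y$ having these respective distributions, the law of $$M_{(\tau,\lambda_1,\lambda_2)}=\frac{2\pi\tau^{1/\tau}}{\Gamma(1-1/\tau)}\,X^{-1}Y^{-1}$$ is a probability distribution on $(0,\infty)$ and $\mathbf E[M_{(\tau,\lambda_1,\lambda_2)}^q]=\mathfrak M(q|\tau,\lambda_1,\lambda_2)$ for all complex $q$ with $\Re q<\tau$ (the expectation converging absolutely). 3. $\log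 M_{(\tau,\lambda_1,\lambda_2)}$ is infinitely divisible; $M^{-1}_{(\tau,\lambda_1,\lambda_2)}$ has finite moments of all orders and its Stieltjes moment problem is determinate (its law is the only measure on $[0,\infty)$ with these moments); and for every integer $n\ge0$ $$\mathbf E[M^{-n}_{(\tau,\lambda_1,\lambda_2)}]=(2\pi)^{-n}\prod_{j=0}^{n-1}\frac{\Gamma(1+\lambda_1+\frac{j+1}\tau)\,\Gamma(1+\lambda_2+\frac{j+1}\tau)\,\Gamma(1-\frac1\tau)}{\Gamma(1+\lambda_1+\lambda_2+\frac{j+1}\tau)\,\Gamma(1+\frac j\tau)}.$$ 4. (Involution invariance under $\tau\to1/\tau$, $q\to q/\tau$, $\lambda_i\to\tau\lambda_i$.) For every complex $q$ that is neither of the form $m+n\tau$ with integers $m,n\ge0$ not both $0$, nor of the form $\tau(\lambda_1+\lambda_2+1)+1+m+n\tau$ with integers $m,n\ge0$, $$\bigl((1/\tau)^{\tau}\bigr)^{q/\tau}R\bigl(\tfrac q\tau\big|\tfrac1\tau,\tau\lambda_1,\tau\lambda_2\bigr)\,\Gamma(1-\tfrac q\tau)=\bigl(\tau^{1/\tau}\bigr)^{q}R(q|\tau,\lambda_1,\lambda_2)\,\Gamma(1-q).$$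 Equivalently, if $\tau$ is not an integer (so that $\Gamma(1-\tau)$ is finite; its powers are principal), $$\mathfrak M\bigl(\tfrac q\tau\big|\tfrac1\tau,\tau\lambda_1,\tau\lambda_2\bigr)(2\pi)^{-q/\tau}\,\Gamma(1-\tau)^{q/\tau}\,\Gamma(1-\tfrac q\tau)=\mathfrak M(q|\tau,\lambda_1,\lambda_2)(2\pi)^{-q}\,\Gamma(1-\tfrac1\tau)^{q}\,\Gamma(1-q).$$ 5. If $\lambda_1=\lambda_2=0$, then for every complex $q$ not of the form $\tau+m+n\tau$ with integers $m,n\ge0$, $$\mathfrak M(q|\tau,0,0)=\frac{(2\pi)^q}{\Gamma(1-\frac1\tau)^q}\,\Gamma\bigl(1-\tfrac q\tau\bigr);$$ the distribution $\beta_{1,0}(\tau;\tau)$ exists and is unique, and $M_{(\tau,0,0)}=\frac{2\pi\tau^{1/\tau}}{\Gamma(1-1/\tau)}\,\beta_{1,0}^{-1}(\tau;\tau)$ in law. -/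

import Mathlib

open MeasureTheory

namespace MorrisIntegral

noncomputable section

/-- The function `f_M(t | a) = t ^ M * ∏ j, (1 - exp (-a_j t))⁻¹`, with its removable singularity at
`t = 0` filled in (each factor `t / (1 - exp (-a_j t))` tends to `1 / a_j`). -/
def bernoulliGen {M : ℕ} (a : Fin M → ℝ) (t : ℝ) : ℝ :=
  ∏ j, if t = 0 then (a j)⁻¹ else t / (1 - Real.exp (-(a j * t)))

/-- The multiple Bernoulli polynomial `B_{M,m}(x | a)`, the `m`-th derivative at `t = 0` of
`f_M(t | a) * exp (-x t)`. -/
def multipleBernoulli {M : ℕ} (a : Fin M → ℝ) (m : ℕ) (x : ℂ) : ℂ :=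
  iteratedDeriv m (fun t : ℝ => (bernoulliGen a t : ℂ) * Complex.exp (-(x * (t : ℂ)))) 0

/-- `log Γ_M(w | a)` for `0 < Re w`, in the Ruijsenaars normalization (Malmsten-type integral). -/
def logBarnesGamma {M : ℕ} (a : Fin M → ℝ) (w : ℂ) : ℂ :=
  ∫ t : ℝ in Set.Ioi 0,
    (Complex.exp (-(w * (t : ℂ))) * (bernoulliGen a t : ℂ)
      - ∑ k ∈ Finset.range M, (t : ℂ) ^ k / (k.factorial : ℂ) * multipleBernoulli a k w
      - (t : ℂ) ^ M * Complex.exp (-(t : ℂ)) / (M.factorial : ℂ) * multipleBernoulli a M w)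
      / (t : ℂ) ^ (M + 1)

/-- The number of translations by `c` that bring `w` into the right half-plane
(the least `k` with `0 < Re (w + k c)`, for `0 < c`). -/
def shiftCount (c : ℝ) (w : ℂ) : ℕ :=
  if 0 < w.re then 0 else ⌊-w.re / c⌋₊ + 1

/-- The Barnes multiple gamma function `Γ_M(w | a)` as a meromorphic function on the plane
(value `0` at the poles). On `0 < Re w` it is `exp (log Γ_M(w | a))`, and elsewhere it is continued
by the functional equation `Γ_M(w | a) = Γ_{M-1}(w | a_2, …, a_M) * Γ_M(w + a_1 | a)`;
`Γ_0(w) = 1 / w`. -/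
def barnesGamma : (M : ℕ) → (Fin M → ℝ) → ℂ → ℂ
  | 0, _, w => w⁻¹
  | M + 1, a, w =>
      (∏ j ∈ Finset.range (shiftCount (a 0) w),
          barnesGamma M (Fin.tail a) (w + (j : ℂ) * (a 0 : ℂ)))
        * Complex.exp (logBarnesGamma a (w + (shiftCount (a 0) w : ℂ) * (a 0 : ℂ)))

/-- The double gamma function `Γ_2(w | τ)` with parameters `(1, τ)`. -/
def doubleGamma (τ : ℝ) (w : ℂ) : ℂ :=
  barnesGamma 2 ![1, τ] w

/-- `(𝓢_N log Γ_M)(q | a, b)`: the alternating sum over all subsets `s` of the indices `1, …, N` of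
`log Γ_M(q + b_0 + ∑ k ∈ s, b_k | a)`. -/
def barnesS {M N : ℕ} (a : Fin M → ℝ) (b₀ : ℝ) (b : Fin N → ℝ) (q : ℂ) : ℂ :=
  ∑ s : Finset (Fin N),
    (-1 : ℂ) ^ s.card * logBarnesGamma a (q + (b₀ : ℂ) + ∑ k ∈ s, (b k : ℂ))

/-- `η_{M,N}(q | a, b)`, for `-b_0 < Re q`. -/
def barnesEta {M N : ℕ} (a : Fin M → ℝ) (b₀ : ℝ) (b : Fin N → ℝ) (q : ℂ) : ℂ :=
  Complex.exp (barnesS a b₀ b q - barnesS a b₀ b 0)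

/-- `μ` is the Barnes beta distribution `β_{M,N}(a, b)`: a probability distribution on `(0, 1]`
(if `M ≤ N`), or on `(0, ∞)` (if `N < M`), with Mellin transform `η_{M,N}(q | a, b)` on
`-b_0 < Re q`. -/
structure IsBarnesBeta {M N : ℕ} (a : Fin M → ℝ) (b₀ : ℝ) (b : Fin N → ℝ) (μ : Measure ℝ) :
    Prop where
  isProbabilityMeasure : IsProbabilityMeasure μ
  support : ∀ᵐ x ∂μ, 0 < x ∧ (M ≤ N → x ≤ 1)
  mellin : ∀ q : ℂ, -b₀ < q.re →
    Integrable (fun x : ℝ => (x : ℂ) ^ q) μ ∧ ∫ x : ℝ, (x : ℂ) ^ q ∂μ = barnesEta a b₀ b q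

open scoped Classical in
/-- The distribution `β_{M,N}(a, b)` (junk value `0` if there is none). -/
def barnesBeta {M N : ℕ} (a : Fin M → ℝ) (b₀ : ℝ) (b : Fin N → ℝ) : Measure ℝ :=
  if h : ∃ μ : Measure ℝ, IsBarnesBeta a b₀ b μ then h.choose else 0

/-- The constant `2 π τ^{1/τ} / Γ(1 - 1/τ)`. -/
def morrisConst (τ : ℝ) : ℝ :=
  2 * Real.pi * τ ^ (1 / τ) / Real.Gamma (1 - 1 / τ)

/-- The product of double gamma ratios in the function `𝔐(q | τ, λ₁, λ₂)`. -/
def morrisRatio (q : ℂ) (τ l₁ l₂ : ℝ) : ℂ :=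
  doubleGamma τ (τ * (l₁ + l₂ + 1) + 1 - q) / doubleGamma τ (τ * (l₁ + l₂ + 1) + 1)
    * (doubleGamma τ (-q + τ) / doubleGamma τ τ)
    * (doubleGamma τ (τ * (1 + l₁) + 1) / doubleGamma τ (τ * (1 + l₁) + 1 - q))
    * (doubleGamma τ (τ * (1 + l₂) + 1) / doubleGamma τ (τ * (1 + l₂) + 1 - q))

/-- The function `𝔐(q | τ, λ₁, λ₂)`. -/
def morrisMellin (q : ℂ) (τ l₁ l₂ : ℝ) : ℂ :=
  ((2 * Real.pi * τ ^ (1 / τ) : ℝ) : ℂ) ^ q / ((Real.Gamma (1 - 1 / τ) : ℝ) : ℂ) ^ q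
    * morrisRatio q τ l₁ l₂

/-- The product of gamma functions that evaluates the Morris integral of dimension `n`. -/
def morrisProduct (n : ℕ) (τ l₁ l₂ : ℝ) : ℝ :=
  (2 * Real.pi) ^ n * ∏ j ∈ Finset.range n,
    Real.Gamma (1 + l₁ + l₂ - j / τ) * Real.Gamma (1 - (j + 1) / τ)
      / (Real.Gamma (1 + l₁ - j / τ) * Real.Gamma (1 + l₂ - j / τ) * Real.Gamma (1 - 1 / τ))

/-- The parameters of the factor `β_{2,2}` are `a = (1, τ)`, `b = (τ, 1 + τ λ₁, 1 + τ λ₂)`. -/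
def morrisBeta22 (τ l₁ l₂ : ℝ) : Measure ℝ :=
  barnesBeta ![1, τ] τ ![1 + τ * l₁, 1 + τ * l₂]

/-- The parameters of the factor `β_{1,0}` are `a = τ`, `b_0 = τ (λ₁ + λ₂ + 1) + 1`. -/
def morrisBeta10 (τ l₁ l₂ : ℝ) : Measure ℝ :=
  barnesBeta ![τ] (τ * (l₁ + l₂ + 1) + 1) ![]

/-- The law of `M_{(τ, λ₁, λ₂)} = (2 π τ^{1/τ} / Γ(1 - 1/τ)) * X⁻¹ * Y⁻¹` with `X`, `Y` independent,
`X` distributed as `β_{2,2}` and `Y` as `β_{1,0}`. -/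
def morrisLaw (τ l₁ l₂ : ℝ) : Measure ℝ :=
  ((morrisBeta22 τ l₁ l₂).prod (morrisBeta10 τ l₁ l₂)).map
    (fun p => morrisConst τ * p.1⁻¹ * p.2⁻¹)

/-- A probability distribution on the line is infinitely divisible if for every `n ≥ 1` it is the
law of a sum of `n` independent identically distributed random variables. -/
def IsInfinitelyDivisible (ν : Measure ℝ) : Prop :=
  IsProbabilityMeasure ν ∧ ∀ n : ℕ, 0 < n → ∃ ρ : Measure ℝ, IsProbabilityMeasure ρ ∧
    (Measure.pi (fun _ : Fin n => ρ)).map (fun x => ∑ i, x i) = ν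

/-- `ν` is a measure on `[0, ∞)` with finite moments of all orders, and it is the only measure on
`[0, ∞)` with its moments. -/
def StieltjesDeterminate (ν : Measure ℝ) : Prop :=
  (∀ᵐ x ∂ν, 0 ≤ x) ∧ (∀ n : ℕ, Integrable (fun x : ℝ => x ^ n) ν) ∧
    ∀ ν' : Measure ℝ, (∀ᵐ x ∂ν', 0 ≤ x) → (∀ n : ℕ, Integrable (fun x : ℝ => x ^ n) ν') →
      (∀ n : ℕ, ∫ x, x ^ n ∂ν' = ∫ x, x ^ n ∂ν) → ν' = ν

end

end MorrisIntegral

/-!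
# The Mellin transform of the Morris integral law

Everything about the double gamma function rests on its Malmsten-type integral. Subtracting the
integrals at `w` and `w + c` multiplies the generating function `f_M` by `1 - exp (-c t)`, which
removes one period (`logBarnesGamma_eq_add_shift`); this yields the two functional equations
`Γ₂(w | τ) = Γ₁(w | τ) Γ₂(w + 1 | τ) = Γ₁(w | 1) Γ₂(w + τ | τ)`, with `Γ₁` an elementary multiple of
Euler's gamma function (`exp_logBarnesGamma_one`). The shift `q ↦ q + 1` in the Mellin transform `𝔐`
therefore multiplies it by a ratio of four gamma functions, and the product formulas at the positive
and negative integers follow by induction from `𝔐(0) = 1`. Scaling `t` in the integral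
(`logBarnesGamma_scale`) interchanges the periods `(1, τ)` and `(1, 1 / τ)` up to the factor
`τ ^ (B_{2,2}(w) / 2)`; in the involution the linear and constant parts of this quadratic exponent
cancel between the ratios of `Γ₂`, and its quadratic part contributes the power `τ ^ q`.

On the probabilistic side, `-log β_{2,2}` has Laplace exponent
`∫ (exp (-q t) - 1) exp (-b₀ t) (1 - exp (-b₁ t)) (1 - exp (-b₂ t)) f₂(t) dt / t ^ 3`: the alternating
sum `𝓢₂` is a second difference in the argument of `log Γ₂`, which annihilates the subtracted
polynomials up to a constant. Its Lévy density is nonnegative with `∫ t k(t) dt` finite, so it belongs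
to a positive infinitely divisible law, obtained as a limit of compound Poisson laws
(`exists_subordinator`). That its Mellin transform is `η_{2,2}` is first known on the imaginary axis,
and extends by analytic continuation to the half-plane in which the exponential moments are finite. The
distribution `β_{1,0}(τ; b)` is the law of `(τ G)^{1/τ}` with `G` of gamma distribution of shape
`b / τ`. The Mellin transform on the imaginary axis is the characteristic function of the logarithm,
whence uniqueness.

The Mellin transform of `M` is the product of those of its factors, and `log M` has the sum of their
Lévy densities, now only with `∫ t ^ 2 k(t) dt` finite near the origin, so that a compensator is needed;
dividing the exponent by `n` gives infinite divisibility (`exists_levyKhintchine`). Finally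
`M⁻¹ = X Y / c` with `X ≤ 1`, and for `τ > 1` the tail of `Y` is lighter than any exponential, so the
moment series of `M⁻¹` sums to its characteristic function and determines the law.
-/
namespace MorrisIntegral

open MeasureTheory ProbabilityTheory Filter Topology

/-! ### Weak limits and compound Poisson laws -/

/-- Lévy's continuity theorem in the form that produces the limit law. Fatou's lemma for weak
convergence carries upper bounds for integrals of nonnegative continuous functions over to it. -/
theorem exists_limit_of_tendsto_charFun {Q : ℕ → Measure ℝ} [∀ n, IsProbabilityMeasure (Q n)]
    {φ : ℝ → ℂ} (hφ : ContinuousAt φ 0)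
    (h : ∀ u, Tendsto (fun n => charFun (Q n) u) atTop (𝓝 (φ u))) :
    ∃ P : Measure ℝ, IsProbabilityMeasure P ∧ (∀ u, charFun P u = φ u) ∧
      ∀ g : ℝ → ℝ, Continuous g → (∀ x, 0 ≤ g x) → ∀ C : ENNReal,
        (∀ n, ∫⁻ x, ENNReal.ofReal (g x) ∂(Q n) ≤ C) → ∫⁻ x, ENNReal.ofReal (g x) ∂P ≤ C := by
  have htight : IsTightMeasureSet (Set.range Q) := isTightMeasureSet_of_tendsto_charFun hφ h
  let R : ℕ → ProbabilityMeasure ℝ := fun n => ⟨Q n, inferInstance⟩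
  have hcomp : IsCompact (closure (Set.range R)) := by
    apply isCompact_closure_of_isTightMeasureSet
    convert! htight using 1
    ext μ
    constructor
    · rintro ⟨_, ⟨n, rfl⟩, rfl⟩
      exact ⟨n, rfl⟩
    · rintro ⟨n, rfl⟩
      exact ⟨R n, ⟨n, rfl⟩, rfl⟩
  obtain ⟨P, -, s, hs, hlim⟩ := hcomp.tendsto_subseq (fun n => subset_closure (Set.mem_range_self n))
  have hchar : ∀ u, charFun (P : Measure ℝ) u = φ u := fun u =>
    tendsto_nhds_unique (ProbabilityMeasure.tendsto_iff_tendsto_charFun.1 hlim u)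
      ((h u).comp hs.tendsto_atTop)
  have hR : Tendsto R atTop (𝓝 P) := by
    refine ProbabilityMeasure.tendsto_of_tendsto_charFun fun u => ?_
    rw [hchar u]
    exact h u
  refine ⟨P, inferInstance, hchar, fun g hg hg0 C hC => ?_⟩
  refine (lintegral_le_liminf_lintegral_of_forall_isOpen_measure_le_liminf_measure
    (μs := Q) hg hg0 fun G hG => ProbabilityMeasure.le_liminf_measure_open_of_tendsto hR hG).trans ?_
  exact (liminf_le_liminf (Eventually.of_forall hC)).trans_eq (by simp)

theorem charFun_map_sum_pi (ρ : Measure ℝ) [IsProbabilityMeasure ρ] (n : ℕ) (u : ℝ) :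
    charFun ((Measure.pi fun _ : Fin n => ρ).map fun x => ∑ i, x i) u = charFun ρ u ^ n := by
  rw [charFun_apply_real, integral_map (by fun_prop) (by fun_prop), charFun_apply_real]
  rw [← Fintype.card_fin n, ← integral_fintype_prod_eq_pow, Fintype.card_fin]
  congr 1
  ext x
  push_cast
  rw [← Complex.exp_sum, Finset.mul_sum, Finset.sum_mul]

theorem isProbabilityMeasure_map_sum_pi (ρ : Measure ℝ) [IsProbabilityMeasure ρ] (n : ℕ) :
    IsProbabilityMeasure ((Measure.pi fun _ : Fin n => ρ).map fun x => ∑ i, x i) :=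
  Measure.isProbabilityMeasure_map (by fun_prop)

theorem lintegral_exp_map_sum_pi (ρ : Measure ℝ) [IsProbabilityMeasure ρ] (n : ℕ) (p : ℝ)
    (hp : Integrable (fun x => Real.exp (p * x)) ρ) :
    ∫⁻ x, ENNReal.ofReal (Real.exp (p * x)) ∂((Measure.pi fun _ : Fin n => ρ).map
      fun x => ∑ i, x i) = ENNReal.ofReal ((∫ x, Real.exp (p * x) ∂ρ) ^ n) := by
  rw [lintegral_map (by fun_prop) (by fun_prop)]
  have h1 : ∀ x : Fin n → ℝ, Real.exp (p * ∑ i, x i) = ∏ i, Real.exp (p * x i) := fun x => by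
    rw [← Real.exp_sum, Finset.mul_sum]
  simp_rw [h1]
  rw [← ofReal_integral_eq_lintegral_ofReal, integral_fintype_prod_eq_pow
    (fun x => Real.exp (p * x)), Fintype.card_fin]
  · exact Integrable.fintype_prod (f := fun _ x => Real.exp (p * x)) fun _ => hp
  · exact Eventually.of_forall fun x => Finset.prod_nonneg fun i _ => (Real.exp_pos _).le

/-- The compound Poisson law with finite jump measure `ν`, obtained as the limit of the laws of
sums of `n` independent jumps that are absent with probability `1 - ν(ℝ) / n`. -/
theorem exists_compoundPoisson (ν : Measure ℝ) [IsFiniteMeasure ν] :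
    ∃ P : Measure ℝ, IsProbabilityMeasure P ∧
      (∀ u : ℝ, charFun P u = Complex.exp (∫ t : ℝ, (Complex.exp (u * t * Complex.I) - 1) ∂ν)) ∧
      ((∀ᵐ t ∂ν, 0 ≤ t) → ∀ᵐ x ∂P, 0 ≤ x) ∧
      ∀ p : ℝ, Integrable (fun t => Real.exp (p * t)) ν →
        ∫⁻ x, ENNReal.ofReal (Real.exp (p * x)) ∂P
          ≤ ENNReal.ofReal (Real.exp (∫ t, (Real.exp (p * t) - 1) ∂ν)) := by
  set l : ℝ := ν.real Set.univ with hl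
  have hl0 : 0 ≤ l := measureReal_nonneg
  obtain ⟨N, hN⟩ := exists_nat_gt l
  -- The number of summands exceeds `l`, so that the atom at `0` has nonnegative mass.
  let m : ℕ → ℕ := fun n => n + N + 1
  have hm : ∀ n, l ≤ m n := fun n => by simp only [m]; push_cast; linarith [n.cast_nonneg (α := ℝ)]
  have hmpos : ∀ n, (0 : ℝ) < m n := fun n => by simp only [m]; positivity
  let ρ : ℕ → Measure ℝ := fun n =>
    ENNReal.ofReal (1 - l / m n) • Measure.dirac 0 + ENNReal.ofReal (1 / m n) • ν
  have hsub : ∀ n, 0 ≤ 1 - l / m n := fun n => by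
    rw [sub_nonneg, div_le_one (hmpos n)]; exact hm n
  have hρ : ∀ n, IsProbabilityMeasure (ρ n) := fun n => by
    constructor
    have hν : ν Set.univ = ENNReal.ofReal l := by rw [hl, ofReal_measureReal]
    simp only [ρ, Measure.add_apply, Measure.smul_apply, smul_eq_mul, measure_univ, mul_one, hν]
    rw [← ENNReal.ofReal_mul (by positivity), ← ENNReal.ofReal_add (hsub n) (by positivity)]
    rw [← ENNReal.ofReal_one]
    congr 1
    ring
  have hint : ∀ n, ∀ {E : Type} [NormedAddCommGroup E] [NormedSpace ℝ E] [CompleteSpace E]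
      (f : ℝ → E), StronglyMeasurable f → Integrable f ν → Integrable f (ρ n) ∧
        ∫ x, f x ∂(ρ n) = (1 - l / m n) • f 0 + (1 / (m n : ℝ)) • ∫ x, f x ∂ν := by
    intro n E _ _ _ f hfm hf
    have h1 : Integrable f (ENNReal.ofReal (1 - l / m n) • Measure.dirac (0 : ℝ)) :=
      (integrable_dirac' hfm (by simp)).smul_measure ENNReal.ofReal_ne_top
    have h2 : Integrable f (ENNReal.ofReal (1 / m n) • ν) := hf.smul_measure ENNReal.ofReal_ne_top
    refine ⟨h1.add_measure h2, ?_⟩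
    rw [integral_add_measure h1 h2, integral_smul_measure, integral_smul_measure, integral_dirac,
      ENNReal.toReal_ofReal (hsub n), ENNReal.toReal_ofReal (by positivity)]
  let Q : ℕ → Measure ℝ := fun n => (Measure.pi fun _ : Fin (m n) => ρ n).map fun x => ∑ i, x i
  have hQ : ∀ n, IsProbabilityMeasure (Q n) := fun n => isProbabilityMeasure_map_sum_pi (ρ n) (m n)
  have hci : ∀ u : ℝ, Integrable (fun t : ℝ => Complex.exp (u * t * Complex.I)) ν := fun u => by
    refine Integrable.of_bound (by fun_prop) 1 (Eventually.of_forall fun t => ?_)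
    rw [← Complex.ofReal_mul, Complex.norm_exp_ofReal_mul_I]
  have hlim : ∀ u : ℝ, Tendsto (fun n => charFun (Q n) u) atTop
      (𝓝 (Complex.exp (∫ t : ℝ, (Complex.exp (u * t * Complex.I) - 1) ∂ν))) := by
    intro u
    have h1 : ∀ n, charFun (Q n) u =
        (1 + (∫ t : ℝ, (Complex.exp (u * t * Complex.I) - 1) ∂ν) / (m n : ℂ)) ^ (m n) := by
      intro n
      have := (hmpos n).ne'
      simp only [Q]
      rw [charFun_map_sum_pi, charFun_apply_real,
        (hint n _ (by fun_prop) (hci u)).2, integral_sub (hci u) (integrable_const _)]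
      have : (m n : ℂ) ≠ 0 := by exact_mod_cast this
      generalize (∫ t : ℝ, Complex.exp (u * t * Complex.I) ∂ν) = J
      congr 1
      simp [← hl]
      field_simp
      ring
    simp_rw [h1]
    have h2 : Tendsto m atTop atTop :=
      tendsto_atTop_mono (fun n => by simp only [m, id_eq]; omega) tendsto_id
    exact (Complex.tendsto_one_add_div_pow_exp _).comp h2
  have hcont : ContinuousAt
      (fun u : ℝ => Complex.exp (∫ t : ℝ, (Complex.exp (u * t * Complex.I) - 1) ∂ν)) 0 := by
    refine (Continuous.cexp ?_).continuousAt
    refine continuous_of_dominated (bound := fun _ => 2) (fun u => by fun_prop) (fun u => ?_)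
      (integrable_const _) (Eventually.of_forall fun t => by fun_prop)
    refine Eventually.of_forall fun t => (norm_sub_le _ _).trans ?_
    rw [← Complex.ofReal_mul, Complex.norm_exp_ofReal_mul_I]
    norm_num
  obtain ⟨P, hP, hPc, hPg⟩ := exists_limit_of_tendsto_charFun hcont hlim
  refine ⟨P, hP, hPc, fun hν => ?_, fun p hp => ?_⟩
  -- Testing the approximations against the negative part of `x` shows that `P` is nonnegative.
  · have h0 : ∫⁻ x, ENNReal.ofReal (max (-x) 0) ∂P ≤ 0 := by
      refine hPg (fun x => max (-x) 0) (by fun_prop) (fun x => le_max_right _ _) 0 fun n => ?_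
      have hρ0 : ∀ᵐ t ∂(ρ n), 0 ≤ t := by
        rw [ae_add_measure_iff]
        refine ⟨Measure.ae_smul_measure ?_ _, Measure.ae_smul_measure hν _⟩
        rw [ae_dirac_iff measurableSet_Ici]
      have hQ0 : ∀ᵐ x ∂(Q n), 0 ≤ x := by
        rw [ae_map_iff (by fun_prop) measurableSet_Ici]
        have : ∀ i : Fin (m n), ∀ᵐ x ∂(Measure.pi fun _ : Fin (m n) => ρ n), 0 ≤ x i := fun i =>
          (Measure.tendsto_eval_ae_ae (μ := fun _ : Fin (m n) => ρ n) (i := i)).eventually hρ0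
        filter_upwards [ae_all_iff.2 this] with x hx
        exact Finset.sum_nonneg fun i _ => hx i
      rw [lintegral_congr_ae (g := fun _ => 0)]
      · simp
      · filter_upwards [hQ0] with x hx
        simp [hx]
    rw [nonpos_iff_eq_zero, lintegral_eq_zero_iff (by fun_prop)] at h0
    filter_upwards [h0] with x hx
    simpa using hx
  · refine hPg (fun x => Real.exp (p * x)) (by fun_prop) (fun x => (Real.exp_pos _).le) _ fun n => ?_
    have h1 := hint n (fun x => Real.exp (p * x)) (by fun_prop) hp
    simp only [Q]
    rw [lintegral_exp_map_sum_pi _ _ _ h1.1, h1.2, integral_sub hp (integrable_const _)]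
    refine ENNReal.ofReal_le_ofReal ?_
    set E := ∫ x, Real.exp (p * x) ∂ν
    have hE : 0 ≤ E := integral_nonneg fun x => (Real.exp_pos _).le
    simp only [mul_zero, Real.exp_zero, smul_eq_mul, integral_const, mul_one, ← hl]
    have h2 : 1 - l / m n + 1 / m n * E ≤ Real.exp ((E - l) / m n) := by
      have := Real.add_one_le_exp ((E - l) / m n)
      refine le_trans (le_of_eq ?_) this
      ring
    refine (pow_le_pow_left₀ ?_ h2 _).trans_eq ?_
    · have := hsub n
      positivity
    · rw [← Real.exp_nat_mul]
      congr 1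
      have := (hmpos n).ne'
      field_simp

/-! ### Infinitely divisible laws with Lévy measure on the half-line -/

theorem norm_exp_sub_one_le_of_re_nonpos {z : ℂ} (hz : z.re ≤ 0) : ‖Complex.exp z - 1‖ ≤ ‖z‖ := by
  have hconv : Convex ℝ {w : ℂ | w.re ≤ 0} := convex_halfSpace_re_le 0
  have := hconv.norm_image_sub_le_of_norm_hasDerivWithin_le (f := Complex.exp) (f' := Complex.exp)
    (C := 1) (x := 0) (y := z) (fun w _ => (Complex.hasDerivAt_exp w).hasDerivWithinAt)
    (fun w hw => by rw [Complex.norm_exp]; exact Real.exp_le_one_iff.2 hw) (by simp) hz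
  simpa using this

theorem norm_exp_sub_one_sub_le_of_re_nonpos {z : ℂ} (hz : z.re ≤ 0) :
    ‖Complex.exp z - 1 - z‖ ≤ 2 * ‖z‖ ^ 2 := by
  rcases le_or_gt ‖z‖ 1 with h | h
  · have := Complex.norm_exp_sub_one_sub_id_le h
    nlinarith [sq_nonneg ‖z‖]
  · have := norm_exp_sub_one_le_of_re_nonpos hz
    have h2 := norm_sub_le (Complex.exp z - 1) z
    nlinarith

theorem iUnion_Ioi_one_div : (⋃ n : ℕ, Set.Ioi (1 / ((n : ℝ) + 1))) = Set.Ioi 0 := by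
  ext t
  simp only [Set.mem_iUnion, Set.mem_Ioi]
  refine ⟨fun ⟨n, hn⟩ => lt_trans (by positivity) hn, fun h => exists_nat_one_div_lt h⟩

theorem tendsto_integral_Ioi_one_div {E : Type*} [NormedAddCommGroup E] [NormedSpace ℝ E]
    {f : ℝ → E} (hf : IntegrableOn f (Set.Ioi 0)) :
    Tendsto (fun n : ℕ => ∫ t in Set.Ioi (1 / ((n : ℝ) + 1)), f t) atTop
      (𝓝 (∫ t in Set.Ioi 0, f t)) := by
  rw [← iUnion_Ioi_one_div] at hf ⊢
  refine tendsto_setIntegral_of_monotone (fun n => measurableSet_Ioi) (fun m n h => ?_) hf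
  exact Set.Ioi_subset_Ioi (one_div_le_one_div_of_le (by positivity) (by gcongr))

theorem integrableOn_Ioi_of_pow_mul {k : ℝ → ℝ} (hk : Measurable k) (j : ℕ)
    (h : IntegrableOn (fun t => t ^ j * k t) (Set.Ioi 0)) {ε : ℝ} (hε : 0 < ε) :
    IntegrableOn k (Set.Ioi ε) := by
  have h' : IntegrableOn (fun t => t ^ j * k t) (Set.Ioi ε) :=
    h.mono_set (Set.Ioi_subset_Ioi hε.le)
  refine Integrable.mono' (h'.norm.const_mul (1 / ε ^ j)) hk.aestronglyMeasurable ?_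
  refine (ae_restrict_iff' measurableSet_Ioi).2 (Eventually.of_forall fun t ht => ?_)
  have ht0 : 0 < t := hε.trans ht
  rw [norm_mul, norm_pow, Real.norm_of_nonneg ht0.le, ← mul_assoc]
  refine le_mul_of_one_le_left (norm_nonneg _) ?_
  rw [one_div_mul_eq_div, one_le_div (by positivity)]
  exact pow_le_pow_left₀ hε.le (le_of_lt ht) j

/-- The compound Poisson law whose jump measure has density `k` on `(ε, ∞)`. -/
theorem exists_compoundPoisson_density {k : ℝ → ℝ} (hk : Measurable k)
    (hk0 : ∀ t, 0 < t → 0 ≤ k t) {ε : ℝ} (hε : 0 < ε) (hint : IntegrableOn k (Set.Ioi ε)) :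
    ∃ P : Measure ℝ, IsProbabilityMeasure P ∧
      (∀ u : ℝ, charFun P u =
        Complex.exp (∫ t : ℝ in Set.Ioi ε, (Complex.exp (u * t * Complex.I) - 1) * k t)) ∧
      (∀ᵐ x ∂P, 0 ≤ x) ∧
      ∀ p : ℝ, IntegrableOn (fun t => (Real.exp (p * t) - 1) * k t) (Set.Ioi ε) →
        ∫⁻ x, ENNReal.ofReal (Real.exp (p * x)) ∂P
          ≤ ENNReal.ofReal (Real.exp (∫ t in Set.Ioi ε, (Real.exp (p * t) - 1) * k t)) := by
  have hk0' : ∀ t ∈ Set.Ioi ε, 0 ≤ k t := fun t ht => hk0 t (hε.trans ht)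
  set ν : Measure ℝ := (volume.restrict (Set.Ioi ε)).withDensity fun t => ENNReal.ofReal (k t)
    with hν
  have hfin : IsFiniteMeasure ν := isFiniteMeasure_withDensity_ofReal hint.2
  have hconv : ∀ {E : Type} [NormedAddCommGroup E] [NormedSpace ℝ E] (f : ℝ → E),
      ∫ t, f t ∂ν = ∫ t in Set.Ioi ε, k t • f t := by
    intro E _ _ f
    rw [hν, integral_withDensity_eq_integral_toReal_smul (by fun_prop) (by simp)]
    refine setIntegral_congr_fun measurableSet_Ioi fun t ht => ?_
    simp only [ENNReal.toReal_ofReal (hk0' t ht)]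
  obtain ⟨P, hP, h1, h2, h3⟩ := exists_compoundPoisson ν
  refine ⟨P, hP, fun u => ?_, h2 ?_, fun p hp => ?_⟩
  · rw [h1, hconv]
    congr 2
    ext t
    rw [Complex.real_smul, mul_comm]
  · rw [hν, ae_withDensity_iff (by fun_prop)]
    refine (ae_restrict_iff' measurableSet_Ioi).2 (Eventually.of_forall fun t ht _ => ?_)
    exact (hε.trans ht).le
  · have hp' : Integrable (fun t => Real.exp (p * t)) ν := by
      rw [hν, integrable_withDensity_iff_integrable_smul₀' (by fun_prop) (by simp)]
      refine (hp.add hint).congr ?_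
      refine (ae_restrict_iff' measurableSet_Ioi).2 (Eventually.of_forall fun t ht => ?_)
      simp only [ENNReal.toReal_ofReal (hk0' t ht), Pi.add_apply, smul_eq_mul]
      ring
    refine (h3 p hp').trans_eq ?_
    rw [hconv]
    simp_rw [smul_eq_mul, mul_comm]

/-- The law of a subordinator without drift at time one, with Lévy density `k` such that
`t * k t` is integrable. It is the limit of the compound Poisson laws with jumps larger than
`1 / (n + 1)`. -/
theorem exists_subordinator {k : ℝ → ℝ} (hk : Measurable k) (hk0 : ∀ t, 0 < t → 0 ≤ k t)
    (hint : IntegrableOn (fun t => t * k t) (Set.Ioi 0)) :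
    ∃ P : Measure ℝ, IsProbabilityMeasure P ∧
      (∀ u : ℝ, charFun P u =
        Complex.exp (∫ t : ℝ in Set.Ioi 0, (Complex.exp (u * t * Complex.I) - 1) * k t)) ∧
      (∀ᵐ x ∂P, 0 ≤ x) ∧
      ∀ p : ℝ, 0 ≤ p → IntegrableOn (fun t => (Real.exp (p * t) - 1) * k t) (Set.Ioi 0) →
        ∫⁻ x, ENNReal.ofReal (Real.exp (p * x)) ∂P
          ≤ ENNReal.ofReal (Real.exp (∫ t in Set.Ioi 0, (Real.exp (p * t) - 1) * k t)) := by
  have hε : ∀ n : ℕ, (0 : ℝ) < 1 / ((n : ℝ) + 1) := fun n => by positivity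
  choose Q hQ hQc hQ0 hQp using fun n : ℕ => exists_compoundPoisson_density hk hk0 (hε n)
    (integrableOn_Ioi_of_pow_mul hk 1 (by simpa using hint) (hε n))
  have hbound : ∀ u t : ℝ, 0 < t →
      ‖(Complex.exp (u * t * Complex.I) - 1) * k t‖ ≤ |u| * (t * k t) := by
    intro u t ht
    rw [norm_mul, Complex.norm_real, Real.norm_of_nonneg (hk0 t ht), ← mul_assoc]
    refine mul_le_mul_of_nonneg_right ?_ (hk0 t ht)
    refine (norm_exp_sub_one_le_of_re_nonpos (by simp)).trans_eq ?_
    simp [abs_of_pos ht]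
  have hci : ∀ u : ℝ, IntegrableOn
      (fun t : ℝ => (Complex.exp (u * t * Complex.I) - 1) * k t) (Set.Ioi 0) := by
    intro u
    refine Integrable.mono' (hint.const_mul |u|) (by fun_prop) ?_
    exact (ae_restrict_iff' measurableSet_Ioi).2 (Eventually.of_forall fun t ht => hbound u t ht)
  have hlim : ∀ u : ℝ, Tendsto (fun n => charFun (Q n) u) atTop
      (𝓝 (Complex.exp (∫ t : ℝ in Set.Ioi 0, (Complex.exp (u * t * Complex.I) - 1) * k t))) := by
    intro u
    simp_rw [hQc]
    exact (Complex.continuous_exp.tendsto _).comp (tendsto_integral_Ioi_one_div (hci u))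
  have hcont : ContinuousAt (fun u : ℝ =>
      Complex.exp (∫ t : ℝ in Set.Ioi 0, (Complex.exp (u * t * Complex.I) - 1) * k t)) 0 := by
    refine Complex.continuous_exp.continuousAt.comp (continuousAt_of_dominated
      (bound := fun t => t * k t) (Eventually.of_forall fun u => by fun_prop) ?_ hint
      (Eventually.of_forall fun t => by fun_prop))
    filter_upwards [Metric.ball_mem_nhds (0 : ℝ) one_pos] with u hu
    refine (ae_restrict_iff' measurableSet_Ioi).2 (Eventually.of_forall fun t ht => ?_)
    refine (hbound u t ht).trans (mul_le_of_le_one_left (mul_nonneg (le_of_lt ht) (hk0 t ht)) ?_)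
    simpa using (mem_ball_zero_iff.1 hu).le
  obtain ⟨P, hP, hPc, hPg⟩ := exists_limit_of_tendsto_charFun hcont hlim
  refine ⟨P, hP, hPc, ?_, fun p hp hpi => ?_⟩
  · have h0 : ∫⁻ x, ENNReal.ofReal (max (-x) 0) ∂P ≤ 0 := by
      refine hPg (fun x => max (-x) 0) (by fun_prop) (fun x => le_max_right _ _) 0 fun n => ?_
      rw [lintegral_congr_ae (g := fun _ => 0)]
      · simp
      · filter_upwards [hQ0 n] with x hx
        simp [hx]
    rw [nonpos_iff_eq_zero, lintegral_eq_zero_iff (by fun_prop)] at h0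
    filter_upwards [h0] with x hx
    simpa using hx
  · refine hPg (fun x => Real.exp (p * x)) (by fun_prop) (fun x => (Real.exp_pos _).le) _ fun n => ?_
    have hsub : Set.Ioi (1 / ((n : ℝ) + 1)) ⊆ Set.Ioi 0 := Set.Ioi_subset_Ioi (hε n).le
    refine (hQp n p (hpi.mono_set hsub)).trans (ENNReal.ofReal_le_ofReal (Real.exp_le_exp.2 ?_))
    refine setIntegral_mono_set hpi ?_ hsub.eventuallyLE
    refine (ae_restrict_iff' measurableSet_Ioi).2 (Eventually.of_forall fun t ht => ?_)
    have : 1 ≤ Real.exp (p * t) := Real.one_le_exp (mul_nonneg hp (le_of_lt ht))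
    exact mul_nonneg (by linarith) (hk0 t ht)

/-- The integrand of the Lévy–Khintchine exponent with compensator `c` is dominated by a quantity
that does not depend on the frequency in a bounded range. -/
theorem norm_levyKhintchine_integrand_le {k c : ℝ → ℝ} (hk0 : ∀ t, 0 < t → 0 ≤ k t) (u : ℝ) {t : ℝ}
    (ht : 0 < t) : ‖(Complex.exp (u * t * Complex.I) - 1) * k t - u * Complex.I * c t‖
      ≤ 2 * u ^ 2 * (t ^ 2 * k t) + |u| * ‖t * k t - c t‖ := by
  have h1 : (Complex.exp (u * t * Complex.I) - 1) * k t - u * Complex.I * c t =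
      (Complex.exp (u * t * Complex.I) - 1 - u * t * Complex.I) * k t
        + u * Complex.I * ((t * k t - c t : ℝ) : ℂ) := by
    push_cast
    ring
  rw [h1]
  refine (norm_add_le _ _).trans (add_le_add ?_ (le_of_eq ?_))
  swap
  · rw [norm_mul, norm_mul, Complex.norm_I, mul_one, Complex.norm_real, Complex.norm_real,
      Real.norm_eq_abs u]
  rw [norm_mul, Complex.norm_real, Real.norm_of_nonneg (hk0 t ht), ← mul_assoc]
  refine mul_le_mul_of_nonneg_right ?_ (hk0 t ht)
  refine (norm_exp_sub_one_sub_le_of_re_nonpos (by simp)).trans_eq ?_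
  simp [mul_pow]
  ring

/-- The Lévy–Khintchine law with drift `b`, Lévy density `k` on `(0, ∞)` and compensator `c`. -/
theorem exists_levyKhintchine {k c : ℝ → ℝ} (hk : Measurable k) (hc : Measurable c)
    (hk0 : ∀ t, 0 < t → 0 ≤ k t)
    (hk2 : IntegrableOn (fun t => t ^ 2 * k t) (Set.Ioi 0))
    (hkc : IntegrableOn (fun t => t * k t - c t) (Set.Ioi 0)) (b : ℝ) :
    ∃ P : Measure ℝ, IsProbabilityMeasure P ∧ ∀ u : ℝ, charFun P u =
        Complex.exp (u * Complex.I * b + ∫ t : ℝ in Set.Ioi 0,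
          ((Complex.exp (u * t * Complex.I) - 1) * k t - u * Complex.I * c t)) := by
  have hε : ∀ n : ℕ, (0 : ℝ) < 1 / ((n : ℝ) + 1) := fun n => by positivity
  have hki : ∀ n : ℕ, IntegrableOn k (Set.Ioi (1 / ((n : ℝ) + 1))) := fun n =>
    integrableOn_Ioi_of_pow_mul hk 2 hk2 (hε n)
  have hsub : ∀ n : ℕ, Set.Ioi (1 / ((n : ℝ) + 1)) ⊆ Set.Ioi 0 := fun n =>
    Set.Ioi_subset_Ioi (hε n).le
  have hci : ∀ n : ℕ, IntegrableOn c (Set.Ioi (1 / ((n : ℝ) + 1))) := by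
    intro n
    have h1 : IntegrableOn (fun t => t * k t) (Set.Ioi (1 / ((n : ℝ) + 1))) := by
      refine integrableOn_Ioi_of_pow_mul (by fun_prop) 1 ?_ (hε n)
      refine hk2.congr_fun (fun t _ => ?_) measurableSet_Ioi
      simp only
      ring
    refine (h1.sub (hkc.mono_set (hsub n))).congr (Eventually.of_forall fun t => ?_)
    simp
  choose Q hQ hQc _ _ using fun n : ℕ => exists_compoundPoisson_density hk hk0 (hε n) (hki n)
  -- The centring by the integral of `c` keeps the translated compound Poisson laws convergent.
  let R : ℕ → Measure ℝ := fun n =>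
    (Q n).map fun x => x + (b - ∫ t in Set.Ioi (1 / ((n : ℝ) + 1)), c t)
  have hR : ∀ n, IsProbabilityMeasure (R n) := fun n =>
    Measure.isProbabilityMeasure_map (by fun_prop)
  have hbound := fun (u : ℝ) {t : ℝ} (ht : 0 < t) =>
    norm_levyKhintchine_integrand_le (c := c) hk0 u ht
  have hgi : ∀ u : ℝ, IntegrableOn (fun t : ℝ =>
      (Complex.exp (u * t * Complex.I) - 1) * k t - u * Complex.I * c t) (Set.Ioi 0) := by
    intro u
    refine Integrable.mono' ((hk2.const_mul (2 * u ^ 2)).add (hkc.norm.const_mul |u|))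
      (by fun_prop) ?_
    exact (ae_restrict_iff' measurableSet_Ioi).2 (Eventually.of_forall fun t ht => hbound u ht)
  have hRc : ∀ n u, charFun (R n) u = Complex.exp (u * Complex.I * b +
      ∫ t : ℝ in Set.Ioi (1 / ((n : ℝ) + 1)),
          ((Complex.exp (u * t * Complex.I) - 1) * k t - u * Complex.I * c t)) := by
    intro n u
    have h1 : IntegrableOn (fun t : ℝ => u * Complex.I * (c t : ℂ))
        (Set.Ioi (1 / ((n : ℝ) + 1))) := ((hci n).ofReal (𝕜 := ℂ)).const_mul _
    have h2 : IntegrableOn (fun t : ℝ => (Complex.exp (u * t * Complex.I) - 1) * k t)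
        (Set.Ioi (1 / ((n : ℝ) + 1))) := by
      refine (((hgi u).mono_set (hsub n)).add h1).congr (Eventually.of_forall fun t => ?_)
      simp
    simp only [R]
    rw [charFun_map_add_const, hQc, integral_sub h2 h1, integral_const_mul, integral_complex_ofReal,
      ← Complex.exp_add]
    congr 1
    simp
    ring
  have hlim : ∀ u : ℝ, Tendsto (fun n => charFun (R n) u) atTop
      (𝓝 (Complex.exp (u * Complex.I * b + ∫ t : ℝ in Set.Ioi 0,
          ((Complex.exp (u * t * Complex.I) - 1) * k t - u * Complex.I * c t)))) := by
    intro u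
    simp_rw [hRc]
    exact (Complex.continuous_exp.tendsto _).comp
      ((tendsto_integral_Ioi_one_div (hgi u)).const_add _)
  have hcont : ContinuousAt (fun u : ℝ => Complex.exp (u * Complex.I * b + ∫ t : ℝ in Set.Ioi 0,
          ((Complex.exp (u * t * Complex.I) - 1) * k t - u * Complex.I * c t))) 0 := by
    refine Complex.continuous_exp.continuousAt.comp (ContinuousAt.add (by fun_prop)
      (continuousAt_of_dominated
        (bound := fun t => 2 * (t ^ 2 * k t) + ‖t * k t - c t‖)
        (Eventually.of_forall fun u => by fun_prop) ?_ ((hk2.const_mul 2).add hkc.norm)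
        (Eventually.of_forall fun t => by fun_prop)))
    filter_upwards [Metric.ball_mem_nhds (0 : ℝ) one_pos] with u hu
    refine (ae_restrict_iff' measurableSet_Ioi).2 (Eventually.of_forall fun t ht => ?_)
    have hu1 : |u| ≤ 1 := by simpa using (mem_ball_zero_iff.1 hu).le
    have hu2 : u ^ 2 ≤ 1 := (sq_le_one_iff_abs_le_one u).2 hu1
    refine (hbound u ht).trans (add_le_add ?_ (mul_le_of_le_one_left (norm_nonneg _) hu1))
    have := mul_nonneg (sq_nonneg t) (hk0 t ht)
    nlinarith
  obtain ⟨P, hP, hPc, -⟩ := exists_limit_of_tendsto_charFun hcont hlim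
  exact ⟨P, hP, hPc⟩

/-! ### The generating function of the multiple Bernoulli polynomials -/

theorem one_sub_exp_neg_pos {a t : ℝ} (ha : 0 < a) (ht : 0 < t) : 0 < 1 - Real.exp (-(a * t)) := by
  have : Real.exp (-(a * t)) < 1 := Real.exp_lt_one_iff.2 (by nlinarith [mul_pos ha ht])
  linarith

theorem div_one_sub_exp_neg_le {a t : ℝ} (ha : 0 < a) (ht : 0 < t) :
    t / (1 - Real.exp (-(a * t))) ≤ a⁻¹ + t := by
  rw [div_le_iff₀ (one_sub_exp_neg_pos ha ht)]
  have h1 : a * t + 1 ≤ Real.exp (a * t) := Real.add_one_le_exp _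
  have h2 : Real.exp (-(a * t)) * Real.exp (a * t) = 1 := by rw [← Real.exp_add]; simp
  have h3 : Real.exp (-(a * t)) * (a * t + 1) ≤ 1 :=
    (mul_le_mul_of_nonneg_left h1 (Real.exp_pos _).le).trans_eq h2
  have h4 : (a⁻¹ + t) * (1 - Real.exp (-(a * t))) - t
      = a⁻¹ * (1 - Real.exp (-(a * t)) * (a * t + 1)) := by
    field_simp
    ring
  have h5 : 0 ≤ a⁻¹ * (1 - Real.exp (-(a * t)) * (a * t + 1)) :=
    mul_nonneg (inv_pos.2 ha).le (by linarith)
  linarith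

/-- The factor is the inverse of the divided difference at `0` of `1 - exp (-a t)`, which does not
vanish. -/
theorem analyticAt_bernoulliFactor {a : ℝ} (ha : 0 < a) (x : ℝ) :
    AnalyticAt ℝ (fun t : ℝ => if t = 0 then a⁻¹ else t / (1 - Real.exp (-(a * t)))) x := by
  set φ : ℝ → ℝ := fun t => 1 - Real.exp (-(a * t)) with hφ
  have hφa : ∀ y, AnalyticAt ℝ φ y := fun y => by simp only [hφ]; fun_prop
  have hφ0 : ∀ y, y ≠ 0 → φ y ≠ 0 := by
    intro y hy h
    have h1 : Real.exp (-(a * y)) = 1 := by simp only [hφ] at h; linarith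
    rw [Real.exp_eq_one_iff, neg_eq_zero, mul_eq_zero] at h1
    exact h1.elim ha.ne' hy
  rcases eq_or_ne x 0 with rfl | hx
  · have hd : deriv φ 0 = a := by
      have : HasDerivAt φ (-(Real.exp (-(a * 0)) * (-(a * 1)))) 0 := by
        simpa using ((((hasDerivAt_id (0 : ℝ)).const_mul a).neg).exp).const_sub 1
      rw [this.deriv]
      simp
    obtain ⟨p, hp⟩ := hφa 0
    have h1 : AnalyticAt ℝ (dslope φ 0) 0 := ⟨_, hp.has_fpower_series_dslope_fslope⟩
    have h2 : dslope φ 0 0 ≠ 0 := by rw [dslope_same, hd]; exact ha.ne'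
    refine (h1.inv h2).congr (Eventually.of_forall fun t => ?_)
    rcases eq_or_ne t 0 with rfl | ht
    · simp [hd]
    · simp [dslope_of_ne _ ht, slope_def_field, ht, hφ]
  · have h1 : AnalyticAt ℝ (fun t => t / φ t) x := analyticAt_id.fun_div (hφa x) (hφ0 x hx)
    refine h1.congr ?_
    filter_upwards [isOpen_ne.mem_nhds hx] with t ht
    rw [if_neg ht]

section

variable {M : ℕ} {a : Fin M → ℝ}

theorem contDiff_bernoulliGen (ha : ∀ j, 0 < a j) {n : WithTop ℕ∞} : ContDiff ℝ n (bernoulliGen a) := by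
  rw [contDiff_iff_contDiffAt]
  intro x
  have : AnalyticAt ℝ (bernoulliGen a) x := by
    have h := Finset.analyticAt_fun_prod (𝕜 := ℝ) (c := x)
      (f := fun (j : Fin M) (t : ℝ) => if t = 0 then (a j)⁻¹ else t / (1 - Real.exp (-(a j * t))))
      Finset.univ (fun j _ => analyticAt_bernoulliFactor (ha j) x)
    exact h
  exact this.contDiffAt

theorem continuous_bernoulliGen (ha : ∀ j, 0 < a j) : Continuous (bernoulliGen a) :=
  (contDiff_bernoulliGen ha (n := 0)).continuous

theorem contDiff_bernoulliGen_mul_exp (ha : ∀ j, 0 < a j) (w : ℂ) {n : WithTop ℕ∞} :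
    ContDiff ℝ n fun t : ℝ => (bernoulliGen a t : ℂ) * Complex.exp (-(w * (t : ℂ))) := by
  have h1 : ContDiff ℝ n fun t : ℝ => (t : ℂ) := Complex.ofRealCLM.contDiff
  have h2 : ContDiff ℝ n fun t : ℝ => (bernoulliGen a t : ℂ) :=
    Complex.ofRealCLM.contDiff.comp (contDiff_bernoulliGen ha)
  exact h2.mul (contDiff_const.mul h1).neg.cexp

theorem bernoulliGen_of_pos {t : ℝ} (ht : 0 < t) :
    bernoulliGen a t = ∏ j, t / (1 - Real.exp (-(a j * t))) := by
  simp [bernoulliGen, ht.ne']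

theorem bernoulliGen_zero : bernoulliGen a 0 = ∏ j, (a j)⁻¹ := by
  simp [bernoulliGen]

theorem bernoulliGen_pos (ha : ∀ j, 0 < a j) {t : ℝ} (ht : 0 < t) : 0 < bernoulliGen a t := by
  rw [bernoulliGen_of_pos ht]
  exact Finset.prod_pos fun j _ => div_pos ht (one_sub_exp_neg_pos (ha j) ht)

theorem bernoulliGen_le (ha : ∀ j, 0 < a j) {t : ℝ} (ht : 1 ≤ t) :
    bernoulliGen a t ≤ (∏ j, ((a j)⁻¹ + 1)) * t ^ M := by
  have ht0 : 0 < t := by linarith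
  rw [bernoulliGen_of_pos ht0]
  have h1 : ∏ j, t / (1 - Real.exp (-(a j * t))) ≤ ∏ j, (((a j)⁻¹ + 1) * t) := by
    refine Finset.prod_le_prod (fun j _ => (div_pos ht0 (one_sub_exp_neg_pos (ha j) ht0)).le)
      fun j _ => (div_one_sub_exp_neg_le (ha j) ht0).trans ?_
    have : 0 < (a j)⁻¹ := inv_pos.2 (ha j)
    nlinarith
  refine h1.trans_eq ?_
  rw [Finset.prod_mul_distrib]
  simp

/-- The integrand of the Malmsten-type integral for `log Γ_M(w | a)`. -/
noncomputable def logBarnesIntegrand (a : Fin M → ℝ) (w : ℂ) (t : ℝ) : ℂ :=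
  (Complex.exp (-(w * (t : ℂ))) * (bernoulliGen a t : ℂ)
      - ∑ k ∈ Finset.range M, (t : ℂ) ^ k / (k.factorial : ℂ) * multipleBernoulli a k w
      - (t : ℂ) ^ M * Complex.exp (-(t : ℂ)) / (M.factorial : ℂ) * multipleBernoulli a M w)
      / (t : ℂ) ^ (M + 1)

theorem logBarnesGamma_eq (a : Fin M → ℝ) (w : ℂ) :
    logBarnesGamma a w = ∫ t in Set.Ioi 0, logBarnesIntegrand a w t := rfl

theorem measurable_logBarnesIntegrand (ha : ∀ j, 0 < a j) (w : ℂ) :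
    Measurable (logBarnesIntegrand a w) := by
  have := (continuous_bernoulliGen ha).measurable
  unfold logBarnesIntegrand
  fun_prop

/-- The values `B_{M,k}(w | a)` are the Taylor coefficients of the generating function, up to
factorials; this makes the singularity of the Malmsten integrand at `0` removable. -/
theorem exists_taylor_bernoulliGen (ha : ∀ j, 0 < a j) (w : ℂ) (n : ℕ) :
    ∃ C : ℝ, ∀ t ∈ Set.Ioc (0 : ℝ) 1, ‖Complex.exp (-(w * (t : ℂ))) * (bernoulliGen a t : ℂ)
      - ∑ k ∈ Finset.range (n + 1), (t : ℂ) ^ k / (k.factorial : ℂ) * multipleBernoulli a k w‖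
        ≤ C * t ^ (n + 1) := by
  have hcd := contDiff_bernoulliGen_mul_exp ha w (n := n + 1)
  obtain ⟨C, hC⟩ := exists_taylor_mean_remainder_bound (zero_le_one (α := ℝ)) (n := n)
    hcd.contDiffOn
  refine ⟨C, fun t ht => ?_⟩
  have := hC t ⟨ht.1.le, ht.2⟩
  rw [taylor_within_apply, sub_zero] at this
  convert! this using 3
  · ring
  · refine Finset.sum_congr rfl fun k hk => ?_
    rw [iteratedDerivWithin_eq_iteratedDeriv (uniqueDiffOn_Icc zero_lt_one)
      (contDiff_bernoulliGen_mul_exp ha w).contDiffAt (by simp), Complex.real_smul]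
    simp only [multipleBernoulli]
    push_cast
    ring

theorem integrableOn_exp_neg_mul_Ioi_one {b : ℝ} (hb : 0 < b) :
    IntegrableOn (fun t : ℝ => Real.exp (-(b * t))) (Set.Ioi 1) := by
  simpa [neg_mul] using exp_neg_integrableOn_Ioi 1 hb

theorem integrableOn_logBarnesIntegrand (ha : ∀ j, 0 < a j) {w : ℂ} (hw : 0 < w.re) :
    IntegrableOn (logBarnesIntegrand a w) (Set.Ioi 0) := by
  rw [← Set.Ioc_union_Ioi_eq_Ioi (zero_le_one (α := ℝ))]
  have hm := (measurable_logBarnesIntegrand ha w).aestronglyMeasurable (μ := volume)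
  -- Taylor's formula bounds the integrand on `(0, 1]`; on `(1, ∞)` each term decays separately.
  refine IntegrableOn.union ?_ ?_
  · obtain ⟨C, hC⟩ := exists_taylor_bernoulliGen ha w M
    refine Integrable.mono' (integrable_const
      (C + ‖multipleBernoulli a M w‖ / M.factorial)) hm.restrict ?_
    refine (ae_restrict_iff' measurableSet_Ioc).2 (Eventually.of_forall fun t ht => ?_)
    have ht0 : 0 < t := ht.1
    unfold logBarnesIntegrand
    rw [norm_div, norm_pow, Complex.norm_real, Real.norm_of_nonneg ht0.le,
      div_le_iff₀ (by positivity)]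
    have h1 := hC t ht
    rw [Finset.sum_range_succ] at h1
    have h2 : ‖(t : ℂ) ^ M / (M.factorial : ℂ) * multipleBernoulli a M w
        * (1 - Complex.exp (-(t : ℂ)))‖ ≤ ‖multipleBernoulli a M w‖ / M.factorial * t ^ (M + 1) := by
      have h3 : ‖1 - Complex.exp (-(t : ℂ))‖ ≤ t := by
        rw [norm_sub_rev]
        refine (norm_exp_sub_one_le_of_re_nonpos (by simpa using ht0.le)).trans_eq ?_
        simp [abs_of_pos ht0]
      rw [norm_mul, norm_mul, norm_div, norm_pow, Complex.norm_real, Real.norm_of_nonneg ht0.le,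
        Complex.norm_natCast]
      refine (mul_le_mul_of_nonneg_left h3 (by positivity)).trans_eq ?_
      ring
    refine le_trans (le_of_eq ?_) ((norm_add_le _ _).trans ((add_le_add h1 h2).trans_eq ?_))
    · congr 1
      ring
    · ring
  · set K : ℝ := ∏ j, ((a j)⁻¹ + 1)
    have hK : 0 ≤ K := Finset.prod_nonneg fun j _ => by have := inv_pos.2 (ha j); linarith
    have hdom : IntegrableOn (fun t : ℝ => K * Real.exp (-(w.re * t))
        + ∑ k ∈ Finset.range M, ‖multipleBernoulli a k w‖ / k.factorial * t ^ (-2 : ℝ)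
        + ‖multipleBernoulli a M w‖ / M.factorial * Real.exp (-(1 * t))) (Set.Ioi 1) := by
      refine ((integrableOn_exp_neg_mul_Ioi_one hw).const_mul K).add ?_ |>.add
        ((integrableOn_exp_neg_mul_Ioi_one one_pos).const_mul _)
      exact integrable_finsetSum _ fun k _ =>
        (integrableOn_Ioi_rpow_of_lt (by norm_num) one_pos).const_mul _
    refine Integrable.mono' hdom hm.restrict ?_
    refine (ae_restrict_iff' measurableSet_Ioi).2 (Eventually.of_forall fun t ht => ?_)
    have ht1 : 1 < t := ht
    have ht0 : 0 < t := by linarith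
    unfold logBarnesIntegrand
    rw [norm_div, norm_pow, Complex.norm_real, Real.norm_of_nonneg ht0.le,
      div_le_iff₀ (by positivity)]
    have htp : (1 : ℝ) ≤ t ^ M := one_le_pow₀ ht1.le
    have h1 : ‖Complex.exp (-(w * (t : ℂ))) * (bernoulliGen a t : ℂ)‖
        ≤ K * Real.exp (-(w.re * t)) * t ^ (M + 1) := by
      rw [norm_mul, Complex.norm_exp, Complex.norm_real,
        Real.norm_of_nonneg (bernoulliGen_pos ha ht0).le]
      have : (-(w * (t : ℂ))).re = -(w.re * t) := by simp
      rw [this]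
      refine (mul_le_mul_of_nonneg_left (bernoulliGen_le ha ht1.le) (Real.exp_pos _).le).trans ?_
      have h4 : t ^ M ≤ t ^ (M + 1) := pow_le_pow_right₀ ht1.le (Nat.le_succ M)
      calc Real.exp (-(w.re * t)) * (K * t ^ M) = K * Real.exp (-(w.re * t)) * t ^ M := by ring
        _ ≤ _ := by gcongr
    have h2 : ‖∑ k ∈ Finset.range M, (t : ℂ) ^ k / (k.factorial : ℂ) * multipleBernoulli a k w‖
        ≤ (∑ k ∈ Finset.range M, ‖multipleBernoulli a k w‖ / k.factorial * t ^ (-2 : ℝ))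
          * t ^ (M + 1) := by
      rw [Finset.sum_mul]
      refine (norm_sum_le _ _).trans (Finset.sum_le_sum fun k hk => ?_)
      rw [norm_mul, norm_div, norm_pow, Complex.norm_real, Real.norm_of_nonneg ht0.le,
        Complex.norm_natCast]
      have hk' : k + 2 ≤ M + 1 := by have := Finset.mem_range.1 hk; omega
      have h5 : t ^ k ≤ t ^ (-2 : ℝ) * t ^ (M + 1) := by
        have h6 : t ^ (k + 2) ≤ t ^ (M + 1) := pow_le_pow_right₀ ht1.le hk'
        rw [show (-2 : ℝ) = ((-2 : ℤ) : ℝ) by norm_num, Real.rpow_intCast]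
        calc t ^ k = t ^ (-2 : ℤ) * t ^ (k + 2) := by
              rw [zpow_neg, pow_add]; field_simp
          _ ≤ _ := by gcongr
      calc t ^ k / k.factorial * ‖multipleBernoulli a k w‖
          = ‖multipleBernoulli a k w‖ / k.factorial * t ^ k := by ring
        _ ≤ ‖multipleBernoulli a k w‖ / k.factorial * (t ^ (-2 : ℝ) * t ^ (M + 1)) := by gcongr
        _ = _ := by ring
    have h3 : ‖(t : ℂ) ^ M * Complex.exp (-(t : ℂ)) / (M.factorial : ℂ) * multipleBernoulli a M w‖
        ≤ ‖multipleBernoulli a M w‖ / M.factorial * Real.exp (-(1 * t)) * t ^ (M + 1) := by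
      rw [norm_mul, norm_div, norm_mul, norm_pow, Complex.norm_real, Real.norm_of_nonneg ht0.le,
        Complex.norm_natCast, Complex.norm_exp]
      have h4 : t ^ M ≤ t ^ (M + 1) := pow_le_pow_right₀ ht1.le (Nat.le_succ M)
      have : (-(t : ℂ)).re = -(1 * t) := by simp
      rw [this]
      calc t ^ M * Real.exp (-(1 * t)) / M.factorial * ‖multipleBernoulli a M w‖
          = ‖multipleBernoulli a M w‖ / M.factorial * Real.exp (-(1 * t)) * t ^ M := by ring
        _ ≤ _ := by gcongr
    rw [add_mul, add_mul]
    exact (norm_sub_le _ _).trans (add_le_add ((norm_sub_le _ _).trans (add_le_add h1 h2)) h3)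

theorem iteratedDeriv_exp_neg_mul (w : ℂ) (k : ℕ) :
    iteratedDeriv k (fun t : ℝ => Complex.exp (-(w * (t : ℂ)))) =
      fun t : ℝ => (-w) ^ k * Complex.exp (-(w * (t : ℂ))) := by
  induction k with
  | zero => simp
  | succ k ih =>
    rw [iteratedDeriv_succ, ih]
    ext t
    have h1 : HasDerivAt (fun t : ℝ => (t : ℂ)) 1 t := Complex.ofRealCLM.hasDerivAt
    have h2 := (((h1.const_mul w).fun_neg).cexp).const_mul ((-w) ^ k)
    rw [h2.deriv]
    ring

/-- The binomial expansion of the multiple Bernoulli polynomials. -/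
theorem multipleBernoulli_eq_sum (ha : ∀ j, 0 < a j) (m : ℕ) (w : ℂ) :
    multipleBernoulli a m w = ∑ i ∈ Finset.range (m + 1), (m.choose i : ℂ)
      * iteratedDeriv i (fun t : ℝ => (bernoulliGen a t : ℂ)) 0 * (-w) ^ (m - i) := by
  unfold multipleBernoulli
  have h2 : ContDiff ℝ m fun t : ℝ => (bernoulliGen a t : ℂ) :=
    Complex.ofRealCLM.contDiff.comp (contDiff_bernoulliGen ha)
  have h3 : ContDiff ℝ m fun t : ℝ => Complex.exp (-(w * (t : ℂ))) :=
    (contDiff_const.mul Complex.ofRealCLM.contDiff).neg.cexp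
  rw [iteratedDeriv_fun_mul h2.contDiffAt h3.contDiffAt]
  refine Finset.sum_congr rfl fun i _ => ?_
  rw [iteratedDeriv_exp_neg_mul]
  simp

end

/-! ### Frullani-type integrals -/

theorem norm_exp_sub_exp_le {w z : ℂ} {m t : ℝ} (hw : m ≤ w.re) (hz : m ≤ z.re) (ht : 0 ≤ t) :
    ‖Complex.exp (-(w * (t : ℂ))) - Complex.exp (-(z * (t : ℂ)))‖
      ≤ t * Real.exp (-(m * t)) * ‖w - z‖ := by
  have hconv : Convex ℝ {w : ℂ | m ≤ w.re} := convex_halfSpace_re_ge m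
  refine hconv.norm_image_sub_le_of_norm_hasDerivWithin_le
    (f := fun w : ℂ => Complex.exp (-(w * (t : ℂ))))
    (f' := fun w : ℂ => Complex.exp (-(w * (t : ℂ))) * (-(1 * (t : ℂ))))
    (fun x _ => ((((hasDerivAt_id x).mul_const (t : ℂ)).fun_neg).cexp).hasDerivWithinAt)
    (fun x hx => ?_) hz hw
  rw [norm_mul, Complex.norm_exp, norm_neg, one_mul, Complex.norm_real, Real.norm_of_nonneg ht,
    mul_comm]
  refine mul_le_mul_of_nonneg_left (Real.exp_le_exp.2 ?_) ht
  have : (-(x * (t : ℂ))).re = -(x.re * t) := by simp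
  rw [this]
  have hx' : m ≤ x.re := hx
  nlinarith

section

variable {h : ℝ → ℝ} {C : ℝ}

theorem integrableOn_exp_neg_mul_Ioi_zero {b : ℝ} (hb : 0 < b) :
    IntegrableOn (fun t : ℝ => Real.exp (-(b * t))) (Set.Ioi 0) := by
  simpa [neg_mul] using exp_neg_integrableOn_Ioi 0 hb

theorem norm_frullani_integrand_le {w w₀ : ℂ} {m t : ℝ} (hw : m ≤ w.re) (hw₀ : m ≤ w₀.re)
    (hC : ∀ t, 0 < t → |h t| ≤ C) (ht : 0 < t) :
    ‖(Complex.exp (-(w * (t : ℂ))) - Complex.exp (-(w₀ * (t : ℂ)))) / t * h t‖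
      ≤ ‖w - w₀‖ * C * Real.exp (-(m * t)) := by
  rw [norm_mul, norm_div, Complex.norm_real, Complex.norm_real, Real.norm_of_nonneg ht.le,
    Real.norm_eq_abs]
  have h1 : ‖Complex.exp (-(w * (t : ℂ))) - Complex.exp (-(w₀ * (t : ℂ)))‖ / t
      ≤ Real.exp (-(m * t)) * ‖w - w₀‖ := by
    rw [div_le_iff₀ ht]
    exact (norm_exp_sub_exp_le hw hw₀ ht.le).trans_eq (by ring)
  calc _ ≤ (Real.exp (-(m * t)) * ‖w - w₀‖) * C :=
        mul_le_mul h1 (hC t ht) (abs_nonneg _) (by positivity)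
    _ = _ := by ring

theorem integrableOn_frullani (hh : Measurable h) (hC : ∀ t, 0 < t → |h t| ≤ C) {w w₀ : ℂ}
    (hw : 0 < w.re) (hw₀ : 0 < w₀.re) :
    IntegrableOn (fun t : ℝ =>
      (Complex.exp (-(w * (t : ℂ))) - Complex.exp (-(w₀ * (t : ℂ)))) / t * h t) (Set.Ioi 0) := by
  refine Integrable.mono' ((integrableOn_exp_neg_mul_Ioi_zero (lt_min hw hw₀)).const_mul
    (‖w - w₀‖ * C)) (by fun_prop) ?_
  exact (ae_restrict_iff' measurableSet_Ioi).2 (Eventually.of_forall fun t ht =>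
    norm_frullani_integrand_le (min_le_left _ _) (min_le_right _ _) hC ht)

/-- Differentiation under the integral sign for weighted Frullani integrals. -/
theorem hasDerivAt_frullani (hh : Measurable h) (hC : ∀ t, 0 < t → |h t| ≤ C) {w w₀ : ℂ}
    (hw : 0 < w.re) (hw₀ : 0 < w₀.re) :
    HasDerivAt (fun w : ℂ => ∫ t : ℝ in Set.Ioi 0,
      (Complex.exp (-(w * (t : ℂ))) - Complex.exp (-(w₀ * (t : ℂ)))) / t * h t)
      (∫ t : ℝ in Set.Ioi 0, -(Complex.exp (-(w * (t : ℂ))) * h t)) w := by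
  have hs : {z : ℂ | w.re / 2 < z.re} ∈ 𝓝 w :=
    (isOpen_lt continuous_const Complex.continuous_re).mem_nhds (half_lt_self hw)
  refine (hasDerivAt_integral_of_dominated_loc_of_deriv_le
    (F := fun (z : ℂ) (t : ℝ) =>
      (Complex.exp (-(z * (t : ℂ))) - Complex.exp (-(w₀ * (t : ℂ)))) / t * h t)
    (F' := fun (z : ℂ) (t : ℝ) => -(Complex.exp (-(z * (t : ℂ))) * h t))
    (bound := fun t => C * Real.exp (-(w.re / 2 * t))) hs
    (Eventually.of_forall fun z => by fun_prop) (integrableOn_frullani hh hC hw hw₀)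
    (by fun_prop) ?_ ((integrableOn_exp_neg_mul_Ioi_zero (half_pos hw)).const_mul C) ?_).2
  · refine (ae_restrict_iff' measurableSet_Ioi).2 (Eventually.of_forall fun t ht z hz => ?_)
    have ht0 : 0 < t := ht
    have hz' : w.re / 2 < z.re := hz
    rw [norm_neg, norm_mul, Complex.norm_exp, Complex.norm_real, Real.norm_eq_abs, mul_comm]
    refine mul_le_mul (hC t ht) (Real.exp_le_exp.2 ?_) (Real.exp_pos _).le
      ((abs_nonneg _).trans (hC t ht))
    have : (-(z * (t : ℂ))).re = -(z.re * t) := by simp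
    rw [this]
    nlinarith
  · refine (ae_restrict_iff' measurableSet_Ioi).2 (Eventually.of_forall fun t ht z hz => ?_)
    have ht0 : (t : ℂ) ≠ 0 := by exact_mod_cast (ne_of_gt ht)
    have h1 := (((((hasDerivAt_id z).mul_const (t : ℂ)).fun_neg).cexp.sub_const
      (Complex.exp (-(w₀ * (t : ℂ))))).div_const (t : ℂ)).mul_const (h t : ℂ)
    refine h1.congr_deriv ?_
    simp only [id]
    field_simp

end

theorem integral_exp_neg_mul_Ioi {w : ℂ} (hw : 0 < w.re) :
    ∫ t : ℝ in Set.Ioi 0, Complex.exp (-(w * (t : ℂ))) = w⁻¹ := by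
  have := integral_exp_mul_complex_Ioi (a := -w) (by simpa using hw) 0
  simpa [neg_mul] using this

/-- The complex Frullani integral: the sum with `log w` has derivative `0` and vanishes at `1`. -/
theorem integral_frullani {w : ℂ} (hw : 0 < w.re) :
    ∫ t : ℝ in Set.Ioi 0, (Complex.exp (-(w * (t : ℂ))) - Complex.exp (-(t : ℂ))) / t
      = -Complex.log w := by
  have hd : ∀ z : ℂ, 0 < z.re → HasDerivAt (fun w : ℂ => (∫ t : ℝ in Set.Ioi 0,
      (Complex.exp (-(w * (t : ℂ))) - Complex.exp (-(1 * (t : ℂ)))) / t * (1 : ℝ))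
        + Complex.log w) 0 z := by
    intro z hz
    have h1 := (hasDerivAt_frullani (h := fun _ => 1) (C := 1) (w₀ := 1) measurable_const
      (fun t _ => by simp) hz (by simp)).add (Complex.hasDerivAt_log (Or.inl hz))
    refine h1.congr_deriv ?_
    rw [integral_neg]
    simp [integral_exp_neg_mul_Ioi hz]
  have hconv : Convex ℝ {w : ℂ | 0 < w.re} := convex_halfSpace_re_gt 0
  have h2 := hconv.norm_image_sub_le_of_norm_hasDerivWithin_le (C := 0) (x := 1) (y := w)
    (fun z hz => (hd z hz).hasDerivWithinAt) (fun z hz => norm_zero.le)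
    (show (0 : ℝ) < (1 : ℂ).re by simp) hw
  rw [zero_mul, norm_le_zero_iff] at h2
  simp only [one_mul, Complex.ofReal_one, mul_one, sub_self, zero_div, integral_zero,
    Complex.log_one, add_zero, sub_zero] at h2
  exact eq_neg_of_add_eq_zero_left h2

/-! ### Functional equations of the logarithm of the Barnes gamma functions -/

/-- The Leibniz rule for `t` times the generating function of `a'`. -/
theorem multipleBernoulli_sub_shift {M : ℕ} {a : Fin (M + 1) → ℝ} {a' : Fin M → ℝ} {c : ℝ}
    (ha : ∀ j, 0 < a j) (ha' : ∀ j, 0 < a' j)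
    (h : ∀ t, bernoulliGen a t * (1 - Real.exp (-(c * t))) = t * bernoulliGen a' t)
    (w : ℂ) (k : ℕ) :
    multipleBernoulli a k w - multipleBernoulli a k (w + c)
      = k * multipleBernoulli a' (k - 1) w := by
  unfold multipleBernoulli
  have h1 : ∀ w, ContDiffAt ℝ k
      (fun t : ℝ => (bernoulliGen a t : ℂ) * Complex.exp (-(w * (t : ℂ)))) 0 := fun w =>
    (contDiff_bernoulliGen_mul_exp ha w).contDiffAt
  have h2 : ContDiffAt ℝ k
      (fun t : ℝ => (bernoulliGen a' t : ℂ) * Complex.exp (-(w * (t : ℂ)))) 0 :=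
    (contDiff_bernoulliGen_mul_exp ha' w).contDiffAt
  have hid : ContDiffAt ℝ k (fun t : ℝ => (t : ℂ)) 0 := Complex.ofRealCLM.contDiff.contDiffAt
  have hdid : deriv (fun t : ℝ => (t : ℂ)) = fun _ => (1 : ℂ) := by
    ext t
    exact (Complex.ofRealCLM.hasDerivAt (x := t)).deriv
  rw [← iteratedDeriv_fun_sub (h1 w) (h1 (w + c))]
  have h3 : (fun t : ℝ => (bernoulliGen a t : ℂ) * Complex.exp (-(w * (t : ℂ)))
      - (bernoulliGen a t : ℂ) * Complex.exp (-((w + c) * (t : ℂ)))) =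
      fun t : ℝ => (t : ℂ) * ((bernoulliGen a' t : ℂ) * Complex.exp (-(w * (t : ℂ)))) := by
    ext t
    have h4 : ((bernoulliGen a t * (1 - Real.exp (-(c * t))) : ℝ) : ℂ)
        = ((t * bernoulliGen a' t : ℝ) : ℂ) := by rw [h t]
    push_cast at h4
    rw [← mul_assoc, ← h4, add_mul, neg_add, Complex.exp_add]
    ring
  rw [h3, iteratedDeriv_fun_mul hid h2]
  rcases k with _ | k
  · simp
  · rw [Finset.sum_eq_single 1]
    · simp [iteratedDeriv_one, hdid]
    · intro i _ hi
      rcases i with _ | _ | i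
      · simp
      · exact absurd rfl hi
      · rw [iteratedDeriv_succ', hdid, iteratedDeriv_const]
        simp
    · intro hk
      simp at hk

theorem logBarnesIntegrand_sub_shift {M : ℕ} {a : Fin (M + 1) → ℝ} {a' : Fin M → ℝ} {c : ℝ}
    (ha : ∀ j, 0 < a j) (ha' : ∀ j, 0 < a' j)
    (h : ∀ t, bernoulliGen a t * (1 - Real.exp (-(c * t))) = t * bernoulliGen a' t)
    (w : ℂ) {t : ℝ} (ht : 0 < t) :
    logBarnesIntegrand a w t - logBarnesIntegrand a (w + c) t = logBarnesIntegrand a' w t := by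
  have ht0 : (t : ℂ) ≠ 0 := by exact_mod_cast ht.ne'
  have hB := multipleBernoulli_sub_shift ha ha' h w
  unfold logBarnesIntegrand
  rw [← sub_div, div_eq_div_iff (pow_ne_zero _ ht0) (pow_ne_zero _ ht0)]
  have h4 : ((bernoulliGen a t * (1 - Real.exp (-(c * t))) : ℝ) : ℂ)
      = ((t * bernoulliGen a' t : ℝ) : ℂ) := by rw [h t]
  push_cast at h4
  have h5 : Complex.exp (-(w * (t : ℂ))) * (bernoulliGen a t : ℂ)
      - Complex.exp (-((w + c) * (t : ℂ))) * (bernoulliGen a t : ℂ)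
      = t * (Complex.exp (-(w * (t : ℂ))) * (bernoulliGen a' t : ℂ)) := by
    have : (t : ℂ) * (Complex.exp (-(w * (t : ℂ))) * (bernoulliGen a' t : ℂ))
      = Complex.exp (-(w * (t : ℂ))) * (t * (bernoulliGen a' t : ℂ)) := by ring
    rw [this, ← h4, add_mul, neg_add, Complex.exp_add]
    ring
  have h6 : ∑ k ∈ Finset.range (M + 1), (t : ℂ) ^ k / (k.factorial : ℂ) * multipleBernoulli a k w
      - ∑ k ∈ Finset.range (M + 1),
          (t : ℂ) ^ k / (k.factorial : ℂ) * multipleBernoulli a k (w + c)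
      = t * ∑ k ∈ Finset.range M, (t : ℂ) ^ k / (k.factorial : ℂ) * multipleBernoulli a' k w := by
    rw [← Finset.sum_sub_distrib]
    simp_rw [← mul_sub, hB]
    rw [Finset.sum_range_succ', Finset.mul_sum]
    simp only [Nat.cast_zero, zero_mul, mul_zero, add_zero]
    refine Finset.sum_congr rfl fun k _ => ?_
    have hk : (k.factorial : ℂ) ≠ 0 := by exact_mod_cast k.factorial_ne_zero
    have hk1 : (k : ℂ) + 1 ≠ 0 := by exact_mod_cast k.succ_ne_zero
    rw [Nat.factorial_succ, Nat.add_sub_cancel]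
    push_cast
    field_simp
    ring
  have h7 : (t : ℂ) ^ (M + 1) * Complex.exp (-(t : ℂ)) / ((M + 1).factorial : ℂ)
        * multipleBernoulli a (M + 1) w
      - (t : ℂ) ^ (M + 1) * Complex.exp (-(t : ℂ)) / ((M + 1).factorial : ℂ)
        * multipleBernoulli a (M + 1) (w + c)
      = t * ((t : ℂ) ^ M * Complex.exp (-(t : ℂ)) / (M.factorial : ℂ)
        * multipleBernoulli a' M w) := by
    rw [← mul_sub, hB]
    have hk : (M.factorial : ℂ) ≠ 0 := by exact_mod_cast M.factorial_ne_zero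
    have hk1 : (M : ℂ) + 1 ≠ 0 := by exact_mod_cast M.succ_ne_zero
    rw [Nat.factorial_succ, Nat.add_sub_cancel]
    push_cast
    field_simp
    ring
  have h8 := congrArg₂ (· - ·) (congrArg₂ (· - ·) h5 h6) h7
  have h9 : (t : ℂ) ^ (M + 1 + 1) = t * (t : ℂ) ^ (M + 1) := pow_succ' _ _
  rw [h9]
  linear_combination ((t : ℂ) ^ (M + 1)) * h8

/-- The functional equation of `log Γ_{M+1}` in the direction of the period `c`, where `a'` is `a`
with one entry `c` removed. -/
theorem logBarnesGamma_eq_add_shift {M : ℕ} {a : Fin (M + 1) → ℝ} {a' : Fin M → ℝ} {c : ℝ}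
    (ha : ∀ j, 0 < a j) (ha' : ∀ j, 0 < a' j) (hc : 0 < c)
    (h : ∀ t, bernoulliGen a t * (1 - Real.exp (-(c * t))) = t * bernoulliGen a' t)
    {w : ℂ} (hw : 0 < w.re) :
    logBarnesGamma a w = logBarnesGamma a' w + logBarnesGamma a (w + c) := by
  rw [← sub_eq_iff_eq_add, logBarnesGamma_eq, logBarnesGamma_eq, logBarnesGamma_eq,
    ← integral_sub (integrableOn_logBarnesIntegrand ha hw)
      (integrableOn_logBarnesIntegrand ha (by simp; linarith))]
  exact setIntegral_congr_fun measurableSet_Ioi fun t ht =>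
    logBarnesIntegrand_sub_shift ha ha' h w ht

theorem exp_logBarnesGamma_zero (a : Fin 0 → ℝ) {w : ℂ} (hw : 0 < w.re) :
    Complex.exp (logBarnesGamma a w) = w⁻¹ := by
  have h1 : logBarnesGamma a w = -Complex.log w := by
    rw [← integral_frullani hw]
    unfold logBarnesGamma
    refine setIntegral_congr_fun measurableSet_Ioi fun t ht => ?_
    simp [bernoulliGen, multipleBernoulli]
  have hw0 : w ≠ 0 := by rintro rfl; simp at hw
  rw [h1, Complex.exp_neg, Complex.exp_log hw0]

/-! ### Scaling of the parameters -/

theorem bernoulliGen_scale {M : ℕ} (a : Fin M → ℝ) {κ : ℝ} (hκ : 0 < κ) (t : ℝ) :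
    bernoulliGen (fun j => κ * a j) t = (κ ^ M)⁻¹ * bernoulliGen a (κ * t) := by
  have h1 : (κ ^ M)⁻¹ = ∏ _j : Fin M, κ⁻¹ := by simp
  rw [h1, bernoulliGen, bernoulliGen, ← Finset.prod_mul_distrib]
  refine Finset.prod_congr rfl fun j _ => ?_
  rcases eq_or_ne t 0 with rfl | ht
  · simp [mul_comm]
  · have : κ * t ≠ 0 := mul_ne_zero hκ.ne' ht
    rw [if_neg ht, if_neg this, show κ * a j * t = a j * (κ * t) by ring, ← mul_div_assoc,
      inv_mul_cancel_left₀ hκ.ne']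

theorem multipleBernoulli_scale {M : ℕ} {a : Fin M → ℝ} (ha : ∀ j, 0 < a j) {κ : ℝ} (hκ : 0 < κ)
    (k : ℕ) (w : ℂ) : multipleBernoulli (fun j => κ * a j) k (κ * w)
      = (κ ^ M : ℂ)⁻¹ * κ ^ k * multipleBernoulli a k w := by
  unfold multipleBernoulli
  have h1 : (fun t : ℝ => (bernoulliGen (fun j => κ * a j) t : ℂ)
      * Complex.exp (-(κ * w * (t : ℂ)))) = fun t : ℝ => (κ ^ M : ℂ)⁻¹ *
      (fun s : ℝ => (bernoulliGen a s : ℂ) * Complex.exp (-(w * (s : ℂ)))) (κ * t) := by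
    ext t
    rw [bernoulliGen_scale a hκ]
    push_cast
    ring_nf
  rw [h1, iteratedDeriv_const_mul_field, iteratedDeriv_comp_const_smul
    (contDiff_bernoulliGen_mul_exp ha w)]
  simp only [mul_zero, Complex.real_smul]
  push_cast
  ring

/-- Homogeneity of `log Γ_M`: the scaling anomaly is the top multiple Bernoulli polynomial. -/
theorem logBarnesGamma_scale {M : ℕ} {a : Fin M → ℝ} (ha : ∀ j, 0 < a j) {κ : ℝ} (hκ : 0 < κ)
    {w : ℂ} (hw : 0 < w.re) :
    logBarnesGamma (fun j => κ * a j) (κ * w) = logBarnesGamma a w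
      - Complex.log κ * (multipleBernoulli a M w / M.factorial) := by
  have hκ0 : (κ : ℂ) ≠ 0 := by exact_mod_cast hκ.ne'
  set B : ℂ := multipleBernoulli a M w / M.factorial with hB
  -- Substituting `s = κ t` turns `exp (-t)` into `exp (-s / κ)`; undoing this costs a Frullani
  -- integral with coefficient `B`.
  let J : ℝ → ℂ := fun s => logBarnesIntegrand a w s
    - B * ((Complex.exp (-((κ : ℂ)⁻¹ * (s : ℂ))) - Complex.exp (-(s : ℂ))) / s)
  have hpt : ∀ t ∈ Set.Ioi (0 : ℝ), logBarnesIntegrand (fun j => κ * a j) (κ * w) t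
      = (κ : ℂ) * J (κ * t) := by
    intro t ht
    have ht0 : (t : ℂ) ≠ 0 := by exact_mod_cast (ne_of_gt ht)
    simp only [J, logBarnesIntegrand]
    rw [bernoulliGen_scale a hκ]
    simp_rw [multipleBernoulli_scale ha hκ]
    have h1 : ∑ k ∈ Finset.range M, (t : ℂ) ^ k / (k.factorial : ℂ)
        * ((κ ^ M : ℂ)⁻¹ * κ ^ k * multipleBernoulli a k w) = (κ ^ M : ℂ)⁻¹ *
        ∑ k ∈ Finset.range M, ((κ * t : ℝ) : ℂ) ^ k / (k.factorial : ℂ)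
          * multipleBernoulli a k w := by
      rw [Finset.mul_sum]
      refine Finset.sum_congr rfl fun k _ => ?_
      push_cast
      rw [mul_pow]
      ring
    rw [h1]
    have h2 : -((κ : ℂ)⁻¹ * ((κ * t : ℝ) : ℂ)) = -(t : ℂ) := by
      push_cast
      rw [inv_mul_cancel_left₀ hκ0]
    have h3 : (κ : ℂ) * w * t = w * ((κ * t : ℝ) : ℂ) := by
      push_cast
      ring
    rw [h2, h3, hB]
    generalize ∑ k ∈ Finset.range M, ((κ * t : ℝ) : ℂ) ^ k / (k.factorial : ℂ)
          * multipleBernoulli a k w = S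
    generalize bernoulliGen a (κ * t) = f
    have hM : (M.factorial : ℂ) ≠ 0 := by exact_mod_cast M.factorial_ne_zero
    push_cast
    have hκM : (κ : ℂ) ^ M ≠ 0 := pow_ne_zero _ hκ0
    have htM : (t : ℂ) ^ M ≠ 0 := pow_ne_zero _ ht0
    rw [pow_succ, pow_succ, mul_pow]
    field_simp
    ring
  rw [logBarnesGamma_eq, setIntegral_congr_fun measurableSet_Ioi hpt, integral_const_mul,
    integral_comp_mul_left_Ioi J 0 hκ, mul_zero, Complex.real_smul, ← mul_assoc, Complex.ofReal_inv,
    mul_inv_cancel₀ hκ0, one_mul]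
  have hre : 0 < ((κ : ℂ)⁻¹).re := by
    rw [← Complex.ofReal_inv, Complex.ofReal_re]
    exact inv_pos.2 hκ
  have hfi : IntegrableOn (fun s : ℝ =>
      (Complex.exp (-((κ : ℂ)⁻¹ * (s : ℂ))) - Complex.exp (-(s : ℂ))) / s) (Set.Ioi 0) := by
    simpa using integrableOn_frullani (h := fun _ => 1) (C := 1) (w := (κ : ℂ)⁻¹) (w₀ := 1)
      measurable_const (fun t _ => by simp) hre (by simp)
  simp only [J]
  rw [integral_sub (integrableOn_logBarnesIntegrand ha hw) (hfi.const_mul B), integral_const_mul,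
    integral_frullani hre, logBarnesGamma_eq]
  have h5 : Complex.log (κ : ℂ)⁻¹ = -Complex.log κ := by
    rw [← Complex.ofReal_inv, ← Complex.ofReal_log (inv_pos.2 hκ).le, Real.log_inv,
      ← Complex.ofReal_log hκ.le]
    push_cast
    rfl
  rw [h5]
  ring

/-! ### The gamma function of one period -/

theorem bernoulliGen_mul_one_sub_exp_tail {M : ℕ} {a : Fin (M + 1) → ℝ} (ha : 0 < a 0) (t : ℝ) :
    bernoulliGen a t * (1 - Real.exp (-(a 0 * t))) = t * bernoulliGen (Fin.tail a) t := by
  unfold bernoulliGen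
  rw [Fin.prod_univ_succ]
  rcases eq_or_ne t 0 with rfl | ht
  · simp
  · have h1 : 1 - Real.exp (-(a 0 * t)) ≠ 0 := by
      intro h
      have h2 : Real.exp (-(a 0 * t)) = 1 := by linarith
      rw [Real.exp_eq_one_iff, neg_eq_zero, mul_eq_zero] at h2
      exact h2.elim ha.ne' ht
    simp only [if_neg ht, Fin.tail]
    generalize 1 - Real.exp (-(a 0 * t)) = E at h1
    rw [div_mul_eq_mul_div, div_mul_cancel₀ _ h1]

theorem logBarnesGamma_congr {M : ℕ} {a a' : Fin M → ℝ} (h : bernoulliGen a = bernoulliGen a')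
    (w : ℂ) : logBarnesGamma a w = logBarnesGamma a' w := by
  simp only [logBarnesGamma, multipleBernoulli, h]

section GammaOne

variable {c : ℝ}

theorem forall_pos_single (hc : 0 < c) : ∀ j : Fin 1, 0 < (![c] : Fin 1 → ℝ) j := by
  simpa using hc

theorem exp_logBarnesGamma_one_shift (hc : 0 < c) {w : ℂ} (hw : 0 < w.re) :
    Complex.exp (logBarnesGamma ![c] w) = w⁻¹ * Complex.exp (logBarnesGamma ![c] (w + c)) := by
  rw [logBarnesGamma_eq_add_shift (a' := Fin.tail ![c]) (c := c) (forall_pos_single hc)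
    (fun j => j.elim0) hc (bernoulliGen_mul_one_sub_exp_tail (a := ![c]) (by simpa using hc)) hw,
    Complex.exp_add, exp_logBarnesGamma_zero _ hw]

theorem exp_logBarnesGamma_one_shift_nat (hc : 0 < c) {w : ℂ} (hw : 0 < w.re) (n : ℕ) :
    Complex.exp (logBarnesGamma ![c] (w + n * c))
      = (∏ j ∈ Finset.range n, (w + j * c)) * Complex.exp (logBarnesGamma ![c] w) := by
  induction n with
  | zero => simp
  | succ n ih =>
    have hre : 0 < (w + n * c).re := by
      have : (w + n * c).re = w.re + n * c := by simp
      rw [this]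
      positivity
    have hne : w + n * c ≠ 0 := by
      intro h
      rw [h] at hre
      simp at hre
    have h1 := exp_logBarnesGamma_one_shift hc hre
    rw [ih, eq_inv_mul_iff_mul_eq₀ hne] at h1
    rw [Finset.prod_range_succ, show w + ((n + 1 : ℕ) : ℂ) * c = w + n * c + c by push_cast; ring,
      ← h1]
    ring

theorem multipleBernoulli_one_zero (hc : 0 < c) (w : ℂ) :
    multipleBernoulli ![c] 0 w = (c : ℂ)⁻¹ := by
  rw [multipleBernoulli_eq_sum (forall_pos_single hc)]
  simp [bernoulliGen_zero]

theorem multipleBernoulli_one_one_sub (hc : 0 < c) (w z : ℂ) :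
    multipleBernoulli ![c] 1 (w + z) - multipleBernoulli ![c] 1 z = -(w * (c : ℂ)⁻¹) := by
  rw [multipleBernoulli_eq_sum (forall_pos_single hc),
    multipleBernoulli_eq_sum (forall_pos_single hc)]
  simp [Finset.sum_range_succ, bernoulliGen_zero]
  ring

/-- The growth of `log Γ_1` along the arithmetic progression of its period. After the logarithm is
written as a Frullani integral, the integrand carries a factor `exp (-x t)` that tends to `0`. -/
theorem tendsto_logBarnesGamma_one (hc : 0 < c) {w : ℂ} (hw : 0 < w.re) :
    Tendsto (fun n : ℕ => logBarnesGamma ![c] (w + ((n + 1) * c : ℝ))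
      - logBarnesGamma ![c] (((n + 1) * c : ℝ)) - w / c * Real.log ((n + 1) * c)) atTop (𝓝 0) := by
  let J : ℝ → ℝ → ℂ := fun x t => logBarnesIntegrand ![c] (w + x) t - logBarnesIntegrand ![c] x t
    + w / c * ((Complex.exp (-((x : ℂ) * (t : ℂ))) - Complex.exp (-(t : ℂ))) / t)
  have hfr : ∀ x : ℝ, 0 < x → IntegrableOn (fun s : ℝ =>
      (Complex.exp (-((x : ℂ) * (s : ℂ))) - Complex.exp (-(s : ℂ))) / s) (Set.Ioi 0) := by
    intro x hx
    simpa using integrableOn_frullani (h := fun _ => 1) (C := 1) (w := (x : ℂ)) (w₀ := 1)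
      measurable_const (fun t _ => by simp) (by simpa using hx) (by simp)
  have hI1 : ∀ x : ℝ, 0 < x → IntegrableOn (logBarnesIntegrand ![c] (w + x)) (Set.Ioi 0) :=
    fun x hx => integrableOn_logBarnesIntegrand (forall_pos_single hc) (by simp; linarith)
  have hI2 : ∀ x : ℝ, 0 < x → IntegrableOn (logBarnesIntegrand ![c] x) (Set.Ioi 0) :=
    fun x hx => integrableOn_logBarnesIntegrand (forall_pos_single hc) (by simpa using hx)
  have hJi : ∀ x : ℝ, 0 < x → IntegrableOn (J x) (Set.Ioi 0) := fun x hx =>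
    ((hI1 x hx).sub (hI2 x hx)).add ((hfr x hx).const_mul _)
  have hJ : ∀ x : ℝ, 0 < x → ∫ t in Set.Ioi 0, J x t = logBarnesGamma ![c] (w + x)
      - logBarnesGamma ![c] x - w / c * Real.log x := by
    intro x hx
    simp only [J]
    have h12 : IntegrableOn (fun t => logBarnesIntegrand ![c] (w + x) t
      - logBarnesIntegrand ![c] x t) (Set.Ioi 0) := (hI1 x hx).sub (hI2 x hx)
    rw [integral_add h12 ((hfr x hx).const_mul _),
      integral_sub (hI1 x hx) (hI2 x hx), integral_const_mul,
      integral_frullani (by simpa using hx), logBarnesGamma_eq, logBarnesGamma_eq,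
      Complex.ofReal_log hx.le]
    ring
  have hJpt : ∀ x t : ℝ, 0 < t → J x t = Complex.exp (-((x : ℂ) * (t : ℂ))) *
      (((Complex.exp (-(w * (t : ℂ))) - 1) * bernoulliGen ![c] t + w / c * t) / (t : ℂ) ^ 2) := by
    intro x t ht
    have ht0 : (t : ℂ) ≠ 0 := by exact_mod_cast ht.ne'
    have hB := multipleBernoulli_one_one_sub hc w x
    simp only [J, logBarnesIntegrand, Finset.sum_range_one, multipleBernoulli_one_zero hc,
      Nat.factorial]
    rw [add_mul, neg_add, Complex.exp_add, eq_add_of_sub_eq hB]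
    field_simp
    push_cast
    ring
  have hlim : Tendsto (fun n : ℕ => ∫ t in Set.Ioi 0, J ((n + 1) * c) t) atTop
      (𝓝 (∫ t in Set.Ioi (0 : ℝ), (0 : ℂ))) := by
    refine tendsto_integral_of_dominated_convergence (fun t => ‖J c t‖)
      (fun n => (hJi _ (by positivity)).aestronglyMeasurable) (hJi c hc).norm (fun n => ?_) ?_
    · refine (ae_restrict_iff' measurableSet_Ioi).2 (Eventually.of_forall fun t ht => ?_)
      have ht0 : 0 < t := ht
      rw [hJpt _ t ht, hJpt _ t ht, norm_mul, norm_mul]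
      refine mul_le_mul_of_nonneg_right ?_ (norm_nonneg _)
      rw [Complex.norm_exp, Complex.norm_exp]
      refine Real.exp_le_exp.2 ?_
      simp only [← Complex.ofReal_mul, ← Complex.ofReal_neg, Complex.ofReal_re]
      have : 0 ≤ (n : ℝ) * (c * t) := by positivity
      linarith
    · refine (ae_restrict_iff' measurableSet_Ioi).2 (Eventually.of_forall fun t ht => ?_)
      have ht0 : 0 < t := ht
      simp_rw [hJpt _ t ht]
      have hexp : Tendsto (fun n : ℕ => Complex.exp (-((((n + 1) * c : ℝ) : ℂ) * (t : ℂ)))) atTop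
          (𝓝 0) := by
        rw [tendsto_zero_iff_norm_tendsto_zero]
        simp_rw [Complex.norm_exp, ← Complex.ofReal_mul, ← Complex.ofReal_neg, Complex.ofReal_re]
        refine Real.tendsto_exp_neg_atTop_nhds_zero.comp ?_
        refine Tendsto.atTop_mul_const ht0 (Tendsto.atTop_mul_const hc ?_)
        exact tendsto_atTop_add_const_right _ _ tendsto_natCast_atTop_atTop
      have hmul := hexp.mul_const
        (((Complex.exp (-(w * (t : ℂ))) - 1) * bernoulliGen ![c] t + w / c * t) / (t : ℂ) ^ 2)
      rw [zero_mul] at hmul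
      exact hmul
  rw [integral_zero] at hlim
  refine hlim.congr fun n => ?_
  rw [hJ _ (by positivity)]

/-- The constant relating `Γ_1(w | c)` to Euler's gamma function. Its value `1 / √(2 π c)` is not
needed, only that it does not depend on `w` and does not vanish. -/
noncomputable def gammaOneConst (c : ℝ) : ℂ := Complex.exp (logBarnesGamma ![c] c) / c

theorem gammaOneConst_ne_zero (hc : 0 < c) : gammaOneConst c ≠ 0 :=
  div_ne_zero (Complex.exp_ne_zero _) (by exact_mod_cast hc.ne')

/-- `Γ_1(w | c)` in terms of Euler's gamma function, by comparison with Euler's limit formula. -/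
theorem exp_logBarnesGamma_one (hc : 0 < c) {w : ℂ} (hw : 0 < w.re) :
    Complex.exp (logBarnesGamma ![c] w)
      = gammaOneConst c * Complex.exp (w / c * Real.log c) * Complex.Gamma (w / c) := by
  have hc0 : (c : ℂ) ≠ 0 := by exact_mod_cast hc.ne'
  set s : ℂ := w / c with hs
  have hws : w = c * s := by rw [hs]; field_simp
  set g : ℂ := Complex.exp (logBarnesGamma ![c] w) with hg
  set g1 : ℂ := Complex.exp (logBarnesGamma ![c] c) with hg1
  have hg1' : g1 ≠ 0 := Complex.exp_ne_zero _
  have hE := (Complex.continuous_exp.tendsto _).comp (tendsto_logBarnesGamma_one hc hw)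
  rw [Complex.exp_zero] at hE
  have hmain := hE.mul (Complex.GammaSeq_tendsto_Gamma s)
  rw [one_mul] at hmain
  have hlog : Tendsto (fun n : ℕ => c * g / g1 * Complex.exp (-(s * Real.log c))
      * Complex.exp (s * ((Real.log ((n : ℝ) / (n + 1)) : ℝ) : ℂ))) atTop
      (𝓝 (c * g / g1 * Complex.exp (-(s * Real.log c)) * Complex.exp (s * (Real.log 1 : ℝ)))) := by
    refine Tendsto.const_mul _ ((Complex.continuous_exp.tendsto _).comp (Tendsto.const_mul _ ?_))
    refine (Complex.continuous_ofReal.tendsto _).comp ?_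
    exact (Real.continuousAt_log one_ne_zero).tendsto.comp (tendsto_natCast_div_add_atTop (1 : ℝ))
  have heq : Tendsto (fun n : ℕ => c * g / g1 * Complex.exp (-(s * Real.log c))
      * Complex.exp (s * ((Real.log ((n : ℝ) / (n + 1)) : ℝ) : ℂ))) atTop
      (𝓝 (Complex.Gamma s)) := by
    refine hmain.congr' ?_
    filter_upwards [eventually_gt_atTop 0] with n hn
    have hnr : (0 : ℝ) < n := by exact_mod_cast hn
    have hsj : ∀ j : ℕ, s + j ≠ 0 := by
      intro j h
      have h1 : (s + j).re = w.re / c + j := by simp [hs, Complex.div_ofReal_re]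
      have h2 : 0 < w.re / c + j := by positivity
      rw [← h1, h] at h2
      simp at h2
    have hP : ∏ j ∈ Finset.range (n + 1), (s + j) ≠ 0 := Finset.prod_ne_zero_iff.2 fun j _ => hsj j
    have h1 := exp_logBarnesGamma_one_shift_nat hc hw (n + 1)
    have h2 := exp_logBarnesGamma_one_shift_nat hc (w := c) (by simpa using hc) n
    have h3 : ∏ j ∈ Finset.range (n + 1), (w + j * c)
        = (c : ℂ) ^ (n + 1) * ∏ j ∈ Finset.range (n + 1), (s + j) := by
      rw [show (c : ℂ) ^ (n + 1) = ∏ _j ∈ Finset.range (n + 1), (c : ℂ) by simp,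
        ← Finset.prod_mul_distrib]
      refine Finset.prod_congr rfl fun j _ => ?_
      rw [hws]
      ring
    have h4 : ∏ j ∈ Finset.range n, ((c : ℂ) + j * c) = (c : ℂ) ^ n * n.factorial := by
      rw [← Finset.prod_range_add_one_eq_factorial]
      push_cast
      rw [show (c : ℂ) ^ n = ∏ _j ∈ Finset.range n, (c : ℂ) by simp, ← Finset.prod_mul_distrib]
      refine Finset.prod_congr rfl fun j _ => ?_
      ring
    rw [h3] at h1
    rw [h4] at h2
    have e1 : w + (((n : ℝ) + 1) * c : ℝ) = w + ((n + 1 : ℕ) : ℂ) * c := by push_cast; ring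
    have e2 : ((((n : ℝ) + 1) * c : ℝ) : ℂ) = c + (n : ℂ) * c := by push_cast; ring
    have hfac : (n.factorial : ℂ) ≠ 0 := by exact_mod_cast n.factorial_ne_zero
    simp only [Function.comp]
    rw [e1, e2, Complex.exp_sub, Complex.exp_sub, h1, h2, ← hg, ← hg1, Complex.GammaSeq,
      Complex.cpow_def_of_ne_zero (by exact_mod_cast hn.ne'),
      Real.log_mul (by positivity) hc.ne', Real.log_div hnr.ne' (by positivity), ← hs]
    push_cast
    rw [mul_sub, mul_add, Complex.exp_sub, Complex.exp_add, Complex.exp_neg,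
      mul_comm (Complex.log n) s]
    have x1 := Complex.exp_ne_zero (s * (Real.log c : ℝ))
    have x2 := Complex.exp_ne_zero (s * (Real.log ((n : ℝ) + 1) : ℝ))
    generalize ∏ j ∈ Finset.range (n + 1), (s + j) = P at hP
    field_simp
    ring
  have hfin := tendsto_nhds_unique heq hlog
  rw [hfin, gammaOneConst, ← hg1, Complex.exp_neg, Real.log_one]
  have x1 := Complex.exp_ne_zero (s * (Real.log c : ℝ))
  simp only [Complex.ofReal_zero, mul_zero, Complex.exp_zero, mul_one]
  field_simp

end GammaOne

/-! ### The functional equations on the whole plane -/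

theorem shiftCount_of_pos (c : ℝ) {w : ℂ} (hw : 0 < w.re) : shiftCount c w = 0 := by
  simp [shiftCount, hw]

theorem shiftCount_of_nonpos {c : ℝ} (hc : 0 < c) {w : ℂ} (hw : w.re ≤ 0) :
    shiftCount c w = shiftCount c (w + c) + 1 := by
  have hre : (w + c).re = w.re + c := by simp
  unfold shiftCount
  rw [if_neg hw.not_gt, hre]
  have h1 : -w.re / c = -(w.re + c) / c + 1 := by field_simp; ring
  split_ifs with h
  · have h2 : ⌊-w.re / c⌋₊ = 0 := by
      rw [Nat.floor_eq_zero, div_lt_one hc]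
      linarith
    rw [h2]
  · have h2 : 0 ≤ -(w.re + c) / c := div_nonneg (by linarith) hc.le
    rw [h1, Nat.floor_add_one h2]

theorem barnesGamma_eq_exp {M : ℕ} (a : Fin M → ℝ) {w : ℂ} (hw : 0 < w.re) :
    barnesGamma M a w = Complex.exp (logBarnesGamma a w) := by
  cases M with
  | zero => rw [exp_logBarnesGamma_zero a hw, barnesGamma]
  | succ M => simp [barnesGamma, shiftCount_of_pos _ hw]

/-- The functional equation in the direction of the first period. It holds at all points because
`barnesGamma` vanishes at the poles. -/
theorem barnesGamma_shift {M : ℕ} {a : Fin (M + 1) → ℝ} (ha : ∀ j, 0 < a j) (w : ℂ) :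
    barnesGamma (M + 1) a w
      = barnesGamma M (Fin.tail a) w * barnesGamma (M + 1) a (w + (a 0 : ℝ)) := by
  rcases lt_or_ge 0 w.re with hw | hw
  · have hw' : 0 < (w + (a 0 : ℝ)).re := by
      simp only [Complex.add_re, Complex.ofReal_re]
      linarith [ha 0]
    rw [barnesGamma_eq_exp _ hw, barnesGamma_eq_exp _ hw, barnesGamma_eq_exp _ hw',
      ← Complex.exp_add, logBarnesGamma_eq_add_shift (a' := Fin.tail a) ha
        (fun j => ha j.succ) (ha 0) (bernoulliGen_mul_one_sub_exp_tail (ha 0)) hw]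
  · rw [barnesGamma, barnesGamma, shiftCount_of_nonpos (ha 0) hw, Finset.prod_range_succ']
    have h1 : ∀ j : ℕ, w + ((j + 1 : ℕ) : ℂ) * (a 0 : ℂ) = w + (a 0 : ℝ) + (j : ℂ) * (a 0 : ℂ) := by
      intro j
      push_cast
      ring
    simp_rw [h1]
    simp only [Nat.cast_zero, zero_mul, add_zero]
    ring

/-- Induction over translates of the right half-plane. -/
theorem shift_induction {c : ℝ} (hc : 0 < c) {P : ℂ → Prop} (h0 : ∀ w : ℂ, 0 < w.re → P w)
    (hs : ∀ w : ℂ, P (w + c) → P w) (w : ℂ) : P w := by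
  have h : ∀ (n : ℕ) (w : ℂ), 0 < w.re + n * c → P w := by
    intro n
    induction n with
    | zero => intro w hw; exact h0 w (by simpa using hw)
    | succ n ih =>
      intro w hw
      refine hs w (ih _ ?_)
      push_cast at hw
      simp only [Complex.add_re, Complex.ofReal_re]
      linarith
  obtain ⟨n, hn⟩ := exists_nat_gt (-w.re / c)
  rw [div_lt_iff₀ hc] at hn
  exact h n w (by linarith)

theorem Gamma_eq_inv_mul (s : ℂ) : Complex.Gamma s = s⁻¹ * Complex.Gamma (s + 1) := by
  rcases eq_or_ne s 0 with rfl | hs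
  · simp
  · rw [Complex.Gamma_add_one s hs, inv_mul_cancel_left₀ hs]

theorem barnesGamma_one_shift {c : ℝ} (hc : 0 < c) (w : ℂ) :
    barnesGamma 1 ![c] w = w⁻¹ * barnesGamma 1 ![c] (w + c) := by
  rw [barnesGamma_shift (a := ![c]) (forall_pos_single hc) w, Matrix.cons_val_zero]
  rfl

theorem barnesGamma_one_eq {c : ℝ} (hc : 0 < c) (w : ℂ) :
    barnesGamma 1 ![c] w
      = gammaOneConst c * Complex.exp (w / c * Real.log c) * Complex.Gamma (w / c) := by
  have hc0 : (c : ℂ) ≠ 0 := by exact_mod_cast hc.ne'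
  refine shift_induction hc (P := fun w => barnesGamma 1 ![c] w = gammaOneConst c
    * Complex.exp (w / c * Real.log c) * Complex.Gamma (w / c)) (fun w hw => ?_) (fun w ih => ?_) w
  · rw [barnesGamma_eq_exp _ hw, exp_logBarnesGamma_one hc hw]
  · have h2 : (w + c) / c = w / c + 1 := by field_simp
    have h3 : Complex.exp ((Real.log c : ℝ) : ℂ) = c := by
      rw [← Complex.ofReal_exp, Real.exp_log hc]
    rw [barnesGamma_one_shift hc, ih, h2, Gamma_eq_inv_mul (w / c), add_mul, one_mul,
      Complex.exp_add, h3, inv_div]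
    ring

theorem barnesGamma_one_ne_zero {c : ℝ} (hc : 0 < c) {w : ℂ} (hw : ∀ n : ℕ, w ≠ -(n * (c : ℂ))) :
    barnesGamma 1 ![c] w ≠ 0 := by
  have hc0 : (c : ℂ) ≠ 0 := by exact_mod_cast hc.ne'
  rw [barnesGamma_one_eq hc]
  refine mul_ne_zero (mul_ne_zero (gammaOneConst_ne_zero hc) (Complex.exp_ne_zero _))
    (Complex.Gamma_ne_zero fun n h => hw n ?_)
  rw [div_eq_iff hc0] at h
  rw [h]
  ring

section DoubleGamma

variable {τ : ℝ}

theorem forall_pos_pair (hτ : 0 < τ) : ∀ j : Fin 2, 0 < (![1, τ] : Fin 2 → ℝ) j := by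
  intro j
  fin_cases j <;> simp [hτ]

theorem doubleGamma_shift_one (hτ : 0 < τ) (w : ℂ) :
    doubleGamma τ w = barnesGamma 1 ![τ] w * doubleGamma τ (w + 1) := by
  have := barnesGamma_shift (forall_pos_pair hτ) w
  simpa [doubleGamma] using this

theorem bernoulliGen_pair_mul_one_sub_exp (hτ : 0 < τ) (t : ℝ) :
    bernoulliGen ![1, τ] t * (1 - Real.exp (-(τ * t))) = t * bernoulliGen ![1] t := by
  have h1 := bernoulliGen_mul_one_sub_exp_tail (a := ![τ]) (by simpa using hτ) t
  have h2 : bernoulliGen ![1, τ] t = bernoulliGen ![1] t * bernoulliGen ![τ] t := by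
    simp only [bernoulliGen, Fin.prod_univ_two, Fin.prod_univ_one, Matrix.cons_val_zero,
      Matrix.cons_val_one]
  have h3 : bernoulliGen (Fin.tail ![τ]) t = 1 := by simp [bernoulliGen]
  rw [h3, Matrix.cons_val_zero] at h1
  rw [h2, mul_assoc, h1]
  ring

/-- The second functional equation is extended from the right half-plane by means of the first. -/
theorem doubleGamma_shift_tau (hτ : 0 < τ) (w : ℂ) :
    doubleGamma τ w = barnesGamma 1 ![1] w * doubleGamma τ (w + τ) := by
  refine shift_induction one_pos
    (P := fun w => doubleGamma τ w = barnesGamma 1 ![1] w * doubleGamma τ (w + τ))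
    (fun w hw => ?_) (fun w ih => ?_) w
  · have hw' : 0 < (w + τ).re := by
      simp only [Complex.add_re, Complex.ofReal_re]
      linarith
    rw [doubleGamma, doubleGamma, barnesGamma_eq_exp _ hw, barnesGamma_eq_exp _ hw,
      barnesGamma_eq_exp _ hw', ← Complex.exp_add, logBarnesGamma_eq_add_shift (forall_pos_pair hτ)
        (forall_pos_single one_pos) hτ (bernoulliGen_pair_mul_one_sub_exp hτ) hw]
  · rw [Complex.ofReal_one] at ih
    rw [doubleGamma_shift_one hτ w, ih, doubleGamma_shift_one hτ (w + τ)]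
    have h1 := barnesGamma_one_shift hτ w
    have h2 := barnesGamma_one_shift one_pos w
    rw [Complex.ofReal_one] at h2
    rw [h1, h2, add_right_comm w (τ : ℂ) 1]
    ring

theorem doubleGamma_ne_zero_of_pos {w : ℂ} (hw : 0 < w.re) : doubleGamma τ w ≠ 0 := by
  rw [doubleGamma, barnesGamma_eq_exp _ hw]
  exact Complex.exp_ne_zero _

theorem doubleGamma_ne_zero (hτ : 0 < τ) {w : ℂ} (hw : ∀ m n : ℕ, w ≠ -(m + n * (τ : ℂ))) :
    doubleGamma τ w ≠ 0 := by
  revert hw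
  refine shift_induction one_pos
    (P := fun w => (∀ m n : ℕ, w ≠ -(m + n * (τ : ℂ))) → doubleGamma τ w ≠ 0)
    (fun w hw _ => doubleGamma_ne_zero_of_pos hw) (fun w ih hw => ?_) w
  rw [doubleGamma_shift_one hτ]
  refine mul_ne_zero (barnesGamma_one_ne_zero hτ fun n => ?_) ?_
  · simpa using hw 0 n
  · rw [Complex.ofReal_one] at ih
    refine ih fun m n h => hw (m + 1) n ?_
    push_cast
    linear_combination h

/-- Half the polynomial `B_{2,2}(w | 1, τ)`, the scaling anomaly of the double gamma function. -/
noncomputable def doubleAnomaly (τ : ℝ) (w : ℂ) : ℂ :=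
  multipleBernoulli ![1, τ] 2 w / 2

theorem exists_doubleAnomaly_eq (hτ : 0 < τ) : ∃ β γ : ℂ, ∀ w,
    doubleAnomaly τ w = (τ : ℂ)⁻¹ / 2 * w ^ 2 + β * w + γ := by
  refine ⟨-iteratedDeriv 1 (fun t : ℝ => (bernoulliGen ![1, τ] t : ℂ)) 0,
    iteratedDeriv 2 (fun t : ℝ => (bernoulliGen ![1, τ] t : ℂ)) 0 / 2, fun w => ?_⟩
  rw [doubleAnomaly, multipleBernoulli_eq_sum (forall_pos_pair hτ)]
  simp only [Finset.sum_range_succ, Finset.range_zero, Finset.sum_empty, Nat.choose,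
    iteratedDeriv_zero, bernoulliGen_zero, Fin.prod_univ_succ]
  simp
  ring

theorem doubleGamma_inv_of_pos (hτ : 0 < τ) {w : ℂ} (hw : 0 < w.re) :
    doubleGamma (1 / τ) (w / τ) = doubleGamma τ w
      * Complex.exp (Real.log τ * doubleAnomaly τ w) := by
  have hw' : 0 < (w / τ).re := by
    rw [Complex.div_ofReal_re]
    positivity
  have h1 : bernoulliGen ![1, 1 / τ] = bernoulliGen fun j => τ⁻¹ * (![1, τ] : Fin 2 → ℝ) j := by
    ext t
    simp only [bernoulliGen, Fin.prod_univ_two, Matrix.cons_val_zero, Matrix.cons_val_one, mul_one,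
      inv_mul_cancel₀ hτ.ne', one_div]
    rw [mul_comm]
  have h2 := logBarnesGamma_scale (forall_pos_pair hτ) (inv_pos.2 hτ) hw
  rw [doubleGamma, doubleGamma, barnesGamma_eq_exp _ hw, barnesGamma_eq_exp _ hw',
    logBarnesGamma_congr h1, ← Complex.exp_add, div_eq_inv_mul, ← Complex.ofReal_inv, h2,
    ← Complex.ofReal_log (inv_pos.2 hτ).le, Real.log_inv, doubleAnomaly]
  congr 1
  push_cast
  simp [Nat.factorial]

/-- The double gamma functions with parameters `τ` and `1 / τ` agree up to rescaling the variable
and the exponential of a quadratic polynomial. -/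
theorem doubleGamma_inv (hτ : 0 < τ) (w : ℂ) :
    doubleGamma (1 / τ) (w / τ) = doubleGamma τ w
      * Complex.exp (Real.log τ * doubleAnomaly τ w) := by
  have hτ0 : (τ : ℂ) ≠ 0 := by exact_mod_cast hτ.ne'
  obtain ⟨β, γ, hQ⟩ := exists_doubleAnomaly_eq hτ
  have hstep : ∀ w : ℂ, doubleGamma (1 / τ) (w / τ) =
      barnesGamma 1 ![1] (w / τ) * doubleGamma (1 / τ) ((w + 1) / τ) := by
    intro w
    rw [doubleGamma_shift_tau (τ := 1 / τ) (by positivity) (w / τ)]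
    congr 2
    push_cast
    ring
  have hone : ∀ s : ℂ, barnesGamma 1 ![1] s = gammaOneConst 1 * Complex.Gamma s := by
    intro s
    rw [barnesGamma_one_eq one_pos]
    simp
  have hdiff : ∀ w : ℂ, Complex.exp (Real.log τ * doubleAnomaly τ (w + 1))
      = Complex.exp (Real.log τ * ((τ : ℂ)⁻¹ / 2 + β)) * Complex.exp (w / τ * Real.log τ)
        * Complex.exp (Real.log τ * doubleAnomaly τ w) := by
    intro w
    rw [← Complex.exp_add, ← Complex.exp_add, hQ, hQ]
    congr 1
    field_simp
    ring
  -- Comparing the functional equations at `w = 1` determines the ratio of the two constants.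
  have hconst : gammaOneConst 1 * Complex.exp (Real.log τ * ((τ : ℂ)⁻¹ / 2 + β))
      = gammaOneConst τ := by
    have h1 := doubleGamma_inv_of_pos hτ (w := 1) (by simp)
    have h2 := doubleGamma_inv_of_pos hτ (w := 1 + 1) (by norm_num)
    rw [hstep, h2, doubleGamma_shift_one hτ 1, hone, barnesGamma_one_eq hτ, hdiff] at h1
    have n1 : doubleGamma τ (1 + 1) ≠ 0 := doubleGamma_ne_zero_of_pos (by norm_num)
    have n2 : Complex.Gamma (1 / τ) ≠ 0 := by
      refine Complex.Gamma_ne_zero_of_re_pos ?_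
      rw [Complex.div_ofReal_re]
      simpa using hτ
    have n3 := Complex.exp_ne_zero (1 / τ * Real.log τ)
    have n4 := Complex.exp_ne_zero (Real.log τ * doubleAnomaly τ 1)
    refine mul_right_cancel₀ (mul_ne_zero (mul_ne_zero n1 n2) (mul_ne_zero n3 n4)) ?_
    linear_combination h1
  refine shift_induction one_pos (P := fun w => doubleGamma (1 / τ) (w / τ) = doubleGamma τ w
      * Complex.exp (Real.log τ * doubleAnomaly τ w))
    (fun w hw => doubleGamma_inv_of_pos hτ hw) (fun w ih => ?_) w
  rw [Complex.ofReal_one] at ih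
  rw [hstep, ih, hdiff, hone, doubleGamma_shift_one hτ w, barnesGamma_one_eq hτ, ← hconst]
  ring

end DoubleGamma

/-! ### The Mellin transform at the integers, its involution and its degenerate case -/

section

variable {τ l₁ l₂ : ℝ}

theorem morrisRatio_zero (hτ : 0 < τ) (hl₁ : 0 ≤ l₁) (hl₂ : 0 ≤ l₂) :
    morrisRatio 0 τ l₁ l₂ = 1 := by
  have hA : doubleGamma τ (τ * (l₁ + l₂ + 1) + 1) ≠ 0 := by
    refine doubleGamma_ne_zero_of_pos ?_
    have : (τ * (l₁ + l₂ + 1) + 1 : ℂ).re = τ * (l₁ + l₂ + 1) + 1 := by simp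
    rw [this]
    positivity
  have hB : doubleGamma τ τ ≠ 0 := doubleGamma_ne_zero_of_pos (by simpa using hτ)
  have hC : ∀ l : ℝ, 0 ≤ l → doubleGamma τ (τ * (1 + l) + 1) ≠ 0 := by
    intro l hl
    refine doubleGamma_ne_zero_of_pos ?_
    have : (τ * (1 + l) + 1 : ℂ).re = τ * (1 + l) + 1 := by simp
    rw [this]
    positivity
  simp only [morrisRatio, sub_zero, neg_zero, zero_add]
  rw [div_self hA, div_self hB, div_self (hC l₁ hl₁), div_self (hC l₂ hl₂)]
  ring

/-- The shift `q ↦ q + 1` of the ratio of double gamma functions. -/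
theorem morrisRatio_add_one (hτ : 0 < τ) (q : ℂ) :
    morrisRatio (q + 1) τ l₁ l₂ = morrisRatio q τ l₁ l₂ * Complex.exp (-(Real.log τ / τ))
      * (Complex.Gamma (1 + l₁ + l₂ - q / τ) * Complex.Gamma (1 - (q + 1) / τ)
        / (Complex.Gamma (1 + l₁ - q / τ) * Complex.Gamma (1 + l₂ - q / τ))) := by
  have hτ0 : (τ : ℂ) ≠ 0 := by exact_mod_cast hτ.ne'
  have hstep : ∀ w s : ℂ, (w - 1) / τ = s → doubleGamma τ (w - 1)
      = gammaOneConst τ * Complex.exp (s * Real.log τ) * Complex.Gamma s * doubleGamma τ w := by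
    intro w s hs
    rw [doubleGamma_shift_one hτ (w - 1), barnesGamma_one_eq hτ, sub_add_cancel, hs]
  have hA := hstep (τ * (l₁ + l₂ + 1) + 1 - q) (1 + l₁ + l₂ - q / τ) (by field_simp; ring)
  have hB := hstep (-q + τ) (1 - (q + 1) / τ) (by field_simp; ring)
  have hC := hstep (τ * (1 + l₁) + 1 - q) (1 + l₁ - q / τ) (by field_simp; ring)
  have hD := hstep (τ * (1 + l₂) + 1 - q) (1 + l₂ - q / τ) (by field_simp; ring)
  have e1 : ∀ w : ℂ, w - (q + 1) = w - q - 1 := fun w => by ring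
  have e2 : -(q + 1) + (τ : ℂ) = -q + τ - 1 := by ring
  have hexp : Complex.exp ((1 + l₁ + l₂ - q / τ) * Real.log τ)
        * Complex.exp ((1 - (q + 1) / τ) * Real.log τ)
      = Complex.exp (-(Real.log τ / τ)) * Complex.exp ((1 + l₁ - q / τ) * Real.log τ)
        * Complex.exp ((1 + l₂ - q / τ) * Real.log τ) := by
    rw [← Complex.exp_add, ← Complex.exp_add, ← Complex.exp_add]
    congr 1
    field_simp
    ring
  unfold morrisRatio
  rw [e1, e1, e1, e2, hA, hB, hC, hD]
  have hK := gammaOneConst_ne_zero hτ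
  have x1 := Complex.exp_ne_zero ((1 + l₁ - q / τ) * Real.log τ)
  have x2 := Complex.exp_ne_zero ((1 + l₂ - q / τ) * Real.log τ)
  generalize Complex.exp ((1 + l₁ + l₂ - q / τ) * Real.log τ) = E1 at *
  generalize Complex.exp ((1 - (q + 1) / τ) * Real.log τ) = E2 at *
  generalize Complex.exp ((1 + l₁ - q / τ) * Real.log τ) = E3 at *
  generalize Complex.exp ((1 + l₂ - q / τ) * Real.log τ) = E4 at *
  generalize Complex.exp (-(Real.log τ / τ)) = E5 at *
  have h5 : E5 = E1 * E2 * E3⁻¹ * E4⁻¹ := by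
    rw [hexp]
    field_simp
  rw [h5]
  -- Only the constant of `Γ_1` cancels: the other factors may vanish.
  simp only [div_eq_mul_inv, mul_inv]
  have hKK : gammaOneConst τ * (gammaOneConst τ)⁻¹ = 1 := mul_inv_cancel₀ hK
  generalize (gammaOneConst τ)⁻¹ = K' at *
  generalize gammaOneConst τ = K at *
  have hKK2 : K ^ 2 * K' ^ 2 = 1 := by rw [← mul_pow, hKK, one_pow]
  refine Eq.trans ?_ ((congrArg (fun x => x * _) hKK2).trans (one_mul _))
  ring

theorem morrisMellin_zero (hτ : 0 < τ) (hl₁ : 0 ≤ l₁) (hl₂ : 0 ≤ l₂) :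
    morrisMellin 0 τ l₁ l₂ = 1 := by
  simp [morrisMellin, morrisRatio_zero hτ hl₁ hl₂]

theorem gamma_one_sub_inv_pos (hτ : 1 < τ) : 0 < Real.Gamma (1 - 1 / τ) := by
  refine Real.Gamma_pos_of_pos ?_
  rw [sub_pos, div_lt_one (by linarith)]
  exact hτ

/-- The factor of the Morris product that accounts for the shift `q ↦ q + 1`. -/
noncomputable def morrisStep (q : ℂ) (τ l₁ l₂ : ℝ) : ℂ :=
  2 * Real.pi * (Complex.Gamma (1 + l₁ + l₂ - q / τ) * Complex.Gamma (1 - (q + 1) / τ)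
    / (Complex.Gamma (1 + l₁ - q / τ) * Complex.Gamma (1 + l₂ - q / τ)
      * Real.Gamma (1 - 1 / τ)))

theorem morrisMellin_add_one (hτ : 1 < τ) (q : ℂ) :
    morrisMellin (q + 1) τ l₁ l₂ = morrisMellin q τ l₁ l₂ * morrisStep q τ l₁ l₂ := by
  have hτ0 : 0 < τ := by linarith
  have hG : ((Real.Gamma (1 - 1 / τ) : ℝ) : ℂ) ≠ 0 := by
    exact_mod_cast (gamma_one_sub_inv_pos hτ).ne'
  have hc : ((2 * Real.pi * τ ^ (1 / τ) : ℝ) : ℂ) ≠ 0 := by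
    have : 0 < 2 * Real.pi * τ ^ (1 / τ) := by positivity
    exact_mod_cast this.ne'
  have hpow : ((τ ^ (1 / τ) : ℝ) : ℂ) * Complex.exp (-(Real.log τ / τ)) = 1 := by
    rw [Real.rpow_def_of_pos hτ0, Complex.ofReal_exp, ← Complex.exp_add]
    push_cast
    rw [mul_one_div, add_neg_cancel, Complex.exp_zero]
  unfold morrisMellin morrisStep
  rw [morrisRatio_add_one hτ0, Complex.cpow_add _ _ hc, Complex.cpow_add _ _ hG, Complex.cpow_one,
    Complex.cpow_one]
  generalize ((Real.Gamma (1 - 1 / τ) : ℝ) : ℂ) = G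
  generalize Complex.exp (-(Real.log τ / τ)) = E at *
  rw [Complex.ofReal_mul (2 * Real.pi) (τ ^ (1 / τ))] at *
  generalize ((τ ^ (1 / τ) : ℝ) : ℂ) = T at *
  push_cast at *
  refine Eq.trans ?_ ((congrArg (fun x => x * _) hpow).trans (one_mul _))
  simp only [div_eq_mul_inv, mul_inv]
  ring

theorem morrisMellin_natCast (hτ : 1 < τ) (hl₁ : 0 ≤ l₁) (hl₂ : 0 ≤ l₂) (n : ℕ) :
    morrisMellin n τ l₁ l₂ = morrisProduct n τ l₁ l₂ := by
  induction n with
  | zero => simp [morrisMellin_zero (by linarith : 0 < τ) hl₁ hl₂, morrisProduct]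
  | succ n ih =>
    rw [Nat.cast_succ, morrisMellin_add_one hτ, ih, morrisProduct, morrisProduct,
      Finset.prod_range_succ, pow_succ, morrisStep]
    push_cast
    simp only [← Complex.Gamma_ofReal]
    push_cast
    ring

/-- The product of gamma functions that gives the negative integer moments. -/
noncomputable def morrisNegProduct (n : ℕ) (τ l₁ l₂ : ℝ) : ℝ :=
  ((2 * Real.pi) ^ n)⁻¹ * ∏ j ∈ Finset.range n,
    Real.Gamma (1 + l₁ + (j + 1) / τ) * Real.Gamma (1 + l₂ + (j + 1) / τ) * Real.Gamma (1 - 1 / τ)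
      / (Real.Gamma (1 + l₁ + l₂ + (j + 1) / τ) * Real.Gamma (1 + j / τ))

theorem morrisMellin_neg_natCast (hτ : 1 < τ) (hl₁ : 0 ≤ l₁) (hl₂ : 0 ≤ l₂) (n : ℕ) :
    morrisMellin (-(n : ℂ)) τ l₁ l₂ = morrisNegProduct n τ l₁ l₂ := by
  have hτ0 : 0 < τ := by linarith
  induction n with
  | zero => simp [morrisMellin_zero hτ0 hl₁ hl₂, morrisNegProduct]
  | succ n ih =>
    have hG : ∀ l : ℝ, 0 ≤ l → ((Real.Gamma (1 + l + (n + 1) / τ) : ℝ) : ℂ) ≠ 0 := by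
      intro l hl
      exact_mod_cast (Real.Gamma_pos_of_pos (by positivity)).ne'
    have hA : ((Real.Gamma (1 + l₁ + l₂ + (n + 1) / τ) : ℝ) : ℂ) ≠ 0 := by
      have := hG (l₁ + l₂) (by positivity)
      rwa [← add_assoc] at this
    have hB : ((Real.Gamma (1 + n / τ) : ℝ) : ℂ) ≠ 0 := by
      exact_mod_cast (Real.Gamma_pos_of_pos (by positivity)).ne'
    have hC := hG l₁ hl₁
    have hD := hG l₂ hl₂
    have hE : ((Real.Gamma (1 - 1 / τ) : ℝ) : ℂ) ≠ 0 := by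
      exact_mod_cast (gamma_one_sub_inv_pos hτ).ne'
    have hpi : (Real.pi : ℂ) ≠ 0 := by exact_mod_cast Real.pi_ne_zero
    have h1 := morrisMellin_add_one (l₁ := l₁) (l₂ := l₂) hτ (-((n + 1 : ℕ) : ℂ))
    have h2 : morrisStep (-((n + 1 : ℕ) : ℂ)) τ l₁ l₂ = 2 * Real.pi *
        ((Real.Gamma (1 + l₁ + l₂ + (n + 1) / τ) : ℝ) * (Real.Gamma (1 + n / τ) : ℝ)
        / ((Real.Gamma (1 + l₁ + (n + 1) / τ) : ℝ) * (Real.Gamma (1 + l₂ + (n + 1) / τ) : ℝ)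
          * (Real.Gamma (1 - 1 / τ) : ℝ)) : ℂ) := by
      rw [morrisStep]
      simp only [← Complex.Gamma_ofReal]
      push_cast
      ring_nf
    rw [show -((n + 1 : ℕ) : ℂ) + 1 = -(n : ℂ) by push_cast; ring, ih, h2] at h1
    have h3 : (morrisNegProduct (n + 1) τ l₁ l₂ : ℂ) = morrisNegProduct n τ l₁ l₂ *
        (2 * Real.pi : ℂ)⁻¹ * ((Real.Gamma (1 + l₁ + (n + 1) / τ) : ℝ)
          * (Real.Gamma (1 + l₂ + (n + 1) / τ) : ℝ) * (Real.Gamma (1 - 1 / τ) : ℝ)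
        / ((Real.Gamma (1 + l₁ + l₂ + (n + 1) / τ) : ℝ) * (Real.Gamma (1 + n / τ) : ℝ))) := by
      rw [morrisNegProduct, morrisNegProduct, Finset.prod_range_succ, pow_succ, mul_inv]
      push_cast
      ring
    rw [h3, h1]
    generalize ((Real.Gamma (1 + l₁ + l₂ + (n + 1) / τ) : ℝ) : ℂ) = gA at *
    generalize ((Real.Gamma (1 + n / τ) : ℝ) : ℂ) = gB at *
    generalize ((Real.Gamma (1 + l₁ + (n + 1) / τ) : ℝ) : ℂ) = gC at *
    generalize ((Real.Gamma (1 + l₂ + (n + 1) / τ) : ℝ) : ℂ) = gD at *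
    generalize ((Real.Gamma (1 - 1 / τ) : ℝ) : ℂ) = gE at *
    field_simp

/-- The involution `τ ↦ 1 / τ`. The functional equations hold at all points with the value `0` at
the poles, and so does this identity: no double gamma value that depends on `q` is cancelled. -/
theorem morrisRatio_involution (hτ : 0 < τ) (q : ℂ) :
    (((1 / τ) ^ τ : ℝ) : ℂ) ^ (q / τ) * morrisRatio (q / τ) (1 / τ) (τ * l₁) (τ * l₂)
        * Complex.Gamma (1 - q / τ) =
      ((τ ^ (1 / τ) : ℝ) : ℂ) ^ q * morrisRatio q τ l₁ l₂ * Complex.Gamma (1 - q) := by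
  have hτ0 : (τ : ℂ) ≠ 0 := by exact_mod_cast hτ.ne'
  set L : ℂ := ((Real.log τ : ℝ) : ℂ) with hL
  have hp1 : (((1 / τ) ^ τ : ℝ) : ℂ) ^ (q / τ) = Complex.exp (-(L * q)) := by
    have h0 : (0 : ℝ) < 1 / τ := by positivity
    rw [Real.rpow_def_of_pos h0, one_div, Real.log_inv, Complex.ofReal_exp,
      Complex.cpow_def_of_ne_zero (Complex.exp_ne_zero _), ← Complex.ofReal_exp,
      ← Complex.ofReal_log (Real.exp_pos _).le, Real.log_exp]
    congr 1
    push_cast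
    field_simp
    rw [hL]
    ring
  have hp2 : ((τ ^ (1 / τ) : ℝ) : ℂ) ^ q = Complex.exp (q / τ * L) := by
    rw [Real.rpow_def_of_pos hτ, Complex.ofReal_exp,
      Complex.cpow_def_of_ne_zero (Complex.exp_ne_zero _), ← Complex.ofReal_exp,
      ← Complex.ofReal_log (Real.exp_pos _).le, Real.log_exp]
    congr 1
    push_cast
    field_simp
    rw [hL]
    ring
  have hinv : ∀ s w : ℂ, s = w / τ → doubleGamma (1 / τ) s
      = doubleGamma τ w * Complex.exp (L * doubleAnomaly τ w) := by
    intro s w hs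
    rw [hs, doubleGamma_inv hτ]
  have hD1 : ∀ q : ℂ, doubleGamma τ (1 - q) = gammaOneConst 1 * Complex.Gamma (1 - q)
      * doubleGamma τ (1 + τ - q) := by
    intro q
    rw [doubleGamma_shift_tau hτ, barnesGamma_one_eq one_pos, show 1 - q + τ = 1 + τ - q by ring]
    simp
  have hDt : ∀ q : ℂ, doubleGamma τ (-q + τ) = gammaOneConst τ * Complex.exp (L - q / τ * L)
      * Complex.Gamma (1 - q / τ) * doubleGamma τ (1 + τ - q) := by
    intro q
    rw [doubleGamma_shift_one hτ, barnesGamma_one_eq hτ,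
      show -q + τ + 1 = 1 + τ - q by ring, show (-q + τ) / τ = 1 - q / τ by field_simp; ring,
      sub_mul, one_mul]
  have hD1' := hD1 0
  have hDt' := hDt 0
  simp only [sub_zero, neg_zero, zero_add, zero_div, zero_mul, Complex.Gamma_one, mul_one]
    at hD1' hDt'
  obtain ⟨β, γ, hQ⟩ := exists_doubleAnomaly_eq hτ
  have hE0 : doubleGamma τ (1 + τ) ≠ 0 := doubleGamma_ne_zero_of_pos (by
    simp only [Complex.add_re, Complex.one_re, Complex.ofReal_re]
    linarith)
  -- The coefficients `β` and `γ` cancel in this combination of anomalies; what remains is `L * q`.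
  have hexp : Complex.exp (-(L * q)) * (Complex.exp (L * doubleAnomaly τ (τ * (l₁ + l₂ + 1) + 1 - q))
        * (Complex.exp (L * doubleAnomaly τ (τ * (l₁ + l₂ + 1) + 1)))⁻¹
        * Complex.exp (L * doubleAnomaly τ (1 - q)) * (Complex.exp (L * doubleAnomaly τ 1))⁻¹
        * Complex.exp (L * doubleAnomaly τ (τ * (1 + l₁) + 1))
        * (Complex.exp (L * doubleAnomaly τ (τ * (1 + l₁) + 1 - q)))⁻¹
        * Complex.exp (L * doubleAnomaly τ (τ * (1 + l₂) + 1))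
        * (Complex.exp (L * doubleAnomaly τ (τ * (1 + l₂) + 1 - q)))⁻¹) = 1 := by
    simp only [← Complex.exp_neg, ← Complex.exp_add]
    rw [Complex.exp_eq_one_iff]
    refine ⟨0, ?_⟩
    simp only [hQ]
    field_simp
    push_cast
    ring
  rw [hp1, hp2]
  unfold morrisRatio
  rw [hinv _ (τ * (l₁ + l₂ + 1) + 1 - q) (by push_cast; field_simp; ring),
    hinv _ (τ * (l₁ + l₂ + 1) + 1) (by push_cast; field_simp; ring),
    hinv _ (1 - q) (by push_cast; field_simp; ring),
    hinv _ 1 (by push_cast; ring),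
    hinv _ (τ * (1 + l₁) + 1) (by push_cast; field_simp; ring),
    hinv _ (τ * (1 + l₁) + 1 - q) (by push_cast; field_simp; ring),
    hinv _ (τ * (1 + l₂) + 1) (by push_cast; field_simp; ring),
    hinv _ (τ * (1 + l₂) + 1 - q) (by push_cast; field_simp; ring)]
  rw [hD1 q, hD1', hDt q, hDt', Complex.exp_sub]
  have hK1 := mul_inv_cancel₀ (gammaOneConst_ne_zero (one_pos (α := ℝ)))
  have hKt := mul_inv_cancel₀ (gammaOneConst_ne_zero hτ)
  have hLL := mul_inv_cancel₀ (Complex.exp_ne_zero L)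
  have hqq := mul_inv_cancel₀ (Complex.exp_ne_zero (q / τ * L))
  have hall := ((congrArg₂ (· * ·) hexp hK1).trans (by norm_num)).trans
    (congrArg₂ (· * ·) hKt (congrArg₂ (· * ·) hLL hqq)).symm
  linear_combination (doubleGamma τ (τ * (l₁ + l₂ + 1) + 1 - q)
    * (doubleGamma τ (τ * (l₁ + l₂ + 1) + 1))⁻¹ * Complex.Gamma (1 - q)
    * doubleGamma τ (1 + τ - q) * (doubleGamma τ (1 + τ))⁻¹
    * doubleGamma τ (τ * (1 + l₁) + 1) * (doubleGamma τ (τ * (1 + l₁) + 1 - q))⁻¹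
    * doubleGamma τ (τ * (1 + l₂) + 1) * (doubleGamma τ (τ * (1 + l₂) + 1 - q))⁻¹
    * Complex.Gamma (1 - q / τ)) * hall

theorem morrisMellin_involution (hτ : 1 < τ)
    (hk : ∀ k : ℕ, τ ≠ k) (q : ℂ) :
    morrisMellin (q / τ) (1 / τ) (τ * l₁) (τ * l₂) * ((2 * Real.pi : ℝ) : ℂ) ^ (-(q / τ))
        * ((Real.Gamma (1 - τ) : ℝ) : ℂ) ^ (q / τ) * Complex.Gamma (1 - q / τ) =
      morrisMellin q τ l₁ l₂ * ((2 * Real.pi : ℝ) : ℂ) ^ (-q)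
        * ((Real.Gamma (1 - 1 / τ) : ℝ) : ℂ) ^ q * Complex.Gamma (1 - q) := by
  have hτ0 : 0 < τ := by linarith
  have hG : ((Real.Gamma (1 - 1 / τ) : ℝ) : ℂ) ≠ 0 := by
    exact_mod_cast (gamma_one_sub_inv_pos hτ).ne'
  have hG' : ((Real.Gamma (1 - τ) : ℝ) : ℂ) ≠ 0 := by
    have : Real.Gamma (1 - τ) ≠ 0 := by
      refine Real.Gamma_ne_zero fun m h => hk (m + 1) ?_
      push_cast
      linarith
    exact_mod_cast this
  have h2pi : ((2 * Real.pi : ℝ) : ℂ) ≠ 0 := by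
    exact_mod_cast (by positivity : 2 * Real.pi ≠ 0)
  have hmain := morrisRatio_involution (l₁ := l₁) (l₂ := l₂) hτ0 q
  have hz : ∀ x z : ℂ, x ≠ 0 → x ^ z ≠ 0 := fun x z hx => by simp [Complex.cpow_eq_zero_iff, hx]
  unfold morrisMellin
  rw [one_div_one_div, Complex.ofReal_mul (2 * Real.pi), Complex.ofReal_mul (2 * Real.pi),
    Complex.mul_cpow_ofReal_nonneg (by positivity) (by positivity),
    Complex.mul_cpow_ofReal_nonneg (by positivity) (by positivity),
    Complex.cpow_neg, Complex.cpow_neg]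
  have h1 := hz _ q h2pi
  have h2 := hz _ (q / τ) h2pi
  have h3 := hz _ q hG
  have h4 := hz _ (q / τ) hG'
  refine Eq.trans ?_ (hmain.trans ?_)
  · field_simp
  · generalize ((Real.Gamma (1 - 1 / τ) : ℝ) : ℂ) ^ q = G at *
    field_simp

/-- The degenerate case, in which the ratio of double gamma functions collapses to a gamma
function. -/
theorem morrisMellin_zero_zero (hτ : 0 < τ) {q : ℂ}
    (hq : ∀ m n : ℕ, q ≠ τ + m + n * (τ : ℂ)) :
    morrisMellin q τ 0 0 = ((2 * Real.pi : ℝ) : ℂ) ^ q / ((Real.Gamma (1 - 1 / τ) : ℝ) : ℂ) ^ q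
          * Complex.Gamma (1 - q / τ) := by
  have hτ0 : (τ : ℂ) ≠ 0 := by exact_mod_cast hτ.ne'
  have hp : ((τ ^ (1 / τ) : ℝ) : ℂ) ^ q = Complex.exp (q / τ * Real.log τ) := by
    rw [Real.rpow_def_of_pos hτ, Complex.ofReal_exp,
      Complex.cpow_def_of_ne_zero (Complex.exp_ne_zero _), ← Complex.ofReal_exp,
      ← Complex.ofReal_log (Real.exp_pos _).le, Real.log_exp]
    congr 1
    push_cast
    ring
  have hD : ∀ q : ℂ, doubleGamma τ (-q + τ) = gammaOneConst τ
      * Complex.exp (Real.log τ - q / τ * Real.log τ)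
      * Complex.Gamma (1 - q / τ) * doubleGamma τ (τ + 1 - q) := by
    intro q
    rw [doubleGamma_shift_one hτ, barnesGamma_one_eq hτ,
      show -q + τ + 1 = τ + 1 - q by ring, show (-q + τ) / τ = 1 - q / τ by field_simp; ring,
      sub_mul, one_mul]
  have hD0 := hD 0
  simp only [sub_zero, neg_zero, zero_add, zero_div, zero_mul, Complex.Gamma_one, mul_one] at hD0
  have h1 : doubleGamma τ (τ + 1 - q) ≠ 0 := by
    refine doubleGamma_ne_zero hτ fun m n h => hq (m + 1) n ?_
    push_cast
    linear_combination -h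
  have h2 : doubleGamma τ (τ + 1) ≠ 0 := doubleGamma_ne_zero_of_pos (by
    simp only [Complex.add_re, Complex.one_re, Complex.ofReal_re]
    linarith)
  have hK := gammaOneConst_ne_zero hτ
  unfold morrisMellin morrisRatio
  simp only [Complex.ofReal_zero, add_zero, zero_add, mul_one]
  rw [hD q, hD0, Complex.ofReal_mul (2 * Real.pi),
    Complex.mul_cpow_ofReal_nonneg (by positivity) (by positivity), hp, Complex.exp_sub]
  have x1 := Complex.exp_ne_zero ((Real.log τ : ℝ) : ℂ)
  have x2 := Complex.exp_ne_zero (q / τ * Real.log τ)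
  generalize Complex.exp (q / τ * Real.log τ) = E1 at *
  generalize Complex.exp ((Real.log τ : ℝ) : ℂ) = E2 at *
  generalize Complex.Gamma (1 - q / τ) = G
  generalize ((Real.Gamma (1 - 1 / τ) : ℝ) : ℂ) ^ q = G'
  generalize doubleGamma τ (τ + 1 - q) = D1 at *
  generalize doubleGamma τ (τ + 1) = D2 at *
  simp only [div_eq_mul_inv]
  field_simp

end

/-! ### Mellin transforms, moments and infinite divisibility -/

theorem cpow_eq_exp_mul_log {x : ℝ} (hx : 0 < x) (q : ℂ) :
    (x : ℂ) ^ q = Complex.exp (q * Real.log x) := by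
  rw [Complex.cpow_def_of_ne_zero (by exact_mod_cast hx.ne'), ← Complex.ofReal_log hx.le, mul_comm]

theorem charFun_map_log {μ : Measure ℝ} (hμ : ∀ᵐ x ∂μ, 0 < x) (u : ℝ) :
    charFun (μ.map Real.log) u = ∫ x : ℝ, (x : ℂ) ^ ((u : ℂ) * Complex.I) ∂μ := by
  rw [charFun_apply_real, integral_map Real.measurable_log.aemeasurable
    (Measurable.aestronglyMeasurable (by fun_prop))]
  refine integral_congr_ae (hμ.mono fun x hx => ?_)
  simp only [cpow_eq_exp_mul_log hx]
  congr 1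
  ring

theorem map_exp_map_log {μ : Measure ℝ} (hμ : ∀ᵐ x ∂μ, 0 < x) :
    (μ.map Real.log).map Real.exp = μ := by
  rw [Measure.map_map Real.measurable_exp Real.measurable_log]
  conv_rhs => rw [← Measure.map_id (μ := μ)]
  exact Measure.map_congr (hμ.mono fun x hx => Real.exp_log hx)

/-- A finite measure on `(0, ∞)` is determined by its Mellin transform on the imaginary axis. -/
theorem ext_of_mellin {μ ν : Measure ℝ} [IsFiniteMeasure μ] [IsFiniteMeasure ν]
    (hμ : ∀ᵐ x ∂μ, 0 < x) (hν : ∀ᵐ x ∂ν, 0 < x)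
    (h : ∀ u : ℝ, ∫ x : ℝ, (x : ℂ) ^ ((u : ℂ) * Complex.I) ∂μ
      = ∫ x : ℝ, (x : ℂ) ^ ((u : ℂ) * Complex.I) ∂ν) : μ = ν := by
  rw [← map_exp_map_log hμ, ← map_exp_map_log hν]
  congr 1
  refine Measure.ext_of_charFun (funext fun u => ?_)
  rw [charFun_map_log hμ, charFun_map_log hν, h]

theorem IsBarnesBeta.eq {M N : ℕ} {a : Fin M → ℝ} {b₀ : ℝ} {b : Fin N → ℝ} {μ ν : Measure ℝ}
    (hb₀ : 0 < b₀) (hμ : IsBarnesBeta a b₀ b μ) (hν : IsBarnesBeta a b₀ b ν) : μ = ν := by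
  have := hμ.isProbabilityMeasure
  have := hν.isProbabilityMeasure
  refine ext_of_mellin (hμ.support.mono fun _ h => h.1) (hν.support.mono fun _ h => h.1)
    fun u => ?_
  have hu : -b₀ < ((u : ℂ) * Complex.I).re := by simpa using hb₀
  rw [(hμ.mellin _ hu).2, (hν.mellin _ hu).2]

theorem barnesBeta_eq {M N : ℕ} {a : Fin M → ℝ} {b₀ : ℝ} {b : Fin N → ℝ} {μ : Measure ℝ}
    (hb₀ : 0 < b₀) (hμ : IsBarnesBeta a b₀ b μ) : barnesBeta a b₀ b = μ := by
  have h : ∃ μ, IsBarnesBeta a b₀ b μ := ⟨μ, hμ⟩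
  rw [barnesBeta, dif_pos h]
  exact h.choose_spec.eq hb₀ hμ

theorem integrable_pow_of_integrable_exp {ν : Measure ℝ} (h0 : ∀ᵐ x ∂ν, 0 ≤ x)
    (h : Integrable Real.exp ν) (n : ℕ) : Integrable (fun x : ℝ => x ^ n) ν := by
  refine (h.const_mul (n.factorial : ℝ)).mono' (by fun_prop) (h0.mono fun x hx => ?_)
  rw [Real.norm_of_nonneg (pow_nonneg hx n)]
  have := Real.pow_div_factorial_le_exp x hx n
  rwa [div_le_iff₀ (by positivity), mul_comm] at this

theorem hasSum_charFun_of_summable_moments {ν : Measure ℝ} [IsFiniteMeasure ν]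
    (h0 : ∀ᵐ x ∂ν, 0 ≤ x) (hint : ∀ n : ℕ, Integrable (fun x : ℝ => x ^ n) ν) (u : ℝ)
    (hs : Summable fun n : ℕ => |u| ^ n / (n.factorial : ℝ) * ∫ x, x ^ n ∂ν) :
    HasSum (fun n : ℕ => (u * Complex.I) ^ n / (n.factorial : ℂ) * ((∫ x, x ^ n ∂ν : ℝ) : ℂ))
      (charFun ν u) := by
  let F : ℕ → ℝ → ℂ := fun n x => (u * Complex.I) ^ n / (n.factorial : ℂ) * ((x ^ n : ℝ) : ℂ)
  have hF : ∀ n, Integrable (F n) ν := fun n => (hint n).ofReal.const_mul _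
  have hnorm : ∀ n, ∫ x, ‖F n x‖ ∂ν = |u| ^ n / (n.factorial : ℝ) * ∫ x, x ^ n ∂ν := fun n => by
    rw [← integral_const_mul]
    refine integral_congr_ae (h0.mono fun x hx => ?_)
    simp [F, abs_of_nonneg hx]
  have key := hasSum_integral_of_summable_integral_norm hF (by simpa only [hnorm] using hs)
  have hL : (fun n => ∫ x, F n x ∂ν)
      = fun n : ℕ => (u * Complex.I) ^ n / (n.factorial : ℂ) * ((∫ x, x ^ n ∂ν : ℝ) : ℂ) := by
    funext n
    simp only [F]
    rw [integral_const_mul, integral_complex_ofReal]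
  have hR : (∫ x, ∑' n, F n x ∂ν) = charFun ν u := by
    rw [charFun_apply_real]
    congr 1
    funext x
    have h1 := NormedSpace.expSeries_div_hasSum_exp (𝔸 := ℂ) ((u : ℂ) * x * Complex.I)
    rw [← Complex.exp_eq_exp_ℂ] at h1
    rw [← h1.tsum_eq]
    congr 1
    funext n
    simp only [F]
    push_cast
    ring
  rwa [hL, hR] at key

/-- Exponential moments of all orders make the Stieltjes moment problem determinate: the
characteristic function of any solution is then the sum of its moment series. -/
theorem stieltjesDeterminate_of_integrable_exp {ν : Measure ℝ} [IsFiniteMeasure ν]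
    (h0 : ∀ᵐ x ∂ν, 0 ≤ x) (h : ∀ u : ℝ, 0 ≤ u → Integrable (fun x => Real.exp (u * x)) ν) :
    StieltjesDeterminate ν := by
  have hint := integrable_pow_of_integrable_exp h0 (by simpa using h 1 zero_le_one)
  have hs : ∀ u : ℝ, Summable fun n : ℕ => |u| ^ n / (n.factorial : ℝ) * ∫ x, x ^ n ∂ν := by
    intro u
    refine summable_of_sum_range_le (c := ∫ x, Real.exp (|u| * x) ∂ν) (fun n => ?_) fun n => ?_
    · exact mul_nonneg (by positivity)
        (integral_nonneg_of_ae (h0.mono fun x hx => pow_nonneg hx n))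
    · simp_rw [← integral_const_mul]
      rw [← integral_finsetSum _ fun i _ => (hint i).const_mul _]
      refine integral_mono_ae (integrable_finsetSum _ fun i _ => (hint i).const_mul _)
        (h _ (abs_nonneg u)) (h0.mono fun x hx => ?_)
      refine le_trans (le_of_eq ?_) (Real.sum_le_exp_of_nonneg (mul_nonneg (abs_nonneg u) hx) n)
      exact Finset.sum_congr rfl fun i _ => by rw [mul_pow]; ring
  refine ⟨h0, hint, fun ν' h0' hint' hm => ?_⟩
  have : IsFiniteMeasure ν' := by
    have := hint' 0
    simp only [pow_zero] at this
    exact (integrable_const_iff_isFiniteMeasure one_ne_zero).1 this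
  refine Measure.ext_of_charFun (funext fun u => ?_)
  have h1 := hasSum_charFun_of_summable_moments h0 hint u (hs u)
  have h2 := hasSum_charFun_of_summable_moments h0' hint' u (by simpa only [hm] using hs u)
  simp only [hm] at h2
  exact h2.unique h1

/-- A law with a Lévy–Khintchine exponent is infinitely divisible: dividing the drift and the
Lévy density by `n` gives the law of the summands. -/
theorem isInfinitelyDivisible_of_charFun {μ : Measure ℝ} [IsProbabilityMeasure μ] {k c : ℝ → ℝ}
    (hk : Measurable k) (hc : Measurable c) (hk0 : ∀ t, 0 < t → 0 ≤ k t)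
    (hk2 : IntegrableOn (fun t => t ^ 2 * k t) (Set.Ioi 0))
    (hkc : IntegrableOn (fun t => t * k t - c t) (Set.Ioi 0)) (b : ℝ)
    (h : ∀ u : ℝ, charFun μ u = Complex.exp (u * Complex.I * b
      + ∫ t : ℝ in Set.Ioi 0, ((Complex.exp (u * t * Complex.I) - 1) * k t
        - u * Complex.I * c t))) : IsInfinitelyDivisible μ := by
  refine ⟨inferInstance, fun n hn => ?_⟩
  have hn' : (n : ℂ) ≠ 0 := by exact_mod_cast hn.ne'
  obtain ⟨ρ, hρ, hρc⟩ := exists_levyKhintchine (k := fun t => (n : ℝ)⁻¹ * k t)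
    (c := fun t => (n : ℝ)⁻¹ * c t) (hk.const_mul _) (hc.const_mul _)
    (fun t ht => mul_nonneg (by positivity) (hk0 t ht))
    ((hk2.const_mul (n : ℝ)⁻¹).congr (ae_of_all _ fun t => by ring))
    ((hkc.const_mul (n : ℝ)⁻¹).congr (ae_of_all _ fun t => by ring)) ((n : ℝ)⁻¹ * b)
  refine ⟨ρ, hρ, ?_⟩
  have := isProbabilityMeasure_map_sum_pi ρ n
  refine Measure.ext_of_charFun (funext fun u => ?_)
  rw [charFun_map_sum_pi, hρc, h, ← Complex.exp_nat_mul]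
  congr 1
  have : ∀ t : ℝ, (Complex.exp (u * t * Complex.I) - 1) * (((n : ℝ)⁻¹ * k t : ℝ) : ℂ)
      - u * Complex.I * (((n : ℝ)⁻¹ * c t : ℝ) : ℂ) = (n : ℂ)⁻¹ *
        ((Complex.exp (u * t * Complex.I) - 1) * k t - u * Complex.I * c t) := fun t => by
    push_cast
    ring
  simp_rw [this]
  rw [integral_const_mul, mul_add, mul_inv_cancel_left₀ hn']
  congr 1
  push_cast
  generalize (n : ℂ) = z at hn'
  field_simp

/-! ### The distribution `β_{1,0}` -/

theorem gammaMeasure_one_eq (s : ℝ) :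
    gammaMeasure s 1 = (volume.restrict (Set.Ioi 0)).withDensity
      (fun x => ENNReal.ofReal ((Real.Gamma s)⁻¹ * (Real.exp (-x) * x ^ (s - 1)))) := by
  rw [gammaMeasure, ← withDensity_indicator measurableSet_Ioi]
  refine withDensity_congr_ae ?_
  filter_upwards [Measure.ae_ne volume (0 : ℝ)] with x hx
  rcases lt_or_gt_of_ne hx with h | h
  · rw [Set.indicator_of_notMem (by simpa using h.le), gammaPDF, gammaPDFReal,
      if_neg (not_le.2 h), ENNReal.ofReal_zero]
  · rw [Set.indicator_of_mem (by simpa using h), gammaPDF, gammaPDFReal, if_pos h.le]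
    congr 1
    rw [Real.one_rpow, one_mul, one_div]
    ring

theorem ae_pos_gammaMeasure_one (s : ℝ) : ∀ᵐ x ∂(gammaMeasure s 1), 0 < x := by
  rw [gammaMeasure_one_eq]
  exact (withDensity_absolutelyContinuous _ _).ae_le (ae_restrict_mem measurableSet_Ioi)

theorem integrable_gammaMeasure_one_iff {E : Type*} [NormedAddCommGroup E] [NormedSpace ℝ E]
    {s : ℝ} (hs : 0 < s) (g : ℝ → E) : Integrable g (gammaMeasure s 1) ↔
      IntegrableOn (fun x => ((Real.Gamma s)⁻¹ * (Real.exp (-x) * x ^ (s - 1))) • g x)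
        (Set.Ioi 0) := by
  rw [gammaMeasure_one_eq, integrable_withDensity_iff_integrable_smul' (by fun_prop)
    (ae_of_all _ fun x => ENNReal.ofReal_lt_top)]
  refine integrable_congr ((ae_restrict_mem measurableSet_Ioi).mono fun x hx => ?_)
  have hx' : (0 : ℝ) < x := hx
  have := Real.Gamma_pos_of_pos hs
  simp only
  rw [ENNReal.toReal_ofReal (by positivity)]

theorem integral_gammaMeasure_one {E : Type*} [NormedAddCommGroup E] [NormedSpace ℝ E]
    {s : ℝ} (hs : 0 < s) (g : ℝ → E) : ∫ x, g x ∂(gammaMeasure s 1) =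
      ∫ x in Set.Ioi 0, ((Real.Gamma s)⁻¹ * (Real.exp (-x) * x ^ (s - 1))) • g x := by
  rw [gammaMeasure_one_eq, integral_withDensity_eq_integral_toReal_smul (by fun_prop)
    (ae_of_all _ fun x => ENNReal.ofReal_lt_top)]
  refine integral_congr_ae ((ae_restrict_mem measurableSet_Ioi).mono fun x hx => ?_)
  have hx' : (0 : ℝ) < x := hx
  have := Real.Gamma_pos_of_pos hs
  simp only
  rw [ENNReal.toReal_ofReal (by positivity)]

theorem mellin_gammaMeasure_one {s : ℝ} (hs : 0 < s) {q : ℂ} (hq : 0 < (s + q).re) :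
    Integrable (fun x : ℝ => (x : ℂ) ^ q) (gammaMeasure s 1) ∧
      ∫ x : ℝ, (x : ℂ) ^ q ∂(gammaMeasure s 1) = Complex.Gamma (s + q) / Complex.Gamma s := by
  have key : ∀ x ∈ Set.Ioi (0 : ℝ),
      ((Real.Gamma s)⁻¹ * (Real.exp (-x) * x ^ (s - 1))) • (x : ℂ) ^ q
        = (Complex.Gamma s)⁻¹ * (((Real.exp (-x) : ℝ) : ℂ) * (x : ℂ) ^ ((s : ℂ) + q - 1)) := by
    intro x hx
    have hx' : (0 : ℝ) < x := hx
    rw [Complex.real_smul]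
    push_cast
    rw [Complex.ofReal_cpow hx'.le, show (s : ℂ) + q - 1 = ((s - 1 : ℝ) : ℂ) + q by push_cast; ring,
      Complex.cpow_add _ _ (by exact_mod_cast hx'.ne'), ← Complex.Gamma_ofReal]
    ring
  constructor
  · rw [integrable_gammaMeasure_one_iff hs]
    exact (integrableOn_congr_fun key measurableSet_Ioi).2
      ((Complex.GammaIntegral_convergent hq).const_mul _)
  · rw [integral_gammaMeasure_one hs, setIntegral_congr_fun measurableSet_Ioi key,
      integral_const_mul, Complex.Gamma_eq_integral hq, Complex.GammaIntegral, div_eq_inv_mul]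

theorem integrable_exp_half_gammaMeasure_one {s : ℝ} (hs : 0 < s) :
    Integrable (fun x => Real.exp (x / 2)) (gammaMeasure s 1) := by
  rw [integrable_gammaMeasure_one_iff hs]
  have h := (integrableOn_rpow_mul_exp_neg_mul_rpow (p := 1) (s := s - 1) (b := 1 / 2)
    (by linarith) one_pos (by norm_num)).const_mul (Real.Gamma s)⁻¹
  refine h.congr (ae_of_all _ fun x => ?_)
  simp only [smul_eq_mul, Real.rpow_one]
  rw [show -(1 / 2) * x = -x + x / 2 by ring, Real.exp_add]
  ring

/-- The law of `(τ G)^{1/τ}`, where `G` has the gamma distribution of shape `b / τ`; it is the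
Barnes beta distribution `β_{1,0}(τ; b)`. -/
noncomputable def betaOneZero (τ b : ℝ) : Measure ℝ :=
  (gammaMeasure (b / τ) 1).map fun g => (τ * g) ^ (1 / τ)

section BetaOneZero

variable {τ b : ℝ}

theorem measurable_mul_rpow (τ r : ℝ) : Measurable fun g : ℝ => (τ * g) ^ r := by
  fun_prop

theorem isProbabilityMeasure_betaOneZero (hτ : 0 < τ) (hb : 0 < b) :
    IsProbabilityMeasure (betaOneZero τ b) := by
  have := isProbabilityMeasure_gammaMeasure (div_pos hb hτ) one_pos
  exact Measure.isProbabilityMeasure_map (measurable_mul_rpow _ _).aemeasurable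

theorem ae_pos_betaOneZero (hτ : 0 < τ) : ∀ᵐ y ∂(betaOneZero τ b), 0 < y := by
  rw [betaOneZero, ae_map_iff (measurable_mul_rpow _ _).aemeasurable measurableSet_Ioi]
  exact (ae_pos_gammaMeasure_one _).mono fun g hg => Real.rpow_pos_of_pos (mul_pos hτ hg) _

theorem barnesS_one_zero (q : ℂ) : barnesS ![τ] b ![] q = logBarnesGamma ![τ] (q + b) := by
  rw [barnesS, Fintype.sum_eq_single ∅ fun s hs => absurd (Finset.eq_empty_of_isEmpty s) hs]
  simp

theorem barnesEta_one_zero (hτ : 0 < τ) (hb : 0 < b) {q : ℂ} (hq : -b < q.re) :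
    barnesEta ![τ] b ![] q = Complex.exp (q / τ * Real.log τ)
      * (Complex.Gamma ((b / τ : ℝ) + q / τ) / Complex.Gamma (b / τ : ℝ)) := by
  have hb' : 0 < (b : ℂ).re := by simpa using hb
  have hq' : 0 < (q + b).re := by simp; linarith
  have hτ' : (τ : ℂ) ≠ 0 := by exact_mod_cast hτ.ne'
  rw [barnesEta, barnesS_one_zero, barnesS_one_zero, zero_add, Complex.exp_sub, exp_logBarnesGamma_one hτ hq',
    exp_logBarnesGamma_one hτ hb', add_div, add_mul, Complex.exp_add]
  have h2 := Complex.exp_ne_zero ((b : ℂ) / τ * Real.log τ)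
  have h3 := gammaOneConst_ne_zero hτ
  have h4 : Complex.Gamma ((b : ℂ) / τ) ≠ 0 := by
    have := Real.Gamma_pos_of_pos (div_pos hb hτ)
    rw [← Complex.ofReal_div, Complex.Gamma_ofReal]
    exact_mod_cast this.ne'
  rw [add_comm (q / (τ : ℂ)), Complex.ofReal_div]
  generalize Complex.Gamma ((b : ℂ) / τ) = x at *
  generalize Complex.Gamma ((b : ℂ) / τ + q / τ) = y at *
  generalize Complex.exp ((b : ℂ) / τ * Real.log τ) = z at *
  generalize Complex.exp (q / τ * Real.log τ) = v at *
  field_simp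

theorem isBarnesBeta_betaOneZero (hτ : 0 < τ) (hb : 0 < b) :
    IsBarnesBeta ![τ] b ![] (betaOneZero τ b) := by
  have hae : ∀ q : ℂ, (fun g : ℝ => (((τ * g) ^ (1 / τ) : ℝ) : ℂ) ^ q)
      =ᵐ[gammaMeasure (b / τ) 1]
        fun g : ℝ => Complex.exp (q / τ * Real.log τ) * (g : ℂ) ^ (q / τ) := fun q => by
    filter_upwards [ae_pos_gammaMeasure_one (b / τ)] with g hg
    rw [cpow_eq_exp_mul_log (Real.rpow_pos_of_pos (mul_pos hτ hg) _), cpow_eq_exp_mul_log hg,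
      ← Complex.exp_add, Real.log_rpow (mul_pos hτ hg), Real.log_mul hτ.ne' hg.ne']
    congr 1
    push_cast
    ring
  refine ⟨isProbabilityMeasure_betaOneZero hτ hb,
    (ae_pos_betaOneZero hτ).mono fun y hy => ⟨hy, fun h => absurd h (by norm_num)⟩, fun q hq => ?_⟩
  have hre : 0 < (((b / τ : ℝ) : ℂ) + q / τ).re := by
    rw [Complex.add_re, Complex.ofReal_re, Complex.div_ofReal_re, ← add_div]
    exact div_pos (by linarith) hτ
  obtain ⟨hi, he⟩ := mellin_gammaMeasure_one (div_pos hb hτ) hre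
  constructor
  · rw [betaOneZero, integrable_map_measure (Measurable.aestronglyMeasurable (by fun_prop))
      (measurable_mul_rpow _ _).aemeasurable]
    exact (hi.const_mul _).congr (hae q).symm
  · rw [betaOneZero, integral_map (measurable_mul_rpow _ _).aemeasurable
      (Measurable.aestronglyMeasurable (by fun_prop)), integral_congr_ae (hae q),
      integral_const_mul, he, barnesEta_one_zero hτ hb hq]

/-- For `1 < τ` the tail of `β_{1,0}(τ; b)`, of order `exp (-y ^ τ / τ)`, is lighter than any
exponential. -/
theorem integrable_exp_betaOneZero (hτ : 1 < τ) (hb : 0 < b) {u : ℝ} (hu : 0 ≤ u) :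
    Integrable (fun y => Real.exp (u * y)) (betaOneZero τ b) := by
  have hτ0 : 0 < τ := by linarith
  rw [betaOneZero, integrable_map_measure (Measurable.aestronglyMeasurable (by fun_prop))
    (measurable_mul_rpow _ _).aemeasurable]
  -- Beyond `K`, where `K ^ (τ - 1) = 2 τ u`, the linear function `u y` is at most `y ^ τ / (2 τ)`.
  set K : ℝ := (2 * τ * u) ^ (1 / (τ - 1)) with hK
  have hK0 : 0 ≤ K := by positivity
  have hKpow : K ^ (τ - 1) = 2 * τ * u := by
    rw [hK, ← Real.rpow_mul (by positivity), one_div_mul_cancel (by linarith), Real.rpow_one]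
  refine ((integrable_exp_half_gammaMeasure_one (div_pos hb hτ0)).const_mul
    (Real.exp (u * K))).mono' (Measurable.aestronglyMeasurable (by fun_prop)) ?_
  filter_upwards [ae_pos_gammaMeasure_one (b / τ)] with g hg
  simp only [Function.comp]
  rw [Real.norm_of_nonneg (Real.exp_pos _).le, ← Real.exp_add]
  refine Real.exp_le_exp.2 ?_
  set y : ℝ := (τ * g) ^ (1 / τ) with hy
  have hy0 : 0 < y := Real.rpow_pos_of_pos (mul_pos hτ0 hg) _
  have hyτ : y ^ τ = τ * g := by
    rw [hy, ← Real.rpow_mul (by positivity), one_div_mul_cancel hτ0.ne', Real.rpow_one]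
  rcases le_total y K with h | h
  · have := mul_le_mul_of_nonneg_left h hu
    linarith
  · have h1 : K ^ (τ - 1) ≤ y ^ (τ - 1) := Real.rpow_le_rpow hK0 h (by linarith)
    have h2 : y ^ (τ - 1) * y = τ * g := by
      rw [← hyτ, ← Real.rpow_add_one hy0.ne', sub_add_cancel]
    have h3 : 2 * τ * u * y ≤ τ * g := by
      rw [← h2, ← hKpow]
      exact mul_le_mul_of_nonneg_right h1 hy0.le
    have h4 : u * y ≤ g / 2 := by
      have : τ * (2 * (u * y)) ≤ τ * g := by linarith
      have := le_of_mul_le_mul_left this hτ0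
      linarith
    have := mul_nonneg hu hK0
    linarith

end BetaOneZero

/-! ### The distribution `β_{2,2}` -/

theorem integrableOn_frullani_real {h : ℝ → ℝ} {C p q : ℝ} (hh : Measurable h)
    (hC : ∀ t, 0 < t → |h t| ≤ C) (hp : 0 < p) (hq : 0 < q) :
    IntegrableOn (fun t => (Real.exp (-(p * t)) - Real.exp (-(q * t))) / t * h t) (Set.Ioi 0) := by
  have hi := integrableOn_frullani hh hC (w := p) (w₀ := q) (by simpa using hp) (by simpa using hq)
  refine (Integrable.re hi).congr (ae_of_all _ fun t => ?_)
  have : (Complex.exp (-((p : ℂ) * (t : ℂ))) - Complex.exp (-((q : ℂ) * (t : ℂ)))) / t * h t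
      = (((Real.exp (-(p * t)) - Real.exp (-(q * t))) / t * h t : ℝ) : ℂ) := by
    push_cast
    ring
  simp only [this]
  exact Complex.ofReal_re _

section BetaTwoTwo

variable {τ b₀ b₁ b₂ : ℝ}

theorem one_sub_exp_neg_div_le {a b t : ℝ} (ha : 0 < a) (hb : 0 < b) (ht : 0 < t) :
    (1 - Real.exp (-(b * t))) / (1 - Real.exp (-(a * t))) ≤ b / a + 1 := by
  have h0 := one_sub_exp_neg_pos hb ht
  have h1 : 1 - Real.exp (-(b * t)) ≤ b * t := by
    have := Real.add_one_le_exp (-(b * t))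
    linarith
  have h2 : 1 - Real.exp (-(b * t)) ≤ 1 := by
    have := Real.exp_pos (-(b * t))
    linarith
  have h3 := mul_le_mul_of_nonneg_left (div_one_sub_exp_neg_le ha ht) (div_pos h0 ht).le
  rw [div_mul_div_cancel₀ ht.ne'] at h3
  refine h3.trans ?_
  rw [mul_add, div_mul_cancel₀ _ ht.ne']
  refine add_le_add ?_ h2
  rw [div_eq_mul_inv b]
  exact mul_le_mul_of_nonneg_right ((div_le_iff₀ ht).2 h1) (inv_pos.2 ha).le

/-- The density, relative to `exp (-b₀ t) dt / t`, of the Lévy measure of `-log β_{2,2}`. -/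
noncomputable def betaTwoTwoKernel (τ b₁ b₂ t : ℝ) : ℝ :=
  (1 - Real.exp (-(b₁ * t))) / (1 - Real.exp (-(1 * t)))
    * ((1 - Real.exp (-(b₂ * t))) / (1 - Real.exp (-(τ * t))))

theorem measurable_betaTwoTwoKernel : Measurable (betaTwoTwoKernel τ b₁ b₂) := by
  unfold betaTwoTwoKernel
  fun_prop

theorem betaTwoTwoKernel_nonneg (hτ : 0 < τ) (hb₁ : 0 < b₁) (hb₂ : 0 < b₂) {t : ℝ} (ht : 0 < t) :
    0 ≤ betaTwoTwoKernel τ b₁ b₂ t :=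
  (mul_pos (div_pos (one_sub_exp_neg_pos hb₁ ht) (one_sub_exp_neg_pos one_pos ht))
    (div_pos (one_sub_exp_neg_pos hb₂ ht) (one_sub_exp_neg_pos hτ ht))).le

theorem abs_betaTwoTwoKernel_le (hτ : 0 < τ) (hb₁ : 0 < b₁) (hb₂ : 0 < b₂) (t : ℝ) (ht : 0 < t) :
    |betaTwoTwoKernel τ b₁ b₂ t| ≤ (b₁ / 1 + 1) * (b₂ / τ + 1) := by
  rw [abs_of_nonneg (betaTwoTwoKernel_nonneg hτ hb₁ hb₂ ht)]
  exact mul_le_mul (one_sub_exp_neg_div_le one_pos hb₁ ht) (one_sub_exp_neg_div_le hτ hb₂ ht)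
    (div_pos (one_sub_exp_neg_pos hb₂ ht) (one_sub_exp_neg_pos hτ ht)).le (by positivity)

theorem betaTwoTwoKernel_eq {t : ℝ} (ht : 0 < t) :
    betaTwoTwoKernel τ b₁ b₂ t = (1 - Real.exp (-(b₁ * t))) * (1 - Real.exp (-(b₂ * t)))
      * bernoulliGen ![1, τ] t / t ^ 2 := by
  rw [bernoulliGen_of_pos ht, Fin.prod_univ_two, betaTwoTwoKernel]
  simp only [Matrix.cons_val_zero, Matrix.cons_val_one]
  have := ht.ne'
  generalize 1 - Real.exp (-(1 * t)) = x
  generalize 1 - Real.exp (-(τ * t)) = y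
  rw [eq_div_iff (by positivity)]
  ring

/-- The second difference of the integrand with steps `b₁`, `b₂` annihilates the subtracted
polynomials of degree at most one in `w` and turns the quadratic one into a constant. -/
theorem logBarnesIntegrand_second_difference (hτ : 0 < τ) (w w₀ : ℂ) {t : ℝ} (ht : 0 < t) :
    (logBarnesIntegrand ![1, τ] w t - logBarnesIntegrand ![1, τ] (w + b₁) t
        - logBarnesIntegrand ![1, τ] (w + b₂) t + logBarnesIntegrand ![1, τ] (w + (b₁ + b₂)) t)
      - (logBarnesIntegrand ![1, τ] w₀ t - logBarnesIntegrand ![1, τ] (w₀ + b₁) t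
        - logBarnesIntegrand ![1, τ] (w₀ + b₂) t + logBarnesIntegrand ![1, τ] (w₀ + (b₁ + b₂)) t)
      = (Complex.exp (-(w * (t : ℂ))) - Complex.exp (-(w₀ * (t : ℂ)))) / t
        * betaTwoTwoKernel τ b₁ b₂ t := by
  obtain ⟨β, γ, h2⟩ := exists_doubleAnomaly_eq hτ
  have h2' : ∀ w, multipleBernoulli ![1, τ] 2 w = 2 * ((τ : ℂ)⁻¹ / 2 * w ^ 2 + β * w + γ) := by
    intro w
    rw [← h2, doubleAnomaly]
    ring
  obtain ⟨β₀, β₁, h01⟩ : ∃ β₀ β₁ : ℂ, ∀ w, multipleBernoulli ![1, τ] 0 w = β₀ ∧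
      multipleBernoulli ![1, τ] 1 w = β₁ - β₀ * w := by
    refine ⟨iteratedDeriv 0 (fun t : ℝ => (bernoulliGen ![1, τ] t : ℂ)) 0,
      iteratedDeriv 1 (fun t : ℝ => (bernoulliGen ![1, τ] t : ℂ)) 0, fun w => ⟨?_, ?_⟩⟩
    · rw [multipleBernoulli_eq_sum (forall_pos_pair hτ)]
      simp
    · rw [multipleBernoulli_eq_sum (forall_pos_pair hτ)]
      simp only [Finset.sum_range_succ, Finset.range_zero, Finset.sum_empty]
      simp
      ring
  have hE : ∀ w z : ℂ, Complex.exp (-((w + z) * (t : ℂ)))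
      = Complex.exp (-(w * (t : ℂ))) * Complex.exp (-(z * (t : ℂ))) := fun w z => by
    rw [← Complex.exp_add]
    congr 1
    ring
  have ht' : (t : ℂ) ≠ 0 := by exact_mod_cast ht.ne'
  rw [betaTwoTwoKernel_eq ht]
  simp only [logBarnesIntegrand, Finset.sum_range_succ, Finset.range_zero, Finset.sum_empty, h2',
    (h01 _).1, (h01 _).2, hE]
  push_cast
  generalize Complex.exp (-(w * (t : ℂ))) = x
  generalize Complex.exp (-(w₀ * (t : ℂ))) = x₀
  generalize Complex.exp (-((b₁ : ℂ) * (t : ℂ))) = y₁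
  generalize Complex.exp (-((b₂ : ℂ) * (t : ℂ))) = y₂
  generalize (bernoulliGen ![1, τ] t : ℂ) = f
  generalize Complex.exp (-(t : ℂ)) = e
  generalize (t : ℂ) = s at ht'
  simp only [Nat.factorial]
  field_simp
  ring

theorem barnesS_two_two (q : ℂ) : barnesS ![1, τ] b₀ ![b₁, b₂] q
    = logBarnesGamma ![1, τ] (q + b₀) - logBarnesGamma ![1, τ] (q + b₀ + b₁)
      - logBarnesGamma ![1, τ] (q + b₀ + b₂) + logBarnesGamma ![1, τ] (q + b₀ + (b₁ + b₂)) := by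
  have hu : (Finset.univ : Finset (Finset (Fin 2))) = {∅, {0}, {1}, {0, 1}} := by decide
  rw [barnesS, hu, Finset.sum_insert (by decide), Finset.sum_insert (by decide),
    Finset.sum_insert (by decide), Finset.sum_singleton]
  simp
  ring

theorem barnesEta_two_two (hτ : 0 < τ) (hb₀ : 0 < b₀) (hb₁ : 0 < b₁) (hb₂ : 0 < b₂) {q : ℂ}
    (hq : -b₀ < q.re) : barnesEta ![1, τ] b₀ ![b₁, b₂] q
      = Complex.exp (∫ t : ℝ in Set.Ioi 0,
        (Complex.exp (-((q + b₀) * (t : ℂ))) - Complex.exp (-((b₀ : ℂ) * (t : ℂ)))) / t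
          * betaTwoTwoKernel τ b₁ b₂ t) := by
  have hI : ∀ {w : ℂ}, 0 < w.re → Integrable (logBarnesIntegrand ![1, τ] w)
      (volume.restrict (Set.Ioi 0)) := integrableOn_logBarnesIntegrand (forall_pos_pair hτ)
  have hw : 0 < (q + b₀).re := by simp; linarith
  have hw₀ : 0 < (b₀ : ℂ).re := by simpa using hb₀
  have hadd : ∀ {w : ℂ} {b : ℝ}, 0 < w.re → 0 < b → 0 < (w + b).re := fun h hb => by
    simpa using add_pos h hb
  have hS : ∀ {w : ℂ}, 0 < w.re →
      Integrable (fun t => logBarnesIntegrand ![1, τ] w t - logBarnesIntegrand ![1, τ] (w + b₁) t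
        - logBarnesIntegrand ![1, τ] (w + b₂) t + logBarnesIntegrand ![1, τ] (w + (b₁ + b₂)) t)
        (volume.restrict (Set.Ioi 0)) ∧
      logBarnesGamma ![1, τ] w - logBarnesGamma ![1, τ] (w + b₁)
        - logBarnesGamma ![1, τ] (w + b₂) + logBarnesGamma ![1, τ] (w + (b₁ + b₂))
      = ∫ t in Set.Ioi 0, (logBarnesIntegrand ![1, τ] w t
        - logBarnesIntegrand ![1, τ] (w + b₁) t
        - logBarnesIntegrand ![1, τ] (w + b₂) t
        + logBarnesIntegrand ![1, τ] (w + (b₁ + b₂)) t) := by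
    intro w hw
    have i0 := hI hw
    have i1 := hI (hadd hw hb₁)
    have i2 := hI (hadd hw hb₂)
    have i3 : Integrable (logBarnesIntegrand ![1, τ] (w + (b₁ + b₂)))
        (volume.restrict (Set.Ioi 0)) := hI (by simp; linarith)
    refine ⟨((i0.sub i1).sub i2).add i3, ?_⟩
    simp only [logBarnesGamma_eq]
    have e1 := integral_add ((i0.sub i1).sub i2) i3
    have e2 := integral_sub (i0.sub i1) i2
    simp only [Pi.sub_apply] at e1 e2
    rw [e1, e2, integral_sub i0 i1]
  rw [barnesEta, barnesS_two_two, barnesS_two_two, zero_add, (hS hw).2, (hS hw₀).2,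
    ← integral_sub (hS hw).1 (hS hw₀).1]
  congr 1
  exact setIntegral_congr_fun measurableSet_Ioi fun t ht =>
    logBarnesIntegrand_second_difference hτ _ _ ht

/-- Existence of `β_{2,2}`: it is the law of `exp (-T)`, where `T ≥ 0` has the Lévy density
`exp (-b₀ t) * betaTwoTwoKernel τ b₁ b₂ t / t`. The exponential moments of `T` of order less than
`b₀` are finite, so the formula for its characteristic function continues to `Re z < b₀`. -/
theorem exists_isBarnesBeta_two_two (hτ : 0 < τ) (hb₀ : 0 < b₀) (hb₁ : 0 < b₁) (hb₂ : 0 < b₂) :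
    ∃ μ, IsBarnesBeta ![1, τ] b₀ ![b₁, b₂] μ := by
  set h := betaTwoTwoKernel τ b₁ b₂ with hh
  have hm : Measurable h := measurable_betaTwoTwoKernel
  have hC := abs_betaTwoTwoKernel_le hτ hb₁ hb₂
  rw [← hh] at hC
  have h0 : ∀ t, 0 < t → 0 ≤ h t := fun t ht => betaTwoTwoKernel_nonneg hτ hb₁ hb₂ ht
  have hb₀' : 0 < (b₀ : ℂ).re := by simpa using hb₀
  obtain ⟨P, hP, hchar, hnn, hmom⟩ := exists_subordinator
    (k := fun t => Real.exp (-(b₀ * t)) / t * h t) (by fun_prop)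
    (fun t ht => mul_nonneg (by positivity) (h0 t ht)) (by
      refine ((integrableOn_exp_neg_mul_Ioi_zero hb₀).const_mul
        ((b₁ / 1 + 1) * (b₂ / τ + 1))).mono' (by fun_prop)
        ((ae_restrict_iff' measurableSet_Ioi).2 (ae_of_all _ fun t ht => ?_))
      have ht' : (0 : ℝ) < t := ht
      rw [show t * (Real.exp (-(b₀ * t)) / t * h t) = h t * Real.exp (-(b₀ * t)) by field_simp,
        norm_mul, Real.norm_of_nonneg (Real.exp_pos _).le]
      exact mul_le_mul_of_nonneg_right (hC t ht') (Real.exp_pos _).le)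
  have hset : Set.Iio b₀ ⊆ integrableExpSet id P := by
    intro p hp
    have hp' : p < b₀ := hp
    change Integrable (fun x => Real.exp (p * x)) P
    rcases le_total p 0 with hp0 | hp0
    · refine (integrable_const (1 : ℝ)).mono' (by fun_prop) (hnn.mono fun x hx => ?_)
      rw [Real.norm_of_nonneg (Real.exp_pos _).le]
      exact Real.exp_le_one_iff.2 (mul_nonpos_of_nonpos_of_nonneg hp0 hx)
    · have hfr : IntegrableOn (fun t => (Real.exp (p * t) - 1) * (Real.exp (-(b₀ * t)) / t * h t))
          (Set.Ioi 0) := by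
        refine (integrableOn_frullani_real hm hC (sub_pos.2 hp') hb₀).congr
          (ae_of_all _ fun t => ?_)
        simp only
        rw [show -((b₀ - p) * t) = p * t + -(b₀ * t) by ring, Real.exp_add]
        ring
      have hlt := (hmom p hp0 hfr).trans_lt ENNReal.ofReal_lt_top
      refine ⟨by fun_prop, ?_⟩
      rw [hasFiniteIntegral_iff_ofReal (ae_of_all _ fun x => (Real.exp_pos _).le)]
      exact hlt
  have hset' : Set.Iio b₀ ⊆ interior (integrableExpSet id P) := interior_maximal hset isOpen_Iio
  set U : Set ℂ := {z | z.re < b₀} with hU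
  have hUo : IsOpen U := isOpen_lt Complex.continuous_re continuous_const
  set Φ : ℂ → ℂ := fun z => Complex.exp (∫ t : ℝ in Set.Ioi 0,
    (Complex.exp (-((b₀ - z) * (t : ℂ))) - Complex.exp (-((b₀ : ℂ) * (t : ℂ)))) / t * h t) with hΦ
  have hΦa : AnalyticOnNhd ℂ Φ U := by
    refine DifferentiableOn.analyticOnNhd (fun z hz => ?_) hUo
    have hz' : 0 < ((b₀ : ℂ) - z).re := by
      have : z.re < b₀ := hz
      simpa using this
    have h1 := hasDerivAt_frullani hm hC hz' hb₀'
    have h2 : HasDerivAt (fun z : ℂ => (b₀ : ℂ) - z) (-1) z := by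
      simpa using (hasDerivAt_id z).const_sub (b₀ : ℂ)
    exact (HasDerivAt.comp z h1 h2).cexp.differentiableAt.differentiableWithinAt
  have heq : Set.EqOn (complexMGF id P) Φ U := by
    refine (analyticOnNhd_complexMGF.mono fun z hz => hset' hz).eqOn_of_preconnected_of_frequently_eq
      hΦa (convex_halfSpace_re_lt b₀).isPreconnected (z₀ := 0) (show (0 : ℂ).re < b₀ by simpa using hb₀) ?_
    have ht : Tendsto (fun u : ℝ => (u : ℂ) * Complex.I) (𝓝[≠] 0) (𝓝[≠] 0) := by
      refine tendsto_nhdsWithin_iff.2 ⟨?_, ?_⟩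
      · have : Continuous fun u : ℝ => (u : ℂ) * Complex.I := by fun_prop
        simpa using (this.tendsto 0).mono_left nhdsWithin_le_nhds
      · filter_upwards [self_mem_nhdsWithin] with u hu
        simpa using hu
    refine ht.frequently (Eventually.of_forall fun u => ?_).frequently
    rw [complexMGF_id_mul_I, hchar]
    simp only [hΦ]
    congr 1
    refine integral_congr_ae (ae_of_all _ fun t => ?_)
    simp only
    rw [show -(((b₀ : ℂ) - u * Complex.I) * (t : ℂ)) = u * t * Complex.I + -((b₀ : ℂ) * t) by ring,
      Complex.exp_add]
    push_cast
    ring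
  have hmap : Measurable fun x : ℝ => Real.exp (-x) := by fun_prop
  refine ⟨P.map fun x => Real.exp (-x), Measure.isProbabilityMeasure_map hmap.aemeasurable, ?_,
    fun q hq => ?_⟩
  · rw [ae_map_iff hmap.aemeasurable]
    · filter_upwards [hnn] with x hx
      exact ⟨Real.exp_pos _, fun _ => Real.exp_le_one_iff.2 (neg_nonpos.2 hx)⟩
    · simp only [le_refl, forall_const]
      exact measurableSet_Ioc
  · have hcomp : (fun x : ℝ => ((Real.exp (-x) : ℝ) : ℂ) ^ q)
        = fun x : ℝ => Complex.exp (-q * (id x : ℝ)) := funext fun x => by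
      rw [cpow_eq_exp_mul_log (Real.exp_pos _), Real.log_exp]
      push_cast
      congr 1
      simp
    have hmem : -q ∈ U := by
      simp only [hU, Set.mem_ofPred_eq, Complex.neg_re]
      linarith
    constructor
    · rw [integrable_map_measure (Measurable.aestronglyMeasurable (by fun_prop)) hmap.aemeasurable]
      change Integrable (fun x : ℝ => ((Real.exp (-x) : ℝ) : ℂ) ^ q) P
      rw [hcomp]
      exact integrable_cexp_mul_of_re_mem_integrableExpSet aemeasurable_id (hset hmem)
    · rw [integral_map hmap.aemeasurable (Measurable.aestronglyMeasurable (by fun_prop)), hcomp]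
      change complexMGF id P (-q) = _
      rw [heq hmem, barnesEta_two_two hτ hb₀ hb₁ hb₂ hq]
      simp only [hΦ, hh, sub_neg_eq_add, add_comm q]

end BetaTwoTwo

/-! ### The law of `M` and its Mellin transform -/

theorem isBarnesBeta_barnesBeta {M N : ℕ} {a : Fin M → ℝ} {b₀ : ℝ} {b : Fin N → ℝ}
    (h : ∃ μ, IsBarnesBeta a b₀ b μ) : IsBarnesBeta a b₀ b (barnesBeta a b₀ b) := by
  rw [barnesBeta, dif_pos h]
  exact h.choose_spec

section Law

variable {τ l₁ l₂ : ℝ}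

theorem exists_isBarnesBeta_morrisBeta22 (hτ : 1 < τ) (hl₁ : 0 ≤ l₁) (hl₂ : 0 ≤ l₂) :
    ∃ μ, IsBarnesBeta ![1, τ] τ ![1 + τ * l₁, 1 + τ * l₂] μ :=
  exists_isBarnesBeta_two_two (by linarith) (by linarith) (by positivity) (by positivity)

theorem isBarnesBeta_morrisBeta22 (hτ : 1 < τ) (hl₁ : 0 ≤ l₁) (hl₂ : 0 ≤ l₂) :
    IsBarnesBeta ![1, τ] τ ![1 + τ * l₁, 1 + τ * l₂] (morrisBeta22 τ l₁ l₂) :=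
  isBarnesBeta_barnesBeta (exists_isBarnesBeta_morrisBeta22 hτ hl₁ hl₂)

theorem morrisBeta10_eq (hτ : 1 < τ) (hl₁ : 0 ≤ l₁) (hl₂ : 0 ≤ l₂) :
    morrisBeta10 τ l₁ l₂ = betaOneZero τ (τ * (l₁ + l₂ + 1) + 1) :=
  barnesBeta_eq (by positivity) (isBarnesBeta_betaOneZero (by linarith) (by positivity))

theorem isBarnesBeta_morrisBeta10 (hτ : 1 < τ) (hl₁ : 0 ≤ l₁) (hl₂ : 0 ≤ l₂) :
    IsBarnesBeta ![τ] (τ * (l₁ + l₂ + 1) + 1) ![] (morrisBeta10 τ l₁ l₂) := by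
  rw [morrisBeta10_eq hτ hl₁ hl₂]
  exact isBarnesBeta_betaOneZero (by linarith) (by positivity)

theorem morrisConst_pos (hτ : 1 < τ) : 0 < morrisConst τ := by
  have := gamma_one_sub_inv_pos hτ
  have := Real.pi_pos
  unfold morrisConst
  positivity

theorem morrisConst_cpow (hτ : 1 < τ) (q : ℂ) : (morrisConst τ : ℂ) ^ q
    = ((2 * Real.pi * τ ^ (1 / τ) : ℝ) : ℂ) ^ q / ((Real.Gamma (1 - 1 / τ) : ℝ) : ℂ) ^ q := by
  have h1 := gamma_one_sub_inv_pos hτ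
  have h2 : 0 < 2 * Real.pi * τ ^ (1 / τ) := by
    have := Real.pi_pos
    positivity
  rw [cpow_eq_exp_mul_log (morrisConst_pos hτ), cpow_eq_exp_mul_log h1, cpow_eq_exp_mul_log h2,
    morrisConst, Real.log_div h2.ne' h1.ne', ← Complex.exp_sub]
  congr 1
  push_cast
  ring

theorem measurable_morris_map (τ : ℝ) :
    Measurable fun p : ℝ × ℝ => morrisConst τ * p.1⁻¹ * p.2⁻¹ := by
  fun_prop

theorem isProbabilityMeasure_morrisLaw (hτ : 1 < τ) (hl₁ : 0 ≤ l₁) (hl₂ : 0 ≤ l₂) :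
    IsProbabilityMeasure (morrisLaw τ l₁ l₂) := by
  have := (isBarnesBeta_morrisBeta22 hτ hl₁ hl₂).isProbabilityMeasure
  have := (isBarnesBeta_morrisBeta10 hτ hl₁ hl₂).isProbabilityMeasure
  exact Measure.isProbabilityMeasure_map (measurable_morris_map τ).aemeasurable

theorem ae_morrisBeta_prod (hτ : 1 < τ) (hl₁ : 0 ≤ l₁) (hl₂ : 0 ≤ l₂) :
    ∀ᵐ p ∂((morrisBeta22 τ l₁ l₂).prod (morrisBeta10 τ l₁ l₂)), (0 < p.1 ∧ p.1 ≤ 1) ∧ 0 < p.2 := by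
  have h22 := isBarnesBeta_morrisBeta22 hτ hl₁ hl₂
  have h10 := isBarnesBeta_morrisBeta10 hτ hl₁ hl₂
  have := h22.isProbabilityMeasure
  have := h10.isProbabilityMeasure
  filter_upwards [Measure.quasiMeasurePreserving_fst.ae h22.support,
    Measure.quasiMeasurePreserving_snd.ae h10.support] with p h1 h2
  exact ⟨⟨h1.1, h1.2 le_rfl⟩, h2.1⟩

theorem ae_pos_morrisLaw (hτ : 1 < τ) (hl₁ : 0 ≤ l₁) (hl₂ : 0 ≤ l₂) :
    ∀ᵐ x ∂(morrisLaw τ l₁ l₂), 0 < x := by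
  rw [morrisLaw, ae_map_iff (measurable_morris_map τ).aemeasurable measurableSet_Ioi]
  filter_upwards [ae_morrisBeta_prod hτ hl₁ hl₂] with p hp
  exact mul_pos (mul_pos (morrisConst_pos hτ) (inv_pos.2 hp.1.1)) (inv_pos.2 hp.2)

theorem mul_inv_mul_inv_cpow {c x y : ℝ} (hc : 0 < c) (hx : 0 < x) (hy : 0 < y) (q : ℂ) :
    ((c * x⁻¹ * y⁻¹ : ℝ) : ℂ) ^ q = (c : ℂ) ^ q * ((x : ℂ) ^ (-q) * (y : ℂ) ^ (-q)) := by
  have hx' := inv_pos.2 hx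
  have hy' := inv_pos.2 hy
  rw [cpow_eq_exp_mul_log (mul_pos (mul_pos hc hx') hy'), cpow_eq_exp_mul_log hc,
    cpow_eq_exp_mul_log hx, cpow_eq_exp_mul_log hy, ← Complex.exp_add, ← Complex.exp_add,
    Real.log_mul (mul_pos hc hx').ne' hy'.ne', Real.log_mul hc.ne' hx'.ne', Real.log_inv,
    Real.log_inv]
  congr 1
  push_cast
  ring

/-- By independence the Mellin transform factors. -/
theorem mellin_morrisLaw_eq_mul (hτ : 1 < τ) (hl₁ : 0 ≤ l₁) (hl₂ : 0 ≤ l₂) {q : ℂ}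
    (hq : q.re < τ) :
    Integrable (fun x : ℝ => (x : ℂ) ^ q) (morrisLaw τ l₁ l₂) ∧
      ∫ x : ℝ, (x : ℂ) ^ q ∂(morrisLaw τ l₁ l₂) = (morrisConst τ : ℂ) ^ q
        * (barnesEta ![1, τ] τ ![1 + τ * l₁, 1 + τ * l₂] (-q)
          * barnesEta ![τ] (τ * (l₁ + l₂ + 1) + 1) ![] (-q)) := by
  have h22 := isBarnesBeta_morrisBeta22 hτ hl₁ hl₂
  have h10 := isBarnesBeta_morrisBeta10 hτ hl₁ hl₂
  have := h22.isProbabilityMeasure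
  have := h10.isProbabilityMeasure
  have hc := morrisConst_pos hτ
  have hae : (fun p : ℝ × ℝ => ((morrisConst τ * p.1⁻¹ * p.2⁻¹ : ℝ) : ℂ) ^ q)
      =ᵐ[(morrisBeta22 τ l₁ l₂).prod (morrisBeta10 τ l₁ l₂)]
      fun p => (morrisConst τ : ℂ) ^ q * ((p.1 : ℂ) ^ (-q) * (p.2 : ℂ) ^ (-q)) :=
    (ae_morrisBeta_prod hτ hl₁ hl₂).mono fun p hp => mul_inv_mul_inv_cpow hc hp.1.1 hp.2 q
  obtain ⟨i1, e1⟩ := h22.mellin (-q) (by rw [Complex.neg_re]; linarith)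
  obtain ⟨i2, e2⟩ := h10.mellin (-q) (by
    rw [Complex.neg_re]
    have : 0 ≤ τ * (l₁ + l₂) := by positivity
    linarith)
  constructor
  · rw [morrisLaw, integrable_map_measure (Measurable.aestronglyMeasurable (by fun_prop))
      (measurable_morris_map τ).aemeasurable]
    exact ((i1.mul_prod i2).const_mul _).congr hae.symm
  · rw [morrisLaw, integral_map (measurable_morris_map τ).aemeasurable
      (Measurable.aestronglyMeasurable (by fun_prop)), integral_congr_ae hae, integral_const_mul,
      integral_prod_mul (fun x : ℝ => (x : ℂ) ^ (-q)) (fun x : ℝ => (x : ℂ) ^ (-q)), e1, e2]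

theorem barnesEta_two_two_eq_doubleGamma {b₀ b₁ b₂ : ℝ} (hb₀ : 0 < b₀) (hb₁ : 0 < b₁) (hb₂ : 0 < b₂)
    {q : ℂ} (hq : -b₀ < q.re) : barnesEta ![1, τ] b₀ ![b₁, b₂] q
      = doubleGamma τ (q + b₀) / doubleGamma τ (q + b₀ + b₁) / doubleGamma τ (q + b₀ + b₂)
          * doubleGamma τ (q + b₀ + (b₁ + b₂))
        / (doubleGamma τ b₀ / doubleGamma τ (b₀ + b₁) / doubleGamma τ (b₀ + b₂)
          * doubleGamma τ (b₀ + (b₁ + b₂))) := by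
  rw [barnesEta, barnesS_two_two, barnesS_two_two, zero_add]
  simp only [Complex.exp_sub, Complex.exp_add]
  simp only [doubleGamma]
  rw [barnesGamma_eq_exp, barnesGamma_eq_exp, barnesGamma_eq_exp, barnesGamma_eq_exp,
    barnesGamma_eq_exp, barnesGamma_eq_exp, barnesGamma_eq_exp, barnesGamma_eq_exp] <;>
  · simp
    linarith

theorem barnesEta_one_zero_eq_barnesGamma {b : ℝ} (hb : 0 < b) {q : ℂ} (hq : -b < q.re) :
    barnesEta ![τ] b ![] q = barnesGamma 1 ![τ] (q + b) / barnesGamma 1 ![τ] b := by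
  rw [barnesEta, barnesS_one_zero, barnesS_one_zero, zero_add, Complex.exp_sub,
    barnesGamma_eq_exp, barnesGamma_eq_exp] <;>
  · simp
    linarith

/-- The factor `Γ₁(A - q | τ)` of `β_{1,0}`, where `A = τ (l₁ + l₂ + 1) + 1`, lowers the argument
`A + 1 - q` of `Γ₂` in `η_{2,2}(-q)` to the `A - q` that occurs in `𝔐`. -/
theorem mellin_morrisLaw (hτ : 1 < τ) (hl₁ : 0 ≤ l₁) (hl₂ : 0 ≤ l₂) {q : ℂ} (hq : q.re < τ) :
    Integrable (fun x : ℝ => (x : ℂ) ^ q) (morrisLaw τ l₁ l₂) ∧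
      ∫ x : ℝ, (x : ℂ) ^ q ∂(morrisLaw τ l₁ l₂) = morrisMellin q τ l₁ l₂ := by
  obtain ⟨hi, he⟩ := mellin_morrisLaw_eq_mul hτ hl₁ hl₂ hq
  refine ⟨hi, ?_⟩
  have hτ0 : 0 < τ := by linarith
  have hτl : 0 ≤ τ * l₁ ∧ 0 ≤ τ * l₂ := ⟨by positivity, by positivity⟩
  have hA : (0 : ℝ) < τ * (l₁ + l₂ + 1) + 1 := by positivity
  have hne : ∀ {w : ℂ}, 0 < w.re → doubleGamma τ w ≠ 0 := fun h => doubleGamma_ne_zero_of_pos h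
  rw [he, barnesEta_two_two_eq_doubleGamma (by linarith) (by linarith) (by linarith)
    (by rw [Complex.neg_re]; linarith), barnesEta_one_zero_eq_barnesGamma hA
    (by rw [Complex.neg_re]; linarith), morrisMellin, morrisConst_cpow hτ, morrisRatio]
  congr 1
  have s1 := doubleGamma_shift_one hτ0 (-q + (τ * (l₁ + l₂ + 1) + 1 : ℝ))
  have s2 := doubleGamma_shift_one hτ0 ((τ * (l₁ + l₂ + 1) + 1 : ℝ) : ℂ)
  have e1 : (τ : ℂ) * (l₁ + l₂ + 1) + 1 - q = -q + (τ * (l₁ + l₂ + 1) + 1 : ℝ) := by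
    push_cast; ring
  have e2 : (τ : ℂ) * (l₁ + l₂ + 1) + 1 = (τ * (l₁ + l₂ + 1) + 1 : ℝ) := by push_cast; ring
  have e3 : (τ : ℂ) * (1 + l₁) + 1 - q = -q + τ + (1 + τ * l₁ : ℝ) := by push_cast; ring
  have e4 : (τ : ℂ) * (1 + l₁) + 1 = τ + (1 + τ * l₁ : ℝ) := by push_cast; ring
  have e5 : (τ : ℂ) * (1 + l₂) + 1 - q = -q + τ + (1 + τ * l₂ : ℝ) := by push_cast; ring
  have e6 : (τ : ℂ) * (1 + l₂) + 1 = τ + (1 + τ * l₂ : ℝ) := by push_cast; ring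
  have e7 : -q + (τ : ℂ) + ((1 + τ * l₁ : ℝ) + (1 + τ * l₂ : ℝ))
      = -q + (τ * (l₁ + l₂ + 1) + 1 : ℝ) + 1 := by push_cast; ring
  have e8 : (τ : ℂ) + ((1 + τ * l₁ : ℝ) + (1 + τ * l₂ : ℝ))
      = ((τ * (l₁ + l₂ + 1) + 1 : ℝ) : ℂ) + 1 := by push_cast; ring
  rw [e1, e2, e3, e4, e5, e6, e7, e8, s1, s2]
  have n1 : doubleGamma τ (-q + τ + (1 + τ * l₁ : ℝ)) ≠ 0 := hne (by
    rw [Complex.add_re, Complex.add_re, Complex.neg_re, Complex.ofReal_re, Complex.ofReal_re]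
    linarith)
  have n2 : doubleGamma τ (-q + τ + (1 + τ * l₂ : ℝ)) ≠ 0 := hne (by
    rw [Complex.add_re, Complex.add_re, Complex.neg_re, Complex.ofReal_re, Complex.ofReal_re]
    linarith)
  have n3 : doubleGamma τ (τ + (1 + τ * l₁ : ℝ)) ≠ 0 := hne (by
    rw [Complex.add_re, Complex.ofReal_re, Complex.ofReal_re]
    linarith)
  have n4 : doubleGamma τ (τ + (1 + τ * l₂ : ℝ)) ≠ 0 := hne (by
    rw [Complex.add_re, Complex.ofReal_re, Complex.ofReal_re]
    linarith)
  have n5 : doubleGamma τ τ ≠ 0 := hne (by rwa [Complex.ofReal_re])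
  have n6 : barnesGamma 1 ![τ] ((τ * (l₁ + l₂ + 1) + 1 : ℝ) : ℂ) ≠ 0 := by
    intro h
    rw [h, zero_mul] at s2
    exact hne (by rwa [Complex.ofReal_re]) s2
  have n7 : doubleGamma τ (((τ * (l₁ + l₂ + 1) + 1 : ℝ) : ℂ) + 1) ≠ 0 := hne (by
    rw [Complex.add_re, Complex.ofReal_re, Complex.one_re]
    linarith)
  generalize doubleGamma τ (-q + τ + (1 + τ * l₁ : ℝ)) = x1 at *
  generalize doubleGamma τ (-q + τ + (1 + τ * l₂ : ℝ)) = x2 at *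
  generalize doubleGamma τ (τ + (1 + τ * l₁ : ℝ)) = x3 at *
  generalize doubleGamma τ (τ + (1 + τ * l₂ : ℝ)) = x4 at *
  generalize doubleGamma τ τ = x5 at *
  generalize barnesGamma 1 ![τ] ((τ * (l₁ + l₂ + 1) + 1 : ℝ) : ℂ) = x6 at *
  generalize doubleGamma τ (((τ * (l₁ + l₂ + 1) + 1 : ℝ) : ℂ) + 1) = x7 at *
  generalize doubleGamma τ (-q + τ) = y1
  generalize doubleGamma τ (-q + (τ * (l₁ + l₂ + 1) + 1 : ℝ) + 1) = y2
  generalize barnesGamma 1 ![τ] (-q + (τ * (l₁ + l₂ + 1) + 1 : ℝ)) = y3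
  field_simp

/-! ### Moments and determinacy of `M⁻¹` -/

theorem integral_inv_pow_morrisLaw (hτ : 1 < τ) (hl₁ : 0 ≤ l₁) (hl₂ : 0 ≤ l₂) (n : ℕ) :
    Integrable (fun x : ℝ => (x ^ n)⁻¹) (morrisLaw τ l₁ l₂) ∧
      ∫ x : ℝ, (x ^ n)⁻¹ ∂(morrisLaw τ l₁ l₂) = morrisNegProduct n τ l₁ l₂ := by
  obtain ⟨hi, he⟩ := mellin_morrisLaw hτ hl₁ hl₂ (q := -(n : ℂ)) (by
    rw [Complex.neg_re, Complex.natCast_re]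
    have : (0 : ℝ) ≤ n := n.cast_nonneg
    linarith)
  have hf : (fun x : ℝ => (x : ℂ) ^ (-(n : ℂ))) = fun x : ℝ => (((x ^ n)⁻¹ : ℝ) : ℂ) := by
    funext x
    rw [Complex.cpow_neg, Complex.cpow_natCast]
    push_cast
    rfl
  rw [hf] at hi he
  rw [morrisMellin_neg_natCast hτ hl₁ hl₂, integral_complex_ofReal] at he
  refine ⟨(Integrable.re hi).congr (ae_of_all _ fun x => ?_), by exact_mod_cast he⟩
  exact Complex.ofReal_re _

/-- Since `M⁻¹ = X Y / c` with `X ≤ 1`, the exponential moments of `M⁻¹` are finite because those of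
`Y` are. -/
theorem stieltjesDeterminate_inv_morrisLaw (hτ : 1 < τ) (hl₁ : 0 ≤ l₁) (hl₂ : 0 ≤ l₂) :
    StieltjesDeterminate ((morrisLaw τ l₁ l₂).map fun x => x⁻¹) := by
  have := (isBarnesBeta_morrisBeta22 hτ hl₁ hl₂).isProbabilityMeasure
  have := (isBarnesBeta_morrisBeta10 hτ hl₁ hl₂).isProbabilityMeasure
  have := isProbabilityMeasure_morrisLaw hτ hl₁ hl₂
  have hc := morrisConst_pos hτ
  refine stieltjesDeterminate_of_integrable_exp ?_ fun u hu => ?_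
  · rw [ae_map_iff measurable_inv.aemeasurable measurableSet_Ici]
    exact (ae_pos_morrisLaw hτ hl₁ hl₂).mono fun x hx => (inv_pos.2 hx).le
  · have hm : Measurable ((fun x => Real.exp (u * x)) ∘ fun x : ℝ => x⁻¹) :=
      (Real.measurable_exp.comp (measurable_const_mul u)).comp measurable_inv
    rw [integrable_map_measure (Measurable.aestronglyMeasurable (by fun_prop))
      measurable_inv.aemeasurable, morrisLaw, integrable_map_measure hm.aestronglyMeasurable
      (measurable_morris_map τ).aemeasurable]
    have hY : Integrable (fun y => Real.exp (u * (morrisConst τ)⁻¹ * y)) (morrisBeta10 τ l₁ l₂) := by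
      rw [morrisBeta10_eq hτ hl₁ hl₂]
      exact integrable_exp_betaOneZero hτ (by positivity) (by positivity)
    refine (hY.comp_snd (morrisBeta22 τ l₁ l₂)).mono'
      (hm.comp (measurable_morris_map τ)).aestronglyMeasurable ((ae_morrisBeta_prod hτ hl₁ hl₂).mono fun p hp => ?_)
    simp only [Function.comp]
    rw [Real.norm_of_nonneg (Real.exp_pos _).le, mul_inv, mul_inv, inv_inv, inv_inv]
    refine Real.exp_le_exp.2 ?_
    have h1 : p.1 * p.2 ≤ 1 * p.2 := mul_le_mul_of_nonneg_right hp.1.2 hp.2.le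
    have h2 : 0 ≤ u * (morrisConst τ)⁻¹ := by positivity
    have := mul_le_mul_of_nonneg_left h1 h2
    linarith

/-- In the degenerate case the Mellin transforms of the two laws agree. -/
theorem morrisLaw_zero_zero (hτ : 1 < τ) :
    morrisLaw τ 0 0 = (barnesBeta ![τ] τ ![]).map fun y => morrisConst τ * y⁻¹ := by
  have hτ0 : 0 < τ := by linarith
  have hc := morrisConst_pos hτ
  have hb := isBarnesBeta_barnesBeta ⟨_, isBarnesBeta_betaOneZero hτ0 hτ0⟩
  have := hb.isProbabilityMeasure
  have := isProbabilityMeasure_morrisLaw hτ le_rfl le_rfl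
  have hmeas : Measurable fun y : ℝ => morrisConst τ * y⁻¹ := by fun_prop
  have := Measure.isProbabilityMeasure_map (μ := barnesBeta ![τ] τ ![]) hmeas.aemeasurable
  refine ext_of_mellin (ae_pos_morrisLaw hτ le_rfl le_rfl) ?_ fun u => ?_
  · rw [ae_map_iff hmeas.aemeasurable measurableSet_Ioi]
    exact hb.support.mono fun y hy => mul_pos hc (inv_pos.2 hy.1)
  have hre : ((u : ℂ) * Complex.I).re = 0 := by simp
  set q : ℂ := (u : ℂ) * Complex.I with hq
  have hpole : ∀ m n : ℕ, q ≠ τ + m + n * (τ : ℂ) := fun m n h => by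
    have h1 : (0 : ℝ) = τ + m + n * τ := by
      have := congrArg Complex.re h
      rw [hre] at this
      simpa using this
    have : (0 : ℝ) < τ + m + n * τ := by positivity
    linarith
  have hae : (fun y : ℝ => ((morrisConst τ * y⁻¹ : ℝ) : ℂ) ^ q)
      =ᵐ[barnesBeta ![τ] τ ![]] fun y => (morrisConst τ : ℂ) ^ q * (y : ℂ) ^ (-q) := by
    filter_upwards [hb.support] with y hy
    simpa using mul_inv_mul_inv_cpow hc one_pos hy.1 q
  rw [(mellin_morrisLaw hτ le_rfl le_rfl (by rw [hre]; exact hτ0)).2,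
    morrisMellin_zero_zero hτ0 hpole, integral_map hmeas.aemeasurable
      (Measurable.aestronglyMeasurable (by fun_prop)), integral_congr_ae hae, integral_const_mul,
    (hb.mellin (-q) (by rw [Complex.neg_re, hre]; linarith)).2,
    barnesEta_one_zero hτ0 hτ0 (by rw [Complex.neg_re, hre]; linarith), div_self hτ0.ne',
    Complex.ofReal_one, Complex.Gamma_one, div_one, morrisConst_cpow hτ]
  have h2 : 0 < 2 * Real.pi := by positivity
  have h3 : 0 < τ ^ (1 / τ) := Real.rpow_pos_of_pos hτ0 _
  rw [cpow_eq_exp_mul_log (mul_pos h2 h3), cpow_eq_exp_mul_log h2, Real.log_mul h2.ne' h3.ne',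
    Real.log_rpow hτ0, show (1 : ℂ) + -q / τ = 1 - q / τ by ring]
  have h4 : Complex.exp (q * ((Real.log (2 * Real.pi) + 1 / τ * Real.log τ : ℝ) : ℂ))
      = Complex.exp (q * Real.log (2 * Real.pi)) * (Complex.exp (-q / τ * Real.log τ))⁻¹ := by
    rw [← Complex.exp_neg, ← Complex.exp_add]
    congr 1
    push_cast
    ring
  rw [h4]
  have := Complex.exp_ne_zero (-q / τ * Real.log τ)
  field_simp

end Law

/-! ### Infinite divisibility of `log M` -/

section Levy

variable {τ b : ℝ}

theorem bernoulliGen_single {t : ℝ} (ht : 0 < t) :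
    bernoulliGen ![τ] t = t / (1 - Real.exp (-(τ * t))) := by
  rw [bernoulliGen_of_pos ht]
  simp

theorem inv_le_bernoulliGen_single (hτ : 0 < τ) {t : ℝ} (ht : 0 < t) :
    τ⁻¹ ≤ bernoulliGen ![τ] t := by
  rw [bernoulliGen_single ht, le_div_iff₀ (one_sub_exp_neg_pos hτ ht), inv_mul_le_iff₀ hτ]
  have := Real.add_one_le_exp (-(τ * t))
  linarith

theorem bernoulliGen_single_le (hτ : 0 < τ) {t : ℝ} (ht : 0 < t) :
    bernoulliGen ![τ] t ≤ τ⁻¹ + t := by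
  rw [bernoulliGen_single ht]
  exact div_one_sub_exp_neg_le hτ ht

theorem integrableOn_mul_exp_neg_mul_Ioi_zero (hb : 0 < b) :
    IntegrableOn (fun t : ℝ => t * Real.exp (-(b * t))) (Set.Ioi 0) := by
  refine (integrableOn_rpow_mul_exp_neg_mul_rpow (p := 1) (s := 1) (by norm_num) one_pos hb).congr
    (ae_of_all _ fun t => ?_)
  simp only [Real.rpow_one, neg_mul]

/-- The exponent of `E[β_{1,0}^q]` on the imaginary axis. The Lévy density behaves like
`1 / (τ t ^ 2)` at the origin, which is why the compensator `exp (-t) / (τ t)` remains. -/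
theorem barnesEta_one_zero_eq_exp (hτ : 0 < τ) (hb : 0 < b) (u : ℝ) :
    IntegrableOn (fun t : ℝ => (Complex.exp (u * t * Complex.I) - 1)
        * ((Real.exp (-(b * t)) * bernoulliGen ![τ] t / t ^ 2 : ℝ) : ℂ)
        - u * Complex.I * ((Real.exp (-t) / (τ * t) : ℝ) : ℂ)) (Set.Ioi 0) ∧
      barnesEta ![τ] b ![] (-(u * Complex.I)) = Complex.exp (∫ t : ℝ in Set.Ioi 0,
        ((Complex.exp (u * t * Complex.I) - 1)
          * ((Real.exp (-(b * t)) * bernoulliGen ![τ] t / t ^ 2 : ℝ) : ℂ)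
          - u * Complex.I * ((Real.exp (-t) / (τ * t) : ℝ) : ℂ))) := by
  have i1 := integrableOn_logBarnesIntegrand (forall_pos_single hτ)
    (w := -(u * Complex.I) + b) (by simpa using hb)
  have i0 := integrableOn_logBarnesIntegrand (forall_pos_single hτ) (w := b) (by simpa using hb)
  have key : ∀ t ∈ Set.Ioi (0 : ℝ),
      logBarnesIntegrand ![τ] (-(u * Complex.I) + b) t - logBarnesIntegrand ![τ] b t
        = (Complex.exp (u * t * Complex.I) - 1)
          * ((Real.exp (-(b * t)) * bernoulliGen ![τ] t / t ^ 2 : ℝ) : ℂ)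
          - u * Complex.I * ((Real.exp (-t) / (τ * t) : ℝ) : ℂ) := by
    intro t ht
    have ht' : (t : ℂ) ≠ 0 := by
      have : (0 : ℝ) < t := ht
      exact_mod_cast this.ne'
    have hτ' : (τ : ℂ) ≠ 0 := by exact_mod_cast hτ.ne'
    have hB := multipleBernoulli_one_one_sub hτ (-(u * Complex.I)) (b : ℂ)
    rw [sub_eq_iff_eq_add] at hB
    simp only [logBarnesIntegrand, Finset.sum_range_succ, Finset.range_zero, Finset.sum_empty,
      multipleBernoulli_one_zero hτ, hB]
    rw [show -((-(u * Complex.I) + (b : ℂ)) * (t : ℂ)) = u * t * Complex.I + -((b : ℂ) * t) by ring,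
      Complex.exp_add]
    push_cast
    generalize Complex.exp (u * t * Complex.I) = x
    generalize Complex.exp (-((b : ℂ) * t)) = y
    generalize Complex.exp (-(t : ℂ)) = z
    generalize (bernoulliGen ![τ] t : ℂ) = f
    generalize multipleBernoulli ![τ] 1 (b : ℂ) = B
    generalize Complex.I = i
    simp only [Nat.factorial]
    field_simp
    ring
  refine ⟨(integrableOn_congr_fun key measurableSet_Ioi).1 (i1.sub i0), ?_⟩
  rw [← setIntegral_congr_fun measurableSet_Ioi key, integral_sub i1 i0, ← logBarnesGamma_eq,
    ← logBarnesGamma_eq, barnesEta, barnesS_one_zero, barnesS_one_zero, zero_add]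

end Levy

section Divisible

variable {τ l₁ l₂ : ℝ}

/-- The logarithm of `M` is a constant minus the independent sum of `log X` and `log Y`, so its Lévy
density is the sum of those of `-log β_{2,2}` and `-log β_{1,0}`. -/
theorem isInfinitelyDivisible_log_morrisLaw (hτ : 1 < τ) (hl₁ : 0 ≤ l₁) (hl₂ : 0 ≤ l₂) :
    IsInfinitelyDivisible ((morrisLaw τ l₁ l₂).map Real.log) := by
  have hτ0 : 0 < τ := by linarith
  have hb₁ : 0 < 1 + τ * l₁ := by positivity
  have hb₂ : 0 < 1 + τ * l₂ := by positivity
  have hA : 0 < τ * (l₁ + l₂ + 1) + 1 := by positivity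
  have := isProbabilityMeasure_morrisLaw hτ hl₁ hl₂
  have := Measure.isProbabilityMeasure_map (μ := morrisLaw τ l₁ l₂) Real.measurable_log.aemeasurable
  set A : ℝ := τ * (l₁ + l₂ + 1) + 1 with hAdef
  set h := betaTwoTwoKernel τ (1 + τ * l₁) (1 + τ * l₂) with hh
  set f := bernoulliGen ![τ] with hf
  have hm : Measurable h := measurable_betaTwoTwoKernel
  have hfm : Measurable f := (continuous_bernoulliGen (forall_pos_single hτ0)).measurable
  have hC := abs_betaTwoTwoKernel_le hτ0 hb₁ hb₂
  rw [← hh] at hC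
  set C : ℝ := ((1 + τ * l₁) / 1 + 1) * ((1 + τ * l₂) / τ + 1) with hCdef
  have h0 : ∀ t, 0 < t → 0 ≤ h t := fun t ht => betaTwoTwoKernel_nonneg hτ0 hb₁ hb₂ ht
  have hf0 : ∀ t, 0 < t → 0 ≤ f t := fun t ht =>
    (bernoulliGen_pos (forall_pos_single hτ0) ht).le
  have hfl : ∀ t, 0 < t → τ⁻¹ ≤ f t := fun t ht => inv_le_bernoulliGen_single hτ0 ht
  have hfu : ∀ t, 0 < t → f t ≤ τ⁻¹ + t := fun t ht => bernoulliGen_single_le hτ0 ht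
  have hae : ∀ {p : ℝ → Prop}, (∀ t, 0 < t → p t) → ∀ᵐ t ∂(volume.restrict (Set.Ioi (0 : ℝ))), p t :=
    fun hp => (ae_restrict_iff' measurableSet_Ioi).2 (ae_of_all _ hp)
  -- integrability of the first and second moments of the two Lévy densities
  have j1 : IntegrableOn (fun t => Real.exp (-(τ * t)) * h t) (Set.Ioi 0) := by
    refine ((integrableOn_exp_neg_mul_Ioi_zero hτ0).const_mul C).mono' (by fun_prop)
      (hae fun t ht => ?_)
    rw [norm_mul, Real.norm_of_nonneg (Real.exp_pos _).le, mul_comm]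
    exact mul_le_mul_of_nonneg_right (hC t ht) (Real.exp_pos _).le
  have j2 : IntegrableOn (fun t => t * (Real.exp (-(τ * t)) * h t)) (Set.Ioi 0) := by
    refine ((integrableOn_mul_exp_neg_mul_Ioi_zero hτ0).const_mul C).mono' (by fun_prop)
      (hae fun t ht => ?_)
    rw [norm_mul, norm_mul, Real.norm_of_nonneg (Real.exp_pos _).le, Real.norm_of_nonneg ht.le]
    have := mul_le_mul_of_nonneg_left (hC t ht) (mul_pos ht (Real.exp_pos (-(τ * t)))).le
    rw [Real.norm_eq_abs]
    linarith
  have j3 : IntegrableOn (fun t => Real.exp (-(A * t)) * f t) (Set.Ioi 0) := by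
    refine (((integrableOn_exp_neg_mul_Ioi_zero hA).const_mul τ⁻¹).add
      (integrableOn_mul_exp_neg_mul_Ioi_zero hA)).mono' (by fun_prop) (hae fun t ht => ?_)
    rw [Real.norm_of_nonneg (mul_nonneg (Real.exp_pos _).le (hf0 t ht)), Pi.add_apply]
    have := mul_le_mul_of_nonneg_left (hfu t ht) (Real.exp_pos (-(A * t))).le
    linarith
  have j4 : IntegrableOn (fun t => Real.exp (-(A * t)) * (f t - τ⁻¹) / t) (Set.Ioi 0) := by
    refine (integrableOn_exp_neg_mul_Ioi_zero hA).mono' (Measurable.aestronglyMeasurable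
      (by fun_prop)) (hae fun t ht => ?_)
    have h1 : 0 ≤ f t - τ⁻¹ := sub_nonneg.2 (hfl t ht)
    rw [Real.norm_of_nonneg (by positivity), div_le_iff₀ ht]
    exact mul_le_mul_of_nonneg_left (by linarith [hfu t ht]) (Real.exp_pos _).le
  have j5 : IntegrableOn (fun t => (Real.exp (-(A * t)) - Real.exp (-(1 * t))) / t * τ⁻¹)
      (Set.Ioi 0) :=
    integrableOn_frullani_real (h := fun _ => τ⁻¹) measurable_const (fun _ _ => le_rfl) hA one_pos
  -- Up to the compensator, the first moment of the density of `-log β_{1,0}` is the sum of `j4`,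
  -- bounded at `0`, and the Frullani integrand `j5`.
  refine isInfinitelyDivisible_of_charFun
    (k := fun t => Real.exp (-(τ * t)) / t * h t + Real.exp (-(A * t)) * f t / t ^ 2)
    (c := fun t => Real.exp (-t) / (τ * t)) (by fun_prop) (by fun_prop)
    (fun t ht => ?_) ?_ ?_ (Real.log (morrisConst τ)) fun u => ?_
  · have := h0 t ht
    have := hf0 t ht
    positivity
  · refine Integrable.congr (j2.add j3) (hae fun t ht => ?_)
    simp only [Pi.add_apply]
    field_simp
  · refine Integrable.congr ((j1.add j4).add j5) (hae fun t ht => ?_)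
    simp only [Pi.add_apply, one_mul]
    field_simp
    ring
  · have hre : ((u : ℂ) * Complex.I).re = 0 := by simp
    obtain ⟨i10, e10⟩ := barnesEta_one_zero_eq_exp hτ0 hA u
    have hτre : 0 < (τ : ℂ).re := by simpa using hτ0
    have i22 := integrableOn_frullani hm hC (w := -(u * Complex.I) + τ) (w₀ := τ)
      (by simpa using hτ0) hτre
    rw [charFun_map_log (ae_pos_morrisLaw hτ hl₁ hl₂),
      (mellin_morrisLaw_eq_mul hτ hl₁ hl₂ (by rw [hre]; exact hτ0)).2, ← hAdef, e10,
      barnesEta_two_two hτ0 hτ0 hb₁ hb₂ (by rw [Complex.neg_re, hre]; linarith), ← hh,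
      cpow_eq_exp_mul_log (morrisConst_pos hτ), ← Complex.exp_add, ← Complex.exp_add,
      ← integral_add i22 i10]
    congr 2
    refine setIntegral_congr_fun measurableSet_Ioi fun t ht => ?_
    rw [show -((-(u * Complex.I) + (τ : ℂ)) * (t : ℂ)) = u * t * Complex.I + -((τ : ℂ) * t) by ring,
      Complex.exp_add]
    push_cast
    ring

end Divisible

end MorrisIntegral

open MorrisIntegral in
theorem theorem4p1 (τ l₁ l₂ : ℝ) (hτ : 1 < τ) (hl₁ : 0 ≤ l₁) (hl₂ : 0 ≤ l₂) :
    -- the function reproduces the Morris product at the integers `n < τ`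
    (∀ n : ℕ, (n : ℝ) < τ → morrisMellin (n : ℂ) τ l₁ l₂ = (morrisProduct n τ l₁ l₂ : ℂ)) ∧
    -- the factors exist and are uniquely determined by their Mellin transforms
    (∃! μ : MeasureTheory.Measure ℝ,
      IsBarnesBeta ![1, τ] τ ![1 + τ * l₁, 1 + τ * l₂] μ) ∧
    (∃! μ : MeasureTheory.Measure ℝ,
      IsBarnesBeta ![τ] (τ * (l₁ + l₂ + 1) + 1) ![] μ) ∧
    -- the function is the Mellin transform of the law of the product on `(0, ∞)`
    MeasureTheory.IsProbabilityMeasure (morrisLaw τ l₁ l₂) ∧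
    (∀ᵐ x ∂(morrisLaw τ l₁ l₂), 0 < x) ∧
    (∀ q : ℂ, q.re < τ →
      MeasureTheory.Integrable (fun x : ℝ => (x : ℂ) ^ q) (morrisLaw τ l₁ l₂) ∧
      ∫ x : ℝ, (x : ℂ) ^ q ∂(morrisLaw τ l₁ l₂) = morrisMellin q τ l₁ l₂) ∧
    -- infinite divisibility, determinacy, negative moments
    IsInfinitelyDivisible ((morrisLaw τ l₁ l₂).map Real.log) ∧
    StieltjesDeterminate ((morrisLaw τ l₁ l₂).map (fun x => x⁻¹)) ∧
    (∀ n : ℕ, MeasureTheory.Integrable (fun x : ℝ => (x ^ n)⁻¹) (morrisLaw τ l₁ l₂) ∧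
      ∫ x : ℝ, (x ^ n)⁻¹ ∂(morrisLaw τ l₁ l₂) =
        ((2 * Real.pi) ^ n)⁻¹ * ∏ j ∈ Finset.range n,
          Real.Gamma (1 + l₁ + (j + 1) / τ) * Real.Gamma (1 + l₂ + (j + 1) / τ)
              * Real.Gamma (1 - 1 / τ)
            / (Real.Gamma (1 + l₁ + l₂ + (j + 1) / τ) * Real.Gamma (1 + j / τ))) ∧
    -- involution invariance, away from the poles of the two sides
    (∀ q : ℂ, (∀ m n : ℕ, 0 < m + n → q ≠ m + n * (τ : ℂ)) →
      (∀ m n : ℕ, q ≠ τ * (l₁ + l₂ + 1) + 1 + m + n * (τ : ℂ)) →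
      -- with the powers of `Γ(1 - τ)` and `Γ(1 - 1/τ)` cancelled
      ((((1 / τ) ^ τ : ℝ) : ℂ) ^ (q / τ) * morrisRatio (q / τ) (1 / τ) (τ * l₁) (τ * l₂)
          * Complex.Gamma (1 - q / τ) =
        ((τ ^ (1 / τ) : ℝ) : ℂ) ^ q * morrisRatio q τ l₁ l₂ * Complex.Gamma (1 - q)) ∧
      -- with those powers written out, when `Γ(1 - τ)` is finite
      ((∀ k : ℕ, τ ≠ k) →
        morrisMellin (q / τ) (1 / τ) (τ * l₁) (τ * l₂) * ((2 * Real.pi : ℝ) : ℂ) ^ (-(q / τ))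
            * ((Real.Gamma (1 - τ) : ℝ) : ℂ) ^ (q / τ) * Complex.Gamma (1 - q / τ) =
          morrisMellin q τ l₁ l₂ * ((2 * Real.pi : ℝ) : ℂ) ^ (-q)
            * ((Real.Gamma (1 - 1 / τ) : ℝ) : ℂ) ^ q * Complex.Gamma (1 - q))) ∧
    -- the special case of vanishing parameters
    (∀ q : ℂ, (∀ m n : ℕ, q ≠ τ + m + n * (τ : ℂ)) →
      morrisMellin q τ 0 0 =
        ((2 * Real.pi : ℝ) : ℂ) ^ q / ((Real.Gamma (1 - 1 / τ) : ℝ) : ℂ) ^ q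
          * Complex.Gamma (1 - q / τ)) ∧
    (∃! μ : MeasureTheory.Measure ℝ, IsBarnesBeta ![τ] τ ![] μ) ∧
    morrisLaw τ 0 0 = (barnesBeta ![τ] τ ![]).map (fun y => morrisConst τ * y⁻¹) := by
  have hτ0 : 0 < τ := by linarith
  have hA : 0 < τ * (l₁ + l₂ + 1) + 1 := by positivity
  refine ⟨fun n _ => morrisMellin_natCast hτ hl₁ hl₂ n, ?_, ?_,
    isProbabilityMeasure_morrisLaw hτ hl₁ hl₂, ae_pos_morrisLaw hτ hl₁ hl₂,
    fun q hq => mellin_morrisLaw hτ hl₁ hl₂ hq, isInfinitelyDivisible_log_morrisLaw hτ hl₁ hl₂,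
    stieltjesDeterminate_inv_morrisLaw hτ hl₁ hl₂,
    fun n => integral_inv_pow_morrisLaw hτ hl₁ hl₂ n,
    fun q _ _ => ⟨morrisRatio_involution hτ0 q, fun hk => morrisMellin_involution hτ hk q⟩,
    fun q hq => morrisMellin_zero_zero hτ0 hq, ?_, morrisLaw_zero_zero hτ⟩
  · obtain ⟨μ, hμ⟩ := exists_isBarnesBeta_morrisBeta22 hτ hl₁ hl₂
    exact ⟨μ, hμ, fun ν hν => hν.eq hτ0 hμ⟩
  · exact ⟨_, isBarnesBeta_betaOneZero hτ0 hA, fun ν hν => hν.eq hA (isBarnesBeta_betaOneZero hτ0 hA)⟩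
  · exact ⟨_, isBarnesBeta_betaOneZero hτ0 hτ0,
      fun ν hν => hν.eq hτ0 (isBarnesBeta_betaOneZero hτ0 hτ0)⟩
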